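/- Let $c,T>0$. For each $n$ let $m=m(n)\in\mathbb N$ with $m/n^2\to c$ as $n\to\infty$, let $\tau_\alpha=\tau_\alpha^{(n)}\in[0,T]$ ($1\le\alpha\le m$), and let $\sigma$ be a probability measure on $\mathbb R$ such that the normalized counting measure $\sigma_n=\frac1m\sum_{\alpha}\delta_{\tau_\alpha}$ satisfies, for some constant $C$, all $n\ge1$ and all bounded continuous $\varphi:\mathbb R\to\mathbb R$, $\left|\int\varphi\,d\sigma_n-\int\varphi\,d\sigma\right|\le Cn^{-2}\sup|\varphi|$. Let $\mathbf y_\alpha^{(1)},\mathbf y_\alpha^{(2)}$ ($1\le\alpha\le m$) be independent random vectors uniformly distributed on the unit sphere of $\mathbb R^n$, $Y_\alpha=\mathbf y_\alpha^{(1)}\otimes\mathbf y_\alpha^{(2)}\in\mathbb R^{n^2}$, $M_n=\sum_\alpha\tau_\alpha Y_\alpha Y_\alpha^T$, $G(z)=(M_n-z)^{-1}$, $G^\alpha(z)=(M_n-\tau_\alpha Y_\alpha Y_\alpha^T-z)^{-1}$, and put $$A_\alpha=1+\tau_\alpha(G^\alpha Y_\alpha,Y_\alpha),\quad B_\alpha=\tau_\alpha((G^\alpha)^2Y_\alpha,Y_\alpha),\quad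 \gamma_n=\mathrm{Tr}\,G,\quad f_n=n^{-2}\,\mathbf E\gamma_n,$$ $$f_n^{(1)}(z_1,z_2)=\mathbf E\,\frac1{n^3}\sum_{j,s,p,q=1}^n G_{js,ps}(z_1)G_{jq,pq}(z_2),\qquad f_n^{(2)}(z_1,z_2)=\mathbf E\,\frac1{n^2}\sum_{j,s,p,q=1}^n G_{js,pq}(z_1)G_{ps,jq}(z_2).$$ For a complex random variable $\xi$ let $\mathrm{Var}\,\xi=\mathbf E|\xi-\mathbf E\xi|^2$. Let $f$ be the solution of $$zf(z)=-1+c-\int\frac{c\,d\sigma(\tau)}{1+\tau f(z)},\qquad \Im z\ne0,$$ in the class of functions analytic in $\mathbb C\setminus\mathbb R$ with $\Im f(z)\,\Im z\ge0$. Then there is $\eta_0>0$, depending only on $c$ and $T$, such that, as $n\to\infty$, uniformly in $\alpha$ and in $z,z_1,z_2$ with $|\Im z|,|\Im z_1|,|\Im z_2|>\eta_0$: (i) $\mathrm{Var}\,A_\alpha(z)=O(n^{-2})$, $\mathrm{Var}\,B_\alpha(z)=O(n^{-2})$, $\mathrm{Var}\,\gamma_n(z)=O(1)$; and if moreover $|m-cn^2|\le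 K$ for all $n\ge1$ with some constant $K$ (in particular if $m=cn^2$), then (ii) $f_n(z)=f(z)+O(n^{-2})$; (iii) $f_n^{(1)}(z_1,z_2)=f(z_1)f(z_2)+\dfrac1n\displaystyle\int\frac{c\tau^2f^2(z_1)f^2(z_2)\,d\sigma(\tau)}{(1+\tau f(z_1))(1+\tau f(z_2))}+O(n^{-3/2})$; (iv) $f_n^{(2)}(z_1,z_2)=f(z_1)f(z_2)+\displaystyle\int\frac{c\tau^2f^2(z_1)f^2(z_2)\,d\sigma(\tau)}{(1+\tau f(z_1))(1+\tau f(z_2))}+O(n^{-1/2})$. The implied constants depend only on $c,T,C,K$ (with $\eta_0$ chosen as a function of $c,T$). -/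

import Mathlib

open MeasureTheory Filter Topology Matrix
open scoped BoundedContinuousFunction

noncomputable section

namespace TensorSampleCov

/-- The unit sphere of the Euclidean space of dimension `n`. -/
abbrev Sph (n : ℕ) : Type := Metric.sphere (0 : EuclideanSpace ℝ (Fin n)) 1

/-- The uniform probability distribution on the unit sphere: normalized surface measure. -/
def unifSphere (n : ℕ) : Measure (Sph n) :=
  ((volume : Measure (EuclideanSpace ℝ (Fin n))).toSphere Set.univ)⁻¹ •
    (volume : Measure (EuclideanSpace ℝ (Fin n))).toSphere

/-- The sample space: an `m`-tuple of pairs of points of the unit sphere. -/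
abbrev Sample (n m : ℕ) : Type := Fin m → Sph n × Sph n

/-- The law of the sample: the `2 m` vectors are independent and uniform on the sphere. -/
def law (n m : ℕ) : Measure (Sample n m) :=
  Measure.pi fun _ => (unifSphere n).prod (unifSphere n)

section Model

variable {n m : ℕ}

/-- The tensor product vector `Y_α`, with entries `y⁽¹⁾_{α i} y⁽²⁾_{α j}` (as complex numbers). -/
def tensorVec (ω : Sample n m) (α : Fin m) : Fin n × Fin n → ℂ := fun p =>
  (((ω α).1 : EuclideanSpace ℝ (Fin n)) p.1 * ((ω α).2 : EuclideanSpace ℝ (Fin n)) p.2 : ℝ)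

/-- The matrix `∑_{β ∈ S} τ_β Y_β Y_βᵀ`. -/
def covMat (τ : Fin m → ℝ) (S : Finset (Fin m)) (ω : Sample n m) :
    Matrix (Fin n × Fin n) (Fin n × Fin n) ℂ :=
  ∑ β ∈ S, (τ β : ℂ) • vecMulVec (tensorVec ω β) (tensorVec ω β)

/-- The resolvent `(∑_{β ∈ S} τ_β Y_β Y_βᵀ - z)⁻¹`. -/
def resolventOn (τ : Fin m → ℝ) (S : Finset (Fin m)) (z : ℂ) (ω : Sample n m) :
    Matrix (Fin n × Fin n) (Fin n × Fin n) ℂ :=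
  (covMat τ S ω - z • (1 : Matrix (Fin n × Fin n) (Fin n × Fin n) ℂ))⁻¹

/-- The resolvent `G(z) = (M_n - z)⁻¹`. -/
def G (τ : Fin m → ℝ) (z : ℂ) (ω : Sample n m) :
    Matrix (Fin n × Fin n) (Fin n × Fin n) ℂ :=
  resolventOn τ Finset.univ z ω

/-- The resolvent `G^α(z)` of `M_n - τ_α Y_α Y_αᵀ`. -/
def GMinus (τ : Fin m → ℝ) (α : Fin m) (z : ℂ) (ω : Sample n m) :
    Matrix (Fin n × Fin n) (Fin n × Fin n) ℂ :=
  resolventOn τ (Finset.univ.erase α) z ω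

/-- `A_α = 1 + τ_α (G^α Y_α, Y_α)`. -/
def A (τ : Fin m → ℝ) (α : Fin m) (z : ℂ) (ω : Sample n m) : ℂ :=
  1 + τ α * ((GMinus τ α z ω *ᵥ tensorVec ω α) ⬝ᵥ tensorVec ω α)

/-- `B_α = τ_α ((G^α)² Y_α, Y_α)`. -/
def B (τ : Fin m → ℝ) (α : Fin m) (z : ℂ) (ω : Sample n m) : ℂ :=
  τ α * (((GMinus τ α z ω ^ 2) *ᵥ tensorVec ω α) ⬝ᵥ tensorVec ω α)

/-- `γ_n = Tr G`. -/
def gam (τ : Fin m → ℝ) (z : ℂ) (ω : Sample n m) : ℂ := (G τ z ω).trace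

/-- `g_n = n⁻² γ_n`. -/
def g (τ : Fin m → ℝ) (z : ℂ) (ω : Sample n m) : ℂ := ((n : ℂ) ^ 2)⁻¹ * gam τ z ω

/-- `g_n⁽¹⁾ = n⁻³ ∑_{j,s,p,q} G_{js,ps}(z₁) G_{jq,pq}(z₂)`. -/
def g1 (τ : Fin m → ℝ) (z₁ z₂ : ℂ) (ω : Sample n m) : ℂ :=
  ((n : ℂ) ^ 3)⁻¹ * ∑ j, ∑ s, ∑ p, ∑ q, G τ z₁ ω (j, s) (p, s) * G τ z₂ ω (j, q) (p, q)

/-- `g_n⁽²⁾ = n⁻² ∑_{j,s,p,q} G_{js,pq}(z₁) G_{ps,jq}(z₂)`. -/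
def g2 (τ : Fin m → ℝ) (z₁ z₂ : ℂ) (ω : Sample n m) : ℂ :=
  ((n : ℂ) ^ 2)⁻¹ * ∑ j, ∑ s, ∑ p, ∑ q, G τ z₁ ω (j, s) (p, q) * G τ z₂ ω (p, s) (j, q)

/-- Expectation with respect to the law of the sample. -/
def expect (ξ : Sample n m → ℂ) : ℂ := ∫ ω, ξ ω ∂(law n m)

/-- Variance `E |ξ - E ξ|²` of a complex random variable. -/
def var (ξ : Sample n m → ℂ) : ℝ := ∫ ω, ‖ξ ω - expect ξ‖ ^ 2 ∂(law n m)

/-- The normalized counting measure `σ_n` of `τ_1, …, τ_m`. -/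
def countingMeasure (τ : Fin m → ℝ) : Measure ℝ :=
  (m : ENNReal)⁻¹ • ∑ α, Measure.dirac (τ α)

end Model

/-- The conditions on the weights: they are nonnegative, bounded by `T` uniformly in `α` and `n`,
and the normalized counting measures converge weakly to `σ`, at the rate
`|∫ φ dσ_n - ∫ φ dσ| ≤ C n⁻² sup |φ|` for every bounded continuous `φ` (this rate contains the
weak convergence). -/
structure ConditionA (m : ℕ → ℕ) (τ : (n : ℕ) → Fin (m n) → ℝ) (σ : Measure ℝ) (T C : ℝ) :
    Prop where
  nonneg : ∀ n α, 0 ≤ τ n α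
  le_bound : ∀ n α, τ n α ≤ T
  rate : ∀ n : ℕ, 1 ≤ n → ∀ φ : ℝ →ᵇ ℝ,
    |(∫ t, φ t ∂(countingMeasure (τ n))) - ∫ t, φ t ∂σ| ≤ C / (n : ℝ) ^ 2 * ‖φ‖

/-- `f` is the solution of `z f(z) = -1 + c - ∫ c dσ(τ) / (1 + τ f(z))` in the class of functions
analytic off the real line with `Im f(z) Im z ≥ 0`. This determines `f` off the real line. -/
structure IsLimitStieltjes (c : ℝ) (σ : Measure ℝ) (f : ℂ → ℂ) : Prop where
  analytic : DifferentiableOn ℂ f {z | z.im ≠ 0}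
  im_nonneg : ∀ z : ℂ, z.im ≠ 0 → 0 ≤ (f z).im * z.im
  equation : ∀ z : ℂ, z.im ≠ 0 →
    z * f z = -1 + c - ∫ t : ℝ, (c : ℂ) / (1 + t * f z) ∂σ

/-- `∫ c τ² f(z₁)² f(z₂)² dσ(τ) / ((1 + τ f(z₁)) (1 + τ f(z₂)))`. -/
def sigmaIntegral (c : ℝ) (σ : Measure ℝ) (f : ℂ → ℂ) (z₁ z₂ : ℂ) : ℂ :=
  ∫ t : ℝ, (c : ℂ) * (t : ℂ) ^ 2 * f z₁ ^ 2 * f z₂ ^ 2 /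
    ((1 + t * f z₁) * (1 + t * f z₂)) ∂σ

end TensorSampleCov

end

/-! Take `|Im z|` beyond `1`, `2T` and `8cT`. The resolvents are then contractions, every `A_α` has
modulus at least `1/2`, and the limiting equation is stable under perturbation. No spectral
information on `M_n` is needed. All random quantities are continuous functions on a compact product
of spheres.

Fluctuations. For `Y = y¹ ⊗ y²` the fourth moments of the sphere give `E|(HY,Y)|² ≤ n⁻⁴ (|tr H|² +
2‖tr₂ H‖² + 2‖tr₁ H‖² + 4‖H‖²)`, with Hilbert–Schmidt norms and the two partial traces
(`integral_norm_quadForm_sq_tens_le`). Apply this to `H = G^α - E G^α`. By signed permutation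
symmetry `E G^α` is scalar, so `(HY,Y)` is the form of `G^α` minus a number. Removing one summand of
`M_n` is a rank one change, which moves the trace and both partial traces by `O(1)`. `efron_stein`
over `m = O(n²)` coordinates thus bounds their second moments by `O(n²)`, and the fluctuation of
`A_α` has second moment `O(n⁻²)`. The same works for `G²` and `B_α`. Since `Tr G - Tr G^α =
-B_α/A_α` is nearly deterministic, a second use of Efron–Stein, with that deterministic value
subtracted, gives `Var γ_n = O(1)`.

First order limit. The resolvent identity gives `z Tr G = -n² + Σ (1 - 1/A_α)`. Expanding `1/A_α`
around `E A_α` leaves only the second moment as an error, so `f_n` solves the limiting equation up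
to `O(n⁻²)`, and stability gives (ii).

Pairings. Both (iii) and (iv) concern `P = n⁻² E tr(G(z₁) L(G(z₂)))` for a linear map `L` that is
selfadjoint for the trace pairing and fixes the identity: the normalized partial trace tensored with
the identity, or the partial transposition. The only difference is the size `r²` of the image of a
rank one matrix: `1/n` or `1`. The resolvent identity at `z₁`, followed by the rank one formula for
`G(z₂)`, splits each summand. One part decouples into `P/(1 + τ f(z₁))`, with error `O(r/n)`. The
other part is a rank one form. Contracting `G^α Y` with one factor of `Y` gives approximately `f`
times the other factor, with error `O(n^{-1/2})` in mean square, so this form is `r² f(z₁) f(z₂)²`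
up to `O(r² n^{-1/2})`. The resulting linear equation for `P` is solved by multiplying it by `f(z₁)`
(`PairingMap.norm_meanTr_sub_le_limit`). The error `r² n^{-1/2}` gives the two rates. -/

noncomputable section

set_option linter.unusedSectionVars false

namespace TensorSampleCov

/-! ### Hilbert–Schmidt norms, contractions and partial traces. -/

section LinearAlgebra

variable {ι κ l : Type*} [Fintype ι] [Fintype κ] [Fintype l]

/-- The squared Euclidean norm of a complex vector. -/
def nsq (v : ι → ℂ) : ℝ := ∑ i, ‖v i‖ ^ 2

/-- The squared Hilbert–Schmidt norm of a complex matrix. -/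
def hs (H : Matrix ι κ ℂ) : ℝ := ∑ i, ∑ j, ‖H i j‖ ^ 2

lemma nsq_nonneg (v : ι → ℂ) : 0 ≤ nsq v := Finset.sum_nonneg fun _ _ => by positivity

lemma hs_nonneg (H : Matrix ι κ ℂ) : 0 ≤ hs H :=
  Finset.sum_nonneg fun _ _ => Finset.sum_nonneg fun _ _ => by positivity

lemma norm_sum_mul_sq_le {s : Finset ι} (u v : ι → ℂ) :
    ‖∑ i ∈ s, u i * v i‖ ^ 2 ≤ (∑ i ∈ s, ‖u i‖ ^ 2) * ∑ i ∈ s, ‖v i‖ ^ 2 := by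
  refine le_trans ?_ (Finset.sum_mul_sq_le_sq_mul_sq s (fun i => ‖u i‖) (fun i => ‖v i‖))
  gcongr
  exact (norm_sum_le _ _).trans (by simp)

lemma norm_dotProduct_sq_le (u v : ι → ℂ) : ‖u ⬝ᵥ v‖ ^ 2 ≤ nsq u * nsq v :=
  norm_sum_mul_sq_le u v

lemma nsq_smul (c : ℂ) (v : ι → ℂ) : nsq (c • v) = ‖c‖ ^ 2 * nsq v := by
  simp [nsq, mul_pow, Finset.mul_sum]

lemma hs_smul (c : ℂ) (H : Matrix ι κ ℂ) : hs (c • H) = ‖c‖ ^ 2 * hs H := by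
  simp [hs, mul_pow, Finset.mul_sum]

lemma norm_add_sq_le (a b : ℂ) : ‖a + b‖ ^ 2 ≤ 2 * ‖a‖ ^ 2 + 2 * ‖b‖ ^ 2 := by
  have h := norm_add_le a b
  nlinarith [norm_nonneg (a + b), sq_nonneg (‖a‖ - ‖b‖), norm_nonneg a, norm_nonneg b]

lemma norm_sub_sq_le (a b : ℂ) : ‖a - b‖ ^ 2 ≤ 2 * ‖a‖ ^ 2 + 2 * ‖b‖ ^ 2 := by
  simpa [sub_eq_add_neg] using norm_add_sq_le a (-b)

lemma hs_add_le (H K : Matrix ι κ ℂ) : hs (H + K) ≤ 2 * hs H + 2 * hs K := by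
  simp only [hs, Finset.mul_sum, ← Finset.sum_add_distrib]
  exact Finset.sum_le_sum fun i _ => Finset.sum_le_sum fun j _ => norm_add_sq_le _ _

lemma hs_neg (H : Matrix ι κ ℂ) : hs (-H) = hs H := by simp [hs]

lemma hs_sub_le (H K : Matrix ι κ ℂ) : hs (H - K) ≤ 2 * hs H + 2 * hs K := by
  simpa [sub_eq_add_neg, hs_neg] using hs_add_le H (-K)

lemma hs_transpose (H : Matrix ι κ ℂ) : hs Hᵀ = hs H := Finset.sum_comm

lemma hs_vecMulVec (u : ι → ℂ) (v : κ → ℂ) : hs (vecMulVec u v) = nsq u * nsq v := by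
  simp [hs, nsq, vecMulVec_apply, mul_pow, Finset.sum_mul_sum]

lemma nsq_mulVec_le (K : Matrix ι κ ℂ) (v : κ → ℂ) : nsq (K *ᵥ v) ≤ hs K * nsq v := by
  rw [hs, Finset.sum_mul]
  exact Finset.sum_le_sum fun i _ => norm_dotProduct_sq_le (fun j => K i j) v

lemma norm_trace_mul_sq_le (H : Matrix ι κ ℂ) (K : Matrix κ ι ℂ) :
    ‖(H * K).trace‖ ^ 2 ≤ hs H * hs K := by
  have h := norm_sum_mul_sq_le (s := Finset.univ) (fun p : ι × κ => H p.1 p.2)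
    (fun p : ι × κ => K p.2 p.1)
  rw [Fintype.sum_prod_type, Fintype.sum_prod_type, Fintype.sum_prod_type] at h
  rw [← hs_transpose K]
  simpa [Matrix.trace, Matrix.mul_apply, hs] using h

/-- A matrix that does not increase the Euclidean norm. -/
def Contr (K : Matrix ι κ ℂ) : Prop := ∀ v, nsq (K *ᵥ v) ≤ nsq v

lemma hs_eq_sum_nsq (H : Matrix ι κ ℂ) : hs H = ∑ j, nsq (fun i => H i j) := Finset.sum_comm

lemma Contr.hs_mul_le {K : Matrix ι κ ℂ} (hK : Contr K) (H : Matrix κ l ℂ) :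
    hs (K * H) ≤ hs H := by
  rw [hs_eq_sum_nsq, hs_eq_sum_nsq]
  exact Finset.sum_le_sum fun j _ => hK (fun i => H i j)

lemma hs_one [DecidableEq ι] : hs (1 : Matrix ι ι ℂ) = Fintype.card ι := by
  simp [hs, Matrix.one_apply, apply_ite norm, ite_pow]

lemma Contr.hs_le [DecidableEq κ] {K : Matrix ι κ ℂ} (hK : Contr K) : hs K ≤ Fintype.card κ := by
  simpa [hs_one] using hK.hs_mul_le (1 : Matrix κ κ ℂ)

/-- Partial trace over the second tensor factor. -/
def ptrR (H : Matrix (ι × κ) (ι × κ) ℂ) : Matrix ι ι ℂ := fun j p => ∑ s, H (j, s) (p, s)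

/-- Partial trace over the first tensor factor. -/
def ptrL (H : Matrix (ι × κ) (ι × κ) ℂ) : Matrix κ κ ℂ := fun s q => ∑ j, H (j, s) (j, q)

lemma ptrR_sub (H K : Matrix (ι × κ) (ι × κ) ℂ) : ptrR (H - K) = ptrR H - ptrR K := by
  ext; simp [ptrR]

lemma ptrL_sub (H K : Matrix (ι × κ) (ι × κ) ℂ) : ptrL (H - K) = ptrL H - ptrL K := by
  ext; simp [ptrL]

lemma ptrR_add (H K : Matrix (ι × κ) (ι × κ) ℂ) : ptrR (H + K) = ptrR H + ptrR K := by
  ext; simp [ptrR, Finset.sum_add_distrib]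

lemma ptrL_add (H K : Matrix (ι × κ) (ι × κ) ℂ) : ptrL (H + K) = ptrL H + ptrL K := by
  ext; simp [ptrL, Finset.sum_add_distrib]

lemma ptrR_smul (c : ℂ) (H : Matrix (ι × κ) (ι × κ) ℂ) : ptrR (c • H) = c • ptrR H := by
  ext; simp [ptrR, Finset.mul_sum]

lemma ptrL_smul (c : ℂ) (H : Matrix (ι × κ) (ι × κ) ℂ) : ptrL (c • H) = c • ptrL H := by
  ext; simp [ptrL, Finset.mul_sum]

lemma trace_ptrR (H : Matrix (ι × κ) (ι × κ) ℂ) : (ptrR H).trace = H.trace := by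
  simp [ptrR, Matrix.trace, Fintype.sum_prod_type]

lemma norm_sum_sq_le_card (v : κ → ℂ) :
    ‖∑ s, v s‖ ^ 2 ≤ Fintype.card κ * ∑ s, ‖v s‖ ^ 2 := by
  simpa using norm_sum_mul_sq_le (s := Finset.univ) (fun _ : κ => (1 : ℂ)) v

lemma hs_ptrR_le (H : Matrix (ι × κ) (ι × κ) ℂ) : hs (ptrR H) ≤ Fintype.card κ * hs H := by
  have h1 : hs (ptrR H) ≤ ∑ j, ∑ p, (Fintype.card κ : ℝ) * ∑ s, ‖H (j, s) (p, s)‖ ^ 2 :=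
    Finset.sum_le_sum fun j _ => Finset.sum_le_sum fun p _ => norm_sum_sq_le_card _
  refine h1.trans ?_
  simp only [hs, Fintype.sum_prod_type, ← Finset.mul_sum]
  gcongr with j
  rw [Finset.sum_comm]
  gcongr with s hs p
  exact Finset.single_le_sum (f := fun q => ‖H (j, s) (p, q)‖ ^ 2) (fun _ _ => by positivity)
    (Finset.mem_univ s)

/-- Exchange of the two tensor factors. -/
def swapT (H : Matrix (ι × κ) (ι × κ) ℂ) : Matrix (κ × ι) (κ × ι) ℂ :=
  H.submatrix Prod.swap Prod.swap

lemma ptrR_swapT (H : Matrix (ι × κ) (ι × κ) ℂ) : ptrR (swapT H) = ptrL H := rfl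

lemma hs_swapT (H : Matrix (ι × κ) (ι × κ) ℂ) : hs (swapT H) = hs H := by
  simp only [hs, swapT, Matrix.submatrix_apply]
  rw [← (Equiv.prodComm κ ι).sum_comp]
  refine Finset.sum_congr rfl fun i _ => ?_
  rw [← (Equiv.prodComm κ ι).sum_comp]
  rfl

lemma hs_ptrL_le (H : Matrix (ι × κ) (ι × κ) ℂ) : hs (ptrL H) ≤ Fintype.card ι * hs H := by
  rw [← ptrR_swapT, ← hs_swapT H]
  exact hs_ptrR_le _

/-- Reshape `u` and `v` into matrices `U` and `V`: the partial trace is `U Vᵀ`, and Cauchy–Schwarz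
applies to each entry. The dimension factor of `hs_ptrR_le` is absent, and for this reason partial
traces of resolvents have bounded differences. -/
lemma hs_ptrR_vecMulVec_le (u v : ι × κ → ℂ) : hs (ptrR (vecMulVec u v)) ≤ nsq u * nsq v := by
  simp only [nsq, Fintype.sum_prod_type, Finset.sum_mul_sum, hs, ptrR, vecMulVec_apply]
  refine Finset.sum_le_sum fun j _ => Finset.sum_le_sum fun p _ => ?_
  simpa [Finset.sum_mul_sum] using
    norm_sum_mul_sq_le (s := Finset.univ) (fun s => u (j, s)) (fun s => v (p, s))

lemma nsq_swap (u : ι × κ → ℂ) : nsq (u ∘ Prod.swap) = nsq u :=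
  (Equiv.prodComm κ ι).sum_comp fun p => ‖u p‖ ^ 2

lemma hs_ptrL_vecMulVec_le (u v : ι × κ → ℂ) : hs (ptrL (vecMulVec u v)) ≤ nsq u * nsq v := by
  rw [← nsq_swap u, ← nsq_swap v]
  exact hs_ptrR_vecMulVec_le (u ∘ Prod.swap) (v ∘ Prod.swap)

lemma norm_trace_vecMulVec_sq_le (u v : ι → ℂ) :
    ‖(vecMulVec u v).trace‖ ^ 2 ≤ nsq u * nsq v := by
  rw [Matrix.trace_vecMulVec]
  exact norm_dotProduct_sq_le _ _

/-- The functional controlling the second moment of the quadratic form of a tensor product of two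
independent uniform vectors of the sphere. -/
def quadFun (H : Matrix (ι × κ) (ι × κ) ℂ) : ℝ :=
  ‖H.trace‖ ^ 2 + 2 * hs (ptrR H) + 2 * hs (ptrL H) + 4 * hs H

end LinearAlgebra

/-! ### Deterministic resolvent bounds and the rank one formula. -/

section Resolvent

variable {ι : Type*} [Fintype ι] [DecidableEq ι]

lemma im_star_dotProduct_hermitian {M : Matrix ι ι ℂ} (hM : M.IsHermitian) (x : ι → ℂ) :
    (star x ⬝ᵥ (M *ᵥ x)).im = 0 := hM.im_star_dotProduct_mulVec_self x

lemma star_dotProduct_self_eq_nsq (x : ι → ℂ) : star x ⬝ᵥ x = (nsq x : ℂ) := by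
  simp [nsq, dotProduct, ← Complex.conj_mul']

lemma nsq_star (x : ι → ℂ) : nsq (star x) = nsq x := by simp [nsq]

/-- The lower bound `‖(M - z) x‖ ≥ |Im z| ‖x‖` for Hermitian `M`. -/
lemma nsq_sub_smul_ge {M : Matrix ι ι ℂ} (hM : M.IsHermitian) (z : ℂ) (x : ι → ℂ) :
    z.im ^ 2 * nsq x ≤ nsq ((M - z • (1 : Matrix ι ι ℂ)) *ᵥ x) := by
  set v := (M - z • (1 : Matrix ι ι ℂ)) *ᵥ x with hv
  -- The Hermitian matrix contributes a real number, so only `z` is seen by the imaginary part;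
  -- Cauchy–Schwarz then bounds `‖v‖` from below.
  have h1 : (star x ⬝ᵥ v).im = -(z.im * nsq x) := by
    rw [hv, Matrix.sub_mulVec, dotProduct_sub, Matrix.smul_mulVec, Matrix.one_mulVec,
      dotProduct_smul, star_dotProduct_self_eq_nsq, Complex.sub_im,
      im_star_dotProduct_hermitian hM]
    simp
  have h2 : (z.im * nsq x) ^ 2 ≤ nsq x * nsq v := by
    have h3 := norm_dotProduct_sq_le (star x) v
    rw [nsq_star] at h3
    have h4 := Complex.abs_im_le_norm (star x ⬝ᵥ v)
    rw [h1, abs_neg] at h4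
    have h5 : |z.im * nsq x| ^ 2 ≤ ‖star x ⬝ᵥ v‖ ^ 2 := by gcongr
    rw [sq_abs] at h5
    exact h5.trans h3
  rcases (nsq_nonneg x).eq_or_lt with h0 | h0
  · rw [← h0, mul_zero]; exact nsq_nonneg _
  · refine le_of_mul_le_mul_left ?_ h0
    calc nsq x * (z.im ^ 2 * nsq x) = (z.im * nsq x) ^ 2 := by ring
      _ ≤ _ := h2

lemma nsq_eq_zero {x : ι → ℂ} : nsq x = 0 ↔ x = 0 := by
  simp [nsq, Finset.sum_eq_zero_iff_of_nonneg, funext_iff]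

lemma isUnit_det_sub_smul {M : Matrix ι ι ℂ} (hM : M.IsHermitian) {z : ℂ} (hz : z.im ≠ 0) :
    IsUnit (M - z • (1 : Matrix ι ι ℂ)).det := by
  rw [isUnit_iff_ne_zero]
  intro h
  obtain ⟨x, hx, hx0⟩ := Matrix.exists_mulVec_eq_zero_iff.2 h
  have h1 := nsq_sub_smul_ge hM z x
  rw [hx0] at h1
  have h2 : nsq x = 0 := by
    have h3 : nsq (0 : ι → ℂ) = 0 := nsq_eq_zero.2 rfl
    have h4 : 0 < z.im ^ 2 := by positivity
    have h5 := nsq_nonneg x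
    nlinarith
  exact hx (nsq_eq_zero.1 h2)

lemma nsq_resolvent_le {M : Matrix ι ι ℂ} (hM : M.IsHermitian) {z : ℂ} (hz : z.im ≠ 0)
    (v : ι → ℂ) : z.im ^ 2 * nsq ((M - z • (1 : Matrix ι ι ℂ))⁻¹ *ᵥ v) ≤ nsq v := by
  have h := nsq_sub_smul_ge hM z ((M - z • (1 : Matrix ι ι ℂ))⁻¹ *ᵥ v)
  rwa [Matrix.mulVec_mulVec, Matrix.mul_nonsing_inv _ (isUnit_det_sub_smul hM hz),
    Matrix.one_mulVec] at h

/-- Rank one perturbation of a symmetric resolvent. -/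
lemma inv_rankOne {W W₀ : Matrix ι ι ℂ} {y : ι → ℂ} {t : ℂ} (hW : W = W₀ + t • vecMulVec y y)
    (hu : IsUnit W.det) (hu₀ : IsUnit W₀.det) (hs : Wᵀ = W) :
    W₀⁻¹ = W⁻¹ + t • vecMulVec (W₀⁻¹ *ᵥ y) (W⁻¹ *ᵥ y) ∧
      (1 + t * ((W₀⁻¹ *ᵥ y) ⬝ᵥ y)) • (W⁻¹ *ᵥ y) = W₀⁻¹ *ᵥ y := by
  have h1 : W₀⁻¹ = W⁻¹ + t • vecMulVec (W₀⁻¹ *ᵥ y) (W⁻¹ *ᵥ y) := by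
    have hsym : y ᵥ* W⁻¹ = W⁻¹ *ᵥ y := by
      rw [← Matrix.mulVec_transpose, Matrix.transpose_nonsing_inv, hs]
    -- Insert `W * W⁻¹` after `W₀⁻¹` and expand the first `W` as `W₀ + t y yᵀ`.
    have h2 : W₀⁻¹ * W * W⁻¹ = W₀⁻¹ := by
      rw [Matrix.mul_assoc, Matrix.mul_nonsing_inv _ hu, Matrix.mul_one]
    rw [← hsym, ← Matrix.vecMulVec_mul, ← Matrix.mul_vecMulVec]
    conv_lhs => rw [← h2, hW, Matrix.mul_add, Matrix.nonsing_inv_mul _ hu₀, ← hW]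
    rw [Matrix.add_mul, Matrix.one_mul]
    simp [Matrix.mul_assoc]
  refine ⟨h1, ?_⟩
  have hsym₀ : (W₀⁻¹)ᵀ = W₀⁻¹ := by
    rw [Matrix.transpose_nonsing_inv]
    congr 1
    have : W₀ = W - t • vecMulVec y y := by rw [hW]; simp
    rw [this]; simp [hs]
  -- The first identity is transposed before it is applied to `y`, so that the scalar produced is
  -- the form of `W₀⁻¹` and not that of `W⁻¹`.
  have h3 : W₀⁻¹ *ᵥ y = W⁻¹ *ᵥ y + t • (((W₀⁻¹ *ᵥ y) ⬝ᵥ y) • (W⁻¹ *ᵥ y)) := by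
    have hT := congrArg Matrix.transpose h1
    rw [hsym₀, Matrix.transpose_add, Matrix.transpose_nonsing_inv, hs, Matrix.transpose_smul,
      Matrix.transpose_vecMulVec] at hT
    conv_lhs => rw [hT]
    rw [Matrix.add_mulVec, Matrix.smul_mulVec, Matrix.vecMulVec_mulVec]
    simp
  rw [add_smul, one_smul, mul_smul]
  exact h3.symm

end Resolvent

section Probability

/-! ### Second moments on a compact probability space. -/

section OneSpace

variable {X : Type*} [TopologicalSpace X] [CompactSpace X] [MeasurableSpace X]
  [OpensMeasurableSpace X] {μ : Measure X}

/-- All random quantities of the proof are continuous on a compact space; this settles every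
question of integrability there. -/
lemma integrable_of_continuous [IsFiniteMeasure μ] {V : Type*} [NormedAddCommGroup V]
    [SecondCountableTopology V] {F : X → V} (hF : Continuous F) : Integrable F μ := by
  borelize V
  obtain ⟨C, hC⟩ := (isCompact_range hF).isBounded.exists_norm_le
  exact Integrable.of_bound hF.measurable.aestronglyMeasurable C
    (Eventually.of_forall fun x => hC _ ⟨x, rfl⟩)

variable [IsProbabilityMeasure μ]

/-- The bias-variance identity. -/
lemma integral_norm_sub_sq {F : X → ℂ} (hF : Continuous F) (c : ℂ) :
    ∫ x, ‖F x - c‖ ^ 2 ∂μ = ∫ x, ‖F x - ∫ y, F y ∂μ‖ ^ 2 ∂μ + ‖(∫ y, F y ∂μ) - c‖ ^ 2 := by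
  set e := ∫ y, F y ∂μ with he
  have h1 : ∀ x, ‖F x - c‖ ^ 2 =
      ‖F x - e‖ ^ 2 + (2 * ((F x - e) * (starRingEnd ℂ) (e - c)).re + ‖e - c‖ ^ 2) := by
    intro x
    have : F x - c = (F x - e) + (e - c) := by ring
    rw [this, ← Complex.normSq_eq_norm_sq, ← Complex.normSq_eq_norm_sq,
      ← Complex.normSq_eq_norm_sq, Complex.normSq_add]
    ring
  simp_rw [h1]
  have hi : Integrable (fun x => (F x - e) * (starRingEnd ℂ) (e - c)) μ :=
    integrable_of_continuous (by fun_prop)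
  have hre : ∫ x, ((F x - e) * (starRingEnd ℂ) (e - c)).re ∂μ = 0 := by
    have h2 := integral_re hi
    simp only [RCLike.re_to_complex] at h2
    rw [h2, integral_mul_const, integral_sub (integrable_of_continuous hF) (integrable_const _)]
    simp [he]
  rw [integral_add (integrable_of_continuous (by fun_prop))
    (integrable_of_continuous (by fun_prop)),
    integral_add (integrable_of_continuous (by fun_prop)) (integrable_const _),
    integral_const_mul, hre]
  simp

/-- The mean is the best centre, so a variance may be estimated around any convenient deterministic
approximation. -/
lemma integral_var_le {F : X → ℂ} (hF : Continuous F) (c : ℂ) :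
    ∫ x, ‖F x - ∫ y, F y ∂μ‖ ^ 2 ∂μ ≤ ∫ x, ‖F x - c‖ ^ 2 ∂μ := by
  rw [integral_norm_sub_sq hF c]
  nlinarith [sq_nonneg ‖(∫ y, F y ∂μ) - c‖]

lemma norm_integral_sq_le {F : X → ℂ} (hF : Continuous F) :
    ‖∫ y, F y ∂μ‖ ^ 2 ≤ ∫ x, ‖F x‖ ^ 2 ∂μ := by
  have h := integral_norm_sub_sq (μ := μ) hF 0
  simp only [sub_zero] at h
  rw [h]
  have : 0 ≤ ∫ x, ‖F x - ∫ y, F y ∂μ‖ ^ 2 ∂μ := integral_nonneg fun _ => by positivity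
  linarith

/-- The Cauchy–Schwarz inequality with given bounds of the two factors. -/
lemma norm_integral_mul_le {F H : X → ℂ} (hF : Continuous F) (hH : Continuous H) {a b : ℝ}
    (ha : 0 < a) (hb : 0 < b) (h1 : ∫ x, ‖F x‖ ^ 2 ∂μ ≤ a ^ 2) (h2 : ∫ x, ‖H x‖ ^ 2 ∂μ ≤ b ^ 2) :
    ‖∫ x, F x * H x ∂μ‖ ≤ a * b := by
  -- Weighted arithmetic–geometric mean inequality; the weights are tuned so that the two bounds add
  -- up to `a * b`.
  have h3 : ‖∫ x, F x * H x ∂μ‖ ≤ ∫ x, (b / (2 * a) * ‖F x‖ ^ 2 + a / (2 * b) * ‖H x‖ ^ 2) ∂μ := by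
    refine norm_integral_le_of_norm_le (integrable_of_continuous (by fun_prop))
      (Eventually.of_forall fun x => ?_)
    rw [norm_mul]
    have : b / (2 * a) * ‖F x‖ ^ 2 + a / (2 * b) * ‖H x‖ ^ 2 - ‖F x‖ * ‖H x‖ =
        (b * ‖F x‖ - a * ‖H x‖) ^ 2 / (2 * a * b) := by
      field_simp; ring
    have h4 : 0 ≤ (b * ‖F x‖ - a * ‖H x‖) ^ 2 / (2 * a * b) := by positivity
    linarith
  rw [integral_add (integrable_of_continuous (by fun_prop))
    (integrable_of_continuous (by fun_prop)), integral_const_mul, integral_const_mul] at h3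
  have h5 : b / (2 * a) * ∫ x, ‖F x‖ ^ 2 ∂μ ≤ b / (2 * a) * a ^ 2 := by gcongr
  have h6 : a / (2 * b) * ∫ x, ‖H x‖ ^ 2 ∂μ ≤ a / (2 * b) * b ^ 2 := by gcongr
  have h7 : b / (2 * a) * a ^ 2 + a / (2 * b) * b ^ 2 = a * b := by field_simp; ring
  linarith

lemma integral_le_of_sq_le {F : X → ℝ} (hF : Continuous F) {a : ℝ}
    (ha : 0 < a) (h1 : ∫ x, F x ^ 2 ∂μ ≤ a ^ 2) : ∫ x, F x ∂μ ≤ a := by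
  have h := norm_integral_mul_le (μ := μ) (F := fun x => (F x : ℂ)) (H := fun _ => 1)
    (by fun_prop) (by fun_prop) ha one_pos (by simpa using h1) (by simp)
  simp only [mul_one] at h
  rw [integral_complex_ofReal, Complex.norm_real] at h
  exact (le_abs_self _).trans h

lemma integral_mono_of_continuous {F H : X → ℝ} (hF : Continuous F) (hH : Continuous H)
    (h : ∀ x, F x ≤ H x) : ∫ x, F x ∂μ ≤ ∫ x, H x ∂μ :=
  integral_mono (integrable_of_continuous hF) (integrable_of_continuous hH) h

lemma integral_le_of_forall_le {F : X → ℝ} (hF : Continuous F) {a : ℝ}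
    (h : ∀ x, F x ≤ a) : ∫ x, F x ∂μ ≤ a := by
  simpa using integral_mono_of_continuous (μ := μ) hF continuous_const h

lemma norm_integral_le_of_forall_le {F : X → ℂ} {a : ℝ}
    (h : ∀ x, ‖F x‖ ≤ a) : ‖∫ x, F x ∂μ‖ ≤ a := by
  simpa using norm_integral_le_of_norm_le_const (μ := μ) (Eventually.of_forall h)

end OneSpace

/-! ### Product spaces: the Efron–Stein inequality and resampling of a coordinate. -/

section ProductSpace

variable {E : Type*} [TopologicalSpace E] [CompactSpace E] [T2Space E]
  [SecondCountableTopology E]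
  [MeasurableSpace E] [BorelSpace E] {μ : Measure E} [IsProbabilityMeasure μ]

lemma continuous_integral_right {X V : Type*} [TopologicalSpace X] [FirstCountableTopology X]
    [LocallyCompactSpace X] [NormedAddCommGroup V] [NormedSpace ℝ V]
    {Y : Type*} [TopologicalSpace Y] [CompactSpace Y] [SecondCountableTopology Y]
    [MeasurableSpace Y] [BorelSpace Y] {ν : Measure Y} [IsFiniteMeasure ν]
    {F : X → Y → V} (hF : Continuous (Function.uncurry F)) : Continuous fun x => ∫ y, F x y ∂ν := by
  have := continuous_parametric_integral_of_continuous (μ := ν) (s := Set.univ) hF isCompact_univ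
  simpa using this

lemma integral_pi_succ {m : ℕ} {V : Type*} [NormedAddCommGroup V] [NormedSpace ℝ V]
    [SecondCountableTopology V] {Φ : (Fin (m + 1) → E) → V} (hΦ : Continuous Φ) :
    ∫ ω, Φ ω ∂(Measure.pi fun _ => μ) =
      ∫ x, ∫ ω, Φ (Fin.cons x ω) ∂(Measure.pi fun _ : Fin m => μ) ∂μ := by
  have h := (measurePreserving_piFinSuccAbove (fun _ : Fin (m + 1) => μ) 0).symm
  rw [← h.integral_comp' (g := Φ), integral_prod]
  · simp [MeasurableEquiv.piFinSuccAbove, Fin.insertNthEquiv]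
  · have : Continuous fun p : E × (Fin m → E) =>
        Φ ((MeasurableEquiv.piFinSuccAbove (fun _ : Fin (m + 1) => E) 0).symm p) := by
      refine hΦ.comp ?_
      simp only [MeasurableEquiv.piFinSuccAbove, Fin.insertNthEquiv]
      simp
      fun_prop
    exact integrable_of_continuous this

/-- The Efron–Stein inequality. -/
theorem efron_stein {m : ℕ} (F : (Fin m → E) → ℂ) (F' : Fin m → (Fin m → E) → ℂ)
    (hF : Continuous F) (hF' : ∀ α, Continuous (F' α))
    (hinv : ∀ α ω x, F' α (Function.update ω α x) = F' α ω) :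
    ∫ ω, ‖F ω - ∫ ω', F ω' ∂(Measure.pi fun _ => μ)‖ ^ 2 ∂(Measure.pi fun _ => μ) ≤
      ∑ α, ∫ ω, ‖F ω - F' α ω‖ ^ 2 ∂(Measure.pi fun _ => μ) := by
  induction m with
  | zero => simp [integral_unique]
  | succ m ih =>
    set ν : Measure (Fin m → E) := Measure.pi fun _ => μ with hν
    have hcons : Continuous fun p : E × (Fin m → E) => (Fin.cons p.1 p.2 : Fin (m + 1) → E) := by
      fun_prop
    have hcons' : ∀ x : E, Continuous fun ω : Fin m → E => (Fin.cons x ω : Fin (m + 1) → E) :=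
      fun x => hcons.comp (Continuous.prodMk_right x)
    -- Conditional expectation given the first coordinate. The variance of `F` is the mean of the
    -- conditional variances, handled by induction, plus the variance of `h`.
    set h : E → ℂ := fun x => ∫ ω, F (Fin.cons x ω) ∂ν with hh
    have hhc : Continuous h := continuous_integral_right (hF.comp hcons)
    set c := ∫ x, h x ∂μ with hc
    have hcF : ∫ ω, F ω ∂(Measure.pi fun _ : Fin (m + 1) => μ) = c := integral_pi_succ hF
    obtain ⟨x₀⟩ : Nonempty E := nonempty_of_isProbabilityMeasure μ
    -- As `F' 0` ignores the first coordinate, averaging it over the other ones yields a constant,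
    -- which can serve as a centre for `h`; `x₀` is an arbitrary point.
    set h₀ := ∫ ω, F' 0 (Fin.cons x₀ ω) ∂ν with hh₀
    have hF0 : ∀ x ω, F' 0 (Fin.cons x ω) = F' 0 (Fin.cons x₀ ω) := by
      intro x ω
      have := hinv 0 (Fin.cons x₀ ω) x
      rwa [Fin.update_cons_zero] at this
    rw [hcF, integral_pi_succ (by fun_prop), Fin.sum_univ_succ]
    have e1 : ∀ x, ∫ ω, ‖F (Fin.cons x ω) - c‖ ^ 2 ∂ν ≤
        (∑ α : Fin m, ∫ ω, ‖F (Fin.cons x ω) - F' α.succ (Fin.cons x ω)‖ ^ 2 ∂ν)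
          + ‖h x - c‖ ^ 2 := by
      intro x
      rw [integral_norm_sub_sq (F := fun ω => F (Fin.cons x ω)) (hF.comp (hcons' x)) c]
      gcongr
      refine ih (fun ω => F (Fin.cons x ω)) (fun α ω => F' α.succ (Fin.cons x ω))
        (hF.comp (hcons' x)) (fun α => (hF' _).comp (hcons' x)) ?_
      intro α ω y
      rw [Fin.cons_update]
      exact hinv _ _ _
    have ci : ∀ α, Continuous fun x => ∫ ω, ‖F (Fin.cons x ω) - F' α (Fin.cons x ω)‖ ^ 2 ∂ν := by
      intro α
      refine continuous_integral_right ?_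
      exact (Continuous.norm ((hF.comp hcons).sub ((hF' α).comp hcons))).pow 2
    have e2 : ∫ x, ‖h x - c‖ ^ 2 ∂μ ≤
        ∫ x, ∫ ω, ‖F (Fin.cons x ω) - F' 0 (Fin.cons x ω)‖ ^ 2 ∂ν ∂μ := by
      refine (integral_var_le hhc h₀).trans ?_
      refine integral_mono_of_continuous (by fun_prop) (ci 0) fun x => ?_
      simp only [hh, hh₀, hF0 x]
      rw [← integral_sub (f := fun ω => F (Fin.cons x ω))
        (g := fun ω => F' 0 (Fin.cons x₀ ω)) (integrable_of_continuous (hF.comp (hcons' x)))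
        (integrable_of_continuous ((hF' 0).comp (hcons' x₀)))]
      exact norm_integral_sq_le ((hF.comp (hcons' x)).sub ((hF' 0).comp (hcons' x₀)))
    have e3 : ∀ α, ∫ ω, ‖F ω - F' α ω‖ ^ 2 ∂(Measure.pi fun _ : Fin (m + 1) => μ) =
        ∫ x, ∫ ω, ‖F (Fin.cons x ω) - F' α (Fin.cons x ω)‖ ^ 2 ∂ν ∂μ := by
      intro α
      have := hF' α
      rw [integral_pi_succ (by fun_prop)]
    simp_rw [e3]
    refine (integral_mono_of_continuous ?_ ?_ e1).trans ?_
    · exact continuous_integral_right (((hF.comp hcons).sub continuous_const).norm.pow 2)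
    · exact (continuous_finsetSum _ fun α _ => ci _).add (by fun_prop)
    · rw [integral_add (integrable_of_continuous (continuous_finsetSum _ fun α _ => ci _))
        (integrable_of_continuous (by fun_prop)),
        integral_finsetSum _ fun α _ => integrable_of_continuous (ci _)]
      linarith

/-- Integration over a product space by resampling one coordinate. -/
lemma integral_update {m : ℕ} {V : Type*} [NormedAddCommGroup V] [NormedSpace ℝ V]
    [SecondCountableTopology V] [CompleteSpace V] {Φ : (Fin m → E) → V}
    (hΦ : Continuous Φ) (α : Fin m) :
    ∫ ω, Φ ω ∂(Measure.pi fun _ => μ) =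
      ∫ ω, ∫ x, Φ (Function.update ω α x) ∂μ ∂(Measure.pi fun _ => μ) := by
  have hc : Continuous fun p : (Fin m → E) × E => Function.update p.1 α p.2 := by fun_prop
  -- Replacing one coordinate by an independent copy preserves the product law. It is enough to
  -- check this on boxes, where the discarded coordinate contributes a factor `1`.
  have hmap : Measure.map (fun p : (Fin m → E) × E => Function.update p.1 α p.2)
      ((Measure.pi fun _ : Fin m => μ).prod μ) = Measure.pi fun _ : Fin m => μ := by
    refine (Measure.pi_eq fun s hs => ?_).symm
    rw [Measure.map_apply hc.measurable (MeasurableSet.univ_pi hs)]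
    have : (fun p : (Fin m → E) × E => Function.update p.1 α p.2) ⁻¹' (Set.univ.pi s) =
        (Set.univ.pi (Function.update s α Set.univ)) ×ˢ (s α) := by
      ext ⟨ω, x⟩
      simp only [Set.mem_preimage, Set.mem_pi, Set.mem_univ, true_imp_iff, Set.mem_prod]
      constructor
      · intro h
        refine ⟨fun β => ?_, by simpa using h α⟩
        by_cases hb : β = α
        · subst hb; simp
        · simpa [hb] using h β
      · rintro ⟨h1, h2⟩ β
        by_cases hb : β = α
        · subst hb; simpa using h2
        · simpa [hb] using h1 β
    rw [this, Measure.prod_prod, Measure.pi_pi, ← Finset.prod_erase_mul _ _ (Finset.mem_univ α),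
      ← Finset.prod_erase_mul (Finset.univ) (fun i => μ (s i)) (Finset.mem_univ α)]
    simp only [Function.update_self, measure_univ, mul_one]
    congr 1
    refine Finset.prod_congr rfl fun β hβ => ?_
    rw [Function.update_of_ne (Finset.ne_of_mem_erase hβ)]
  conv_lhs => rw [← hmap]
  borelize V
  rw [integral_map hc.aemeasurable hΦ.measurable.aestronglyMeasurable, integral_prod]
  exact integrable_of_continuous (hΦ.comp hc)

end ProductSpace

end Probability

/-! ### Rotation invariance and the moments of the uniform law on the sphere. -/

section Sphere

variable {n : ℕ}

instance isProbabilityMeasure_unifSphere [NeZero n] : IsProbabilityMeasure (unifSphere n) := by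
  have : Nonempty (Fin n) := ⟨0⟩
  constructor
  rw [unifSphere, Measure.smul_apply, smul_eq_mul]
  refine ENNReal.inv_mul_cancel ?_ (measure_ne_top _ _)
  rw [Ne, Measure.measure_univ_eq_zero]
  exact Measure.toSphere_ne_zero _

/-- The action of a linear isometry on the unit sphere. -/
def sphMap (U : EuclideanSpace ℝ (Fin n) ≃ₗᵢ[ℝ] EuclideanSpace ℝ (Fin n)) (y : Sph n) : Sph n :=
  ⟨U y, by simp⟩

lemma continuous_sphMap (U : EuclideanSpace ℝ (Fin n) ≃ₗᵢ[ℝ] EuclideanSpace ℝ (Fin n)) :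
    Continuous (sphMap U) := by
  unfold sphMap
  fun_prop

-- The surface measure of a set is, up to the dimension, the volume of the cone over it. A linear
-- isometry preserves volume and carries cones to cones.
open scoped Pointwise in
lemma measurePreserving_sphMap
    (U : EuclideanSpace ℝ (Fin n) ≃ₗᵢ[ℝ] EuclideanSpace ℝ (Fin n)) :
    MeasurePreserving (sphMap U) (unifSphere n) (unifSphere n) := by
  refine ⟨(continuous_sphMap U).measurable, ?_⟩
  rw [unifSphere, Measure.map_smul]
  congr 1
  ext s hs
  have hm := (continuous_sphMap U).measurable
  rw [Measure.map_apply hm hs, Measure.toSphere_apply' _ hs, Measure.toSphere_apply' _ (hm hs)]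
  congr 1
  have hU := U.measurePreserving.measure_preimage_equiv (f := U.toMeasurableEquiv)
    (Set.Ioo (0 : ℝ) 1 • ((↑) '' s : Set (EuclideanSpace ℝ (Fin n))))
  rw [← hU]
  congr 1
  ext x
  simp only [Set.mem_smul, Set.mem_image, Set.mem_preimage]
  constructor
  · rintro ⟨r, hr, _, ⟨y, hy, rfl⟩, rfl⟩
    exact ⟨r, hr, _, ⟨sphMap U y, hy, rfl⟩, by simp [sphMap]⟩
  · rintro ⟨r, hr, _, ⟨y, hy, rfl⟩, h⟩
    refine ⟨r, hr, _, ⟨sphMap U.symm y, ?_, rfl⟩, ?_⟩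
    · simpa [sphMap] using hy
    · apply U.injective
      have : U x = r • (y : EuclideanSpace ℝ (Fin n)) := h.symm
      simp [sphMap, this]

lemma integral_sphMap {V : Type*} [NormedAddCommGroup V] [NormedSpace ℝ V]
    [SecondCountableTopology V] {Φ : Sph n → V}
    (hΦ : Continuous Φ) (U : EuclideanSpace ℝ (Fin n) ≃ₗᵢ[ℝ] EuclideanSpace ℝ (Fin n)) :
    ∫ y, Φ (sphMap U y) ∂(unifSphere n) = ∫ y, Φ y ∂(unifSphere n) := by
  borelize V
  conv_rhs => rw [← (measurePreserving_sphMap U).map_eq]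
  rw [integral_map (continuous_sphMap U).measurable.aemeasurable
    hΦ.measurable.aestronglyMeasurable]

/-- The moments of the projections depend on the length of the direction only. -/
lemma integral_inner_pow_eq (k : ℕ) {v w : EuclideanSpace ℝ (Fin n)} (h : ‖v‖ = ‖w‖) :
    ∫ y : Sph n, (inner ℝ v (y : EuclideanSpace ℝ (Fin n))) ^ k ∂(unifSphere n) =
      ∫ y : Sph n, (inner ℝ w (y : EuclideanSpace ℝ (Fin n))) ^ k ∂(unifSphere n) := by
  -- The reflection in the hyperplane orthogonal to `v - w` exchanges two vectors of equal length.
  set U := (Submodule.span ℝ {v - w})ᗮ.reflection with hU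
  have hUv : U v = w := Submodule.reflection_sub h
  rw [← integral_sphMap (U := U) (by fun_prop)]
  refine integral_congr_ae (Eventually.of_forall fun y => ?_)
  simp only [sphMap]
  rw [← U.inner_map_map v (U y), hUv, hU, Submodule.reflection_reflection]

/-- Invariance reduces `v` to a multiple of a fixed unit vector, and homogeneity extracts its
length. With polarization, one unknown constant per degree remains, and the relation `Σ yᵢ² = 1`
determines it; no spherical integral is computed. -/
lemma exists_integral_inner_pow [NeZero n] (k : ℕ) : ∃ b : ℝ, ∀ v : EuclideanSpace ℝ (Fin n),
    ∫ y : Sph n, (inner ℝ v (y : EuclideanSpace ℝ (Fin n))) ^ k ∂(unifSphere n) = b * ‖v‖ ^ k := by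
  set e : EuclideanSpace ℝ (Fin n) := EuclideanSpace.single 0 1 with he
  refine ⟨∫ y : Sph n, (inner ℝ e (y : EuclideanSpace ℝ (Fin n))) ^ k ∂(unifSphere n), fun v => ?_⟩
  rw [integral_inner_pow_eq k (w := ‖v‖ • e) (by simp [norm_smul, he])]
  simp_rw [inner_smul_left, mul_pow]
  rw [integral_const_mul]
  simp [mul_comm]

lemma sum_sq_sph (y : Sph n) : ∑ i, (y : EuclideanSpace ℝ (Fin n)) i ^ 2 = 1 := by
  have h : ‖(y : EuclideanSpace ℝ (Fin n))‖ = 1 := by simp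
  rw [← EuclideanSpace.real_norm_sq_eq, h, one_pow]

lemma integrable_sph [NeZero n] {V : Type*} [NormedAddCommGroup V]
    [SecondCountableTopology V] {F : Sph n → V} (hF : Continuous F) :
    Integrable F (unifSphere n) := integrable_of_continuous hF

/-- The second moments of the uniform distribution on the sphere. -/
lemma integral_coord_two [NeZero n] (a b : Fin n) :
    ∫ y : Sph n, (y : EuclideanSpace ℝ (Fin n)) a * (y : EuclideanSpace ℝ (Fin n)) b
      ∂(unifSphere n) = (n : ℝ)⁻¹ * (if a = b then 1 else 0) := by
  obtain ⟨r, hr⟩ := exists_integral_inner_pow (n := n) 2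
  have pol : ∀ a b : Fin n, ∫ y : Sph n, (y : EuclideanSpace ℝ (Fin n)) a *
      (y : EuclideanSpace ℝ (Fin n)) b ∂(unifSphere n) = r * (if a = b then 1 else 0) := by
    intro a b
    set u : EuclideanSpace ℝ (Fin n) := EuclideanSpace.single a 1 with hu
    set v : EuclideanSpace ℝ (Fin n) := EuclideanSpace.single b 1 with hv
    have h1 : ∀ y : Sph n, (y : EuclideanSpace ℝ (Fin n)) a * (y : EuclideanSpace ℝ (Fin n)) b =
        4⁻¹ * (inner ℝ (u + v) (y : EuclideanSpace ℝ (Fin n)) ^ 2 -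
          inner ℝ (u - v) (y : EuclideanSpace ℝ (Fin n)) ^ 2) := by
      intro y
      rw [inner_add_left, inner_sub_left, hu, hv, EuclideanSpace.inner_single_left,
        EuclideanSpace.inner_single_left]
      simp; ring
    simp_rw [h1]
    rw [integral_const_mul, integral_sub (integrable_sph (by fun_prop))
      (integrable_sph (by fun_prop)), hr, hr, norm_add_sq_real, norm_sub_sq_real]
    have h2 : inner ℝ u v = if a = b then (1 : ℝ) else 0 := by
      rw [hu, EuclideanSpace.inner_single_left, hv]; simp
    rw [h2]; ring
  have hsum : (n : ℝ) * r = 1 := by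
    have h3 : ∫ y : Sph n, ∑ i, (y : EuclideanSpace ℝ (Fin n)) i *
        (y : EuclideanSpace ℝ (Fin n)) i ∂(unifSphere n) = 1 := by
      simp_rw [← pow_two, sum_sq_sph]; simp
    rw [integral_finsetSum _ fun i _ => integrable_sph (by fun_prop)] at h3
    simpa [pol] using h3
  have hn : (n : ℝ) ≠ 0 := NeZero.ne _
  rw [pol, show r = (n : ℝ)⁻¹ from by field_simp; linarith]

/-- The fourth moments of the uniform distribution on the sphere. -/
lemma exists_integral_coord_four [NeZero n] : ∃ r : ℝ, 0 ≤ r ∧ r ≤ ((n : ℝ) ^ 2)⁻¹ ∧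
    ∀ a b c d : Fin n, ∫ y : Sph n, (y : EuclideanSpace ℝ (Fin n)) a *
      (y : EuclideanSpace ℝ (Fin n)) b * (y : EuclideanSpace ℝ (Fin n)) c *
      (y : EuclideanSpace ℝ (Fin n)) d ∂(unifSphere n) =
      r * ((if a = b then 1 else 0) * (if c = d then 1 else 0) +
        (if a = c then 1 else 0) * (if b = d then 1 else 0) +
        (if a = d then 1 else 0) * (if b = c then 1 else 0)) := by
  obtain ⟨r, hr⟩ := exists_integral_inner_pow (n := n) 4
  have pol : ∀ a b c d : Fin n, ∫ y : Sph n, (y : EuclideanSpace ℝ (Fin n)) a *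
      (y : EuclideanSpace ℝ (Fin n)) b * (y : EuclideanSpace ℝ (Fin n)) c *
      (y : EuclideanSpace ℝ (Fin n)) d ∂(unifSphere n) =
      (r / 3) * ((if a = b then 1 else 0) * (if c = d then 1 else 0) +
        (if a = c then 1 else 0) * (if b = d then 1 else 0) +
        (if a = d then 1 else 0) * (if b = c then 1 else 0)) := by
    intro a b c d
    set e : Fin n → EuclideanSpace ℝ (Fin n) := fun i => EuclideanSpace.single i 1 with he
    have hin : ∀ i j, inner ℝ (e i) (e j) = if i = j then (1 : ℝ) else 0 := by
      intro i j
      simp only [he]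
      rw [EuclideanSpace.inner_single_left]; simp
    have hin1 : ∀ i, ‖e i‖ ^ 2 = 1 := by intro i; simp [he]
    have hiny : ∀ i (y : Sph n), inner ℝ (e i) (y : EuclideanSpace ℝ (Fin n)) =
        (y : EuclideanSpace ℝ (Fin n)) i := by
      intro i y
      simp only [he]
      rw [EuclideanSpace.inner_single_left]; simp
    -- Polarization of a quartic: the eight choices of signs each contribute `4! = 24` times the
    -- monomial, and `192 = 8 * 24`. The same combination of `‖v‖⁴` gives one third of the sum of
    -- the three pairings.
    have h1 : ∀ y : Sph n, (y : EuclideanSpace ℝ (Fin n)) a *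
      (y : EuclideanSpace ℝ (Fin n)) b * (y : EuclideanSpace ℝ (Fin n)) c *
      (y : EuclideanSpace ℝ (Fin n)) d =
        192⁻¹ * (inner ℝ (e a + e b + e c + e d) (y : EuclideanSpace ℝ (Fin n)) ^ 4 -
          inner ℝ (e a - e b + e c + e d) (y : EuclideanSpace ℝ (Fin n)) ^ 4 -
          inner ℝ (e a + e b - e c + e d) (y : EuclideanSpace ℝ (Fin n)) ^ 4 +
          inner ℝ (e a - e b - e c + e d) (y : EuclideanSpace ℝ (Fin n)) ^ 4 -
          inner ℝ (e a + e b + e c - e d) (y : EuclideanSpace ℝ (Fin n)) ^ 4 +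
          inner ℝ (e a - e b + e c - e d) (y : EuclideanSpace ℝ (Fin n)) ^ 4 +
          inner ℝ (e a + e b - e c - e d) (y : EuclideanSpace ℝ (Fin n)) ^ 4 -
          inner ℝ (e a - e b - e c - e d) (y : EuclideanSpace ℝ (Fin n)) ^ 4) := by
      intro y
      simp only [inner_add_left, inner_sub_left, hiny]
      ring
    simp_rw [h1]
    rw [integral_const_mul]
    repeat' first
      | rw [integral_add (integrable_sph (by fun_prop)) (integrable_sph (by fun_prop))]
      | rw [integral_sub (integrable_sph (by fun_prop)) (integrable_sph (by fun_prop))]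
    simp only [hr]
    have h4 : ∀ v : EuclideanSpace ℝ (Fin n), ‖v‖ ^ 4 = (‖v‖ ^ 2) ^ 2 := fun v => by ring
    simp only [h4, norm_add_sq_real, norm_sub_sq_real, inner_add_left, inner_sub_left, hin, hin1]
    ring
  -- Summation over `a = b` and `c = d`: the three pairings contribute `n²`, `n` and `n`. Hence `r /
  -- 3 = 1 / (n (n + 2))`, of which only the bound by `n⁻²` is retained.
  have hsum : (r / 3) * ((n : ℝ) ^ 2 + 2 * n) = 1 := by
    have h3 : ∫ y : Sph n, ∑ i, ∑ j, (y : EuclideanSpace ℝ (Fin n)) i *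
        (y : EuclideanSpace ℝ (Fin n)) i * (y : EuclideanSpace ℝ (Fin n)) j *
        (y : EuclideanSpace ℝ (Fin n)) j ∂(unifSphere n) = 1 := by
      have h5 : ∀ y : Sph n, ∑ i, ∑ j, (y : EuclideanSpace ℝ (Fin n)) i *
        (y : EuclideanSpace ℝ (Fin n)) i * (y : EuclideanSpace ℝ (Fin n)) j *
        (y : EuclideanSpace ℝ (Fin n)) j = 1 := by
        intro y
        have h6 : (∑ i, (y : EuclideanSpace ℝ (Fin n)) i ^ 2) *
          ∑ j, (y : EuclideanSpace ℝ (Fin n)) j ^ 2 = 1 := by rw [sum_sq_sph, one_mul]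
        refine Eq.trans ?_ h6
        rw [Finset.sum_mul_sum]
        refine Finset.sum_congr rfl fun i _ => Finset.sum_congr rfl fun j _ => by ring
      simp_rw [h5]; simp
    rw [integral_finsetSum _ fun i _ => integrable_sph (by fun_prop)] at h3
    have h7 : ∀ i, ∫ y : Sph n, ∑ j, (y : EuclideanSpace ℝ (Fin n)) i *
        (y : EuclideanSpace ℝ (Fin n)) i * (y : EuclideanSpace ℝ (Fin n)) j *
        (y : EuclideanSpace ℝ (Fin n)) j ∂(unifSphere n) = (r / 3) * (n + 2) := by
      intro i
      rw [integral_finsetSum _ fun i _ => integrable_sph (by fun_prop)]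
      simp only [pol, ← Finset.mul_sum, Finset.sum_add_distrib, if_true, mul_one,
        Finset.sum_ite_eq, Finset.mem_univ, mul_ite, mul_zero]
      simp
      left
      ring
    simp only [h7] at h3
    simp at h3
    linear_combination h3
  have hn : (0 : ℝ) < n := Nat.cast_pos.2 (Nat.pos_of_ne_zero (NeZero.ne n))
  refine ⟨r / 3, ?_, ?_, pol⟩
  · by_contra hneg
    push Not at hneg
    nlinarith [mul_neg_of_neg_of_pos hneg (show 0 < (n : ℝ) ^ 2 + 2 * n by positivity)]
  · rw [← one_div, le_div_iff₀ (by positivity)]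
    have h0 : 0 ≤ r / 3 := by
      by_contra hneg
      push Not at hneg
      nlinarith [mul_neg_of_neg_of_pos hneg (show 0 < (n : ℝ) ^ 2 + 2 * n by positivity)]
    nlinarith [mul_nonneg h0 hn.le]

end Sphere

/-! ### Moments of quadratic forms in one sphere vector and in a tensor product of two. -/

section QuadraticForms

variable {n : ℕ}

/-- The coordinates of a point of the sphere, as complex numbers. -/
def vec (y : Sph n) : Fin n → ℂ := fun i => ((y : EuclideanSpace ℝ (Fin n)) i : ℂ)

lemma continuous_vec (i : Fin n) : Continuous fun y : Sph n => vec y i := by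
  unfold vec; fun_prop

attribute [fun_prop] continuous_vec

lemma nsq_vec (y : Sph n) : nsq (vec y) = 1 := by
  simp [nsq, vec, ← sum_sq_sph y]

/-- The tensor product of two points of the sphere. -/
def tens (p : Sph n × Sph n) : Fin n × Fin n → ℂ := fun i => vec p.1 i.1 * vec p.2 i.2

lemma tensorVec_eq_tens {m : ℕ} (ω : Sample n m) (α : Fin m) : tensorVec ω α = tens (ω α) := by
  ext i; simp [tensorVec, tens, vec]

lemma nsq_tens (p : Sph n × Sph n) : nsq (tens p) = 1 := by
  have : nsq (tens p) = nsq (vec p.1) * nsq (vec p.2) := by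
    simp [nsq, tens, Fintype.sum_prod_type, mul_pow, Finset.sum_mul_sum]
  rw [this, nsq_vec, nsq_vec, one_mul]

lemma quadForm_eq {ι : Type*} [Fintype ι] (K : Matrix ι ι ℂ) (v : ι → ℂ) :
    v ⬝ᵥ (K *ᵥ v) = ∑ a, ∑ b, K a b * (v a * v b) := by
  simp only [dotProduct, Matrix.mulVec, Finset.mul_sum]
  exact Finset.sum_congr rfl fun a _ => Finset.sum_congr rfl fun b _ => by ring

lemma integral_vec_two [NeZero n] (a b : Fin n) :
    ∫ y : Sph n, vec y a * vec y b ∂(unifSphere n) = (n : ℂ)⁻¹ * (if a = b then 1 else 0) := by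
  have h := congrArg (fun x : ℝ => (x : ℂ)) (integral_coord_two a b)
  simp only [← integral_complex_ofReal] at h
  simpa [vec, apply_ite Complex.ofReal] using h

lemma integral_quadForm_sph [NeZero n] (K : Matrix (Fin n) (Fin n) ℂ) :
    ∫ y, vec y ⬝ᵥ (K *ᵥ vec y) ∂(unifSphere n) = (n : ℂ)⁻¹ * K.trace := by
  simp only [quadForm_eq]
  rw [integral_finsetSum _ fun i _ => integrable_sph (by fun_prop), Matrix.trace, Finset.mul_sum]
  refine Finset.sum_congr rfl fun a _ => ?_
  rw [integral_finsetSum _ fun i _ => integrable_sph (by fun_prop)]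
  simp [integral_const_mul, integral_vec_two, mul_comm]

/-- The three pairings of the fourth moment produce `|tr K|²`, `‖K‖²` and the sum of `K a b` times
the conjugate of `K b a`; the last one is at most `‖K‖²` by Cauchy–Schwarz. -/
lemma integral_norm_quadForm_sq_sph_le [NeZero n] (K : Matrix (Fin n) (Fin n) ℂ) :
    ∫ y, ‖vec y ⬝ᵥ (K *ᵥ vec y)‖ ^ 2 ∂(unifSphere n) ≤
      ((n : ℝ) ^ 2)⁻¹ * (‖K.trace‖ ^ 2 + 2 * hs K) := by
  obtain ⟨r, hr0, hr1, hr⟩ := exists_integral_coord_four (n := n)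
  have hv : ∀ a b c d : Fin n, ∫ y : Sph n, vec y a * vec y b * vec y c * vec y d ∂(unifSphere n) =
      (r : ℂ) * ((if a = b then 1 else 0) * (if c = d then 1 else 0) +
        (if a = c then 1 else 0) * (if b = d then 1 else 0) +
        (if a = d then 1 else 0) * (if b = c then 1 else 0)) := by
    intro a b c d
    have h := congrArg (fun x : ℝ => (x : ℂ)) (hr a b c d)
    simp only [← integral_complex_ofReal] at h
    simpa [vec, apply_ite Complex.ofReal] using h
  have hstar : ∀ (y : Sph n) a, (starRingEnd ℂ) (vec y a) = vec y a := by
    intro y a; simp [vec]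
  have h1 : ((∫ y, ‖vec y ⬝ᵥ (K *ᵥ vec y)‖ ^ 2 ∂(unifSphere n) : ℝ) : ℂ) =
      r * (K.trace * (starRingEnd ℂ) K.trace + ∑ a, ∑ b, K a b * (starRingEnd ℂ) (K a b) +
        ∑ a, ∑ b, K a b * (starRingEnd ℂ) (K b a)) := by
    rw [← integral_complex_ofReal]
    have h2 : ∀ y : Sph n, ((‖vec y ⬝ᵥ (K *ᵥ vec y)‖ ^ 2 : ℝ) : ℂ) = ∑ a, ∑ b, ∑ c, ∑ d,
        K a b * (starRingEnd ℂ) (K c d) * (vec y a * vec y b * vec y c * vec y d) := by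
      intro y
      rw [Complex.ofReal_pow, ← Complex.conj_mul', quadForm_eq]
      simp only [map_sum, map_mul, hstar, Finset.sum_mul, Finset.mul_sum]
      refine Finset.sum_congr rfl fun a _ => Finset.sum_congr rfl fun b _ =>
        Finset.sum_congr rfl fun c _ => Finset.sum_congr rfl fun d _ => by ring
    simp_rw [h2]
    have h3 : ∫ y : Sph n, ∑ a, ∑ b, ∑ c, ∑ d, K a b * (starRingEnd ℂ) (K c d) *
        (vec y a * vec y b * vec y c * vec y d) ∂(unifSphere n) = ∑ a, ∑ b, ∑ c, ∑ d,
        K a b * (starRingEnd ℂ) (K c d) * ((r : ℂ) * ((if a = b then 1 else 0) *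
        (if c = d then 1 else 0) + (if a = c then 1 else 0) * (if b = d then 1 else 0) +
        (if a = d then 1 else 0) * (if b = c then 1 else 0))) := by
      rw [integral_finsetSum _ fun i _ => integrable_sph (by fun_prop)]
      refine Finset.sum_congr rfl fun a _ => ?_
      rw [integral_finsetSum _ fun i _ => integrable_sph (by fun_prop)]
      refine Finset.sum_congr rfl fun b _ => ?_
      rw [integral_finsetSum _ fun i _ => integrable_sph (by fun_prop)]
      refine Finset.sum_congr rfl fun c _ => ?_
      rw [integral_finsetSum _ fun i _ => integrable_sph (by fun_prop)]
      refine Finset.sum_congr rfl fun d _ => ?_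
      rw [integral_const_mul, hv]
    rw [h3]
    simp only [mul_add, Finset.sum_add_distrib]
    congr 1
    · congr 1
      · simp [Matrix.trace, Finset.mul_sum, mul_comm, mul_left_comm]
        exact Finset.sum_comm
      · simp [Finset.mul_sum, mul_comm, mul_left_comm]
    · simp [Finset.mul_sum, mul_comm, mul_left_comm]
  have hhs : ∑ a, ∑ b, K a b * (starRingEnd ℂ) (K a b) = (hs K : ℂ) := by
    simp [hs, Complex.mul_conj']
  have hcross : ‖∑ a, ∑ b, K a b * (starRingEnd ℂ) (K b a)‖ ≤ hs K := by
    have h4 := norm_trace_mul_sq_le K (K.map (starRingEnd ℂ))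
    have h5 : hs (K.map (starRingEnd ℂ)) = hs K := by simp [hs]
    rw [h5, ← pow_two] at h4
    have := abs_le_of_sq_le_sq h4 (hs_nonneg K)
    simpa [Matrix.trace, Matrix.mul_apply] using this
  have h6 := congrArg norm h1
  rw [Complex.norm_real, norm_mul, Complex.norm_real, Real.norm_of_nonneg hr0,
    Real.norm_of_nonneg (integral_nonneg fun _ => by positivity)] at h6
  rw [h6]
  have h7 : ‖K.trace * (starRingEnd ℂ) K.trace + ∑ a, ∑ b, K a b * (starRingEnd ℂ) (K a b) +
        ∑ a, ∑ b, K a b * (starRingEnd ℂ) (K b a)‖ ≤ ‖K.trace‖ ^ 2 + 2 * hs K := by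
    refine (norm_add₃_le).trans ?_
    rw [hhs, norm_mul, RCLike.norm_conj, Complex.norm_real, Real.norm_of_nonneg (hs_nonneg K)]
    nlinarith
  exact mul_le_mul hr1 h7 (norm_nonneg _) (by positivity)

lemma integrable_sph2 [NeZero n] {V : Type*} [NormedAddCommGroup V]
    [SecondCountableTopology V] {F : Sph n × Sph n → V} (hF : Continuous F) :
    Integrable F ((unifSphere n).prod (unifSphere n)) := integrable_of_continuous hF

/-- The matrix of the quadratic form in the second vector, the first being fixed. -/
def innerForm (H : Matrix (Fin n × Fin n) (Fin n × Fin n) ℂ) (v : Fin n → ℂ) :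
    Matrix (Fin n) (Fin n) ℂ :=
  fun s q => v ⬝ᵥ (Matrix.of (fun j p => H (j, s) (p, q)) *ᵥ v)

/-- With the first factor frozen this is a quadratic form in the second, so that the one-vector
moments can be used twice in succession. -/
lemma quadForm_tens (H : Matrix (Fin n × Fin n) (Fin n × Fin n) ℂ) (p : Sph n × Sph n) :
    tens p ⬝ᵥ (H *ᵥ tens p) = vec p.2 ⬝ᵥ (innerForm H (vec p.1) *ᵥ vec p.2) := by
  simp only [quadForm_eq, innerForm, Matrix.of_apply, tens, Fintype.sum_prod_type, Finset.sum_mul]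
  rw [Finset.sum_comm]
  refine Finset.sum_congr rfl fun s _ => ?_
  conv_rhs => rw [Finset.sum_comm]
  refine Finset.sum_congr rfl fun j _ => ?_
  rw [Finset.sum_comm]
  exact Finset.sum_congr rfl fun q _ => Finset.sum_congr rfl fun p _ => by ring

lemma trace_innerForm (H : Matrix (Fin n × Fin n) (Fin n × Fin n) ℂ) (v : Fin n → ℂ) :
    (innerForm H v).trace = v ⬝ᵥ (ptrR H *ᵥ v) := by
  simp only [quadForm_eq, Matrix.trace, innerForm, Matrix.of_apply, Matrix.diag, ptrR,
    Finset.sum_mul]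
  rw [Finset.sum_comm]
  exact Finset.sum_congr rfl fun j _ => Finset.sum_comm

lemma continuous_quadForm {X : Type*} [TopologicalSpace X] {ι : Type*} [Fintype ι]
    {K : X → Matrix ι ι ℂ} {v w : X → ι → ℂ} (hK : Continuous K) (hv : Continuous v)
    (hw : Continuous w) : Continuous fun x => v x ⬝ᵥ (K x *ᵥ w x) :=
  hv.dotProduct (hK.matrix_mulVec hw)

lemma continuous_vec' : Continuous (vec : Sph n → Fin n → ℂ) := by fun_prop

lemma continuous_tens : Continuous (tens : Sph n × Sph n → Fin n × Fin n → ℂ) := by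
  unfold tens; fun_prop

lemma continuous_innerForm (H : Matrix (Fin n × Fin n) (Fin n × Fin n) ℂ) :
    Continuous fun y : Sph n => innerForm H (vec y) :=
  continuous_matrix fun _ _ => continuous_quadForm continuous_const continuous_vec' continuous_vec'

lemma integral_quadForm_tens [NeZero n] (H : Matrix (Fin n × Fin n) (Fin n × Fin n) ℂ) :
    ∫ p, tens p ⬝ᵥ (H *ᵥ tens p) ∂((unifSphere n).prod (unifSphere n)) =
      ((n : ℂ) ^ 2)⁻¹ * H.trace := by
  rw [integral_prod _ (integrable_sph2
    (continuous_quadForm continuous_const continuous_tens continuous_tens))]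
  simp only [quadForm_tens, integral_quadForm_sph, trace_innerForm]
  rw [integral_const_mul, integral_quadForm_sph, trace_ptrR, ← mul_assoc]
  congr 1
  rw [pow_two, mul_inv]

lemma continuous_hs {X : Type*} [TopologicalSpace X] {ι κ : Type*} [Fintype ι] [Fintype κ]
    {K : X → Matrix ι κ ℂ} (hK : Continuous K) : Continuous fun x => hs (K x) := by
  unfold hs
  have : ∀ i j, Continuous fun x => K x i j := fun i j => hK.matrix_elem i j
  fun_prop

/-- Each entry `(s, q)` of the inner matrix is itself a quadratic form in `y`, whose matrix has
trace `ptrL H s q`. -/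
lemma integral_hs_innerForm_le [NeZero n] (H : Matrix (Fin n × Fin n) (Fin n × Fin n) ℂ) :
    ∫ y, hs (innerForm H (vec y)) ∂(unifSphere n) ≤
      ((n : ℝ) ^ 2)⁻¹ * (hs (ptrL H) + 2 * hs H) := by
  have hc : ∀ s q, Continuous fun y : Sph n => ‖innerForm H (vec y) s q‖ ^ 2 := fun s q =>
    (((continuous_innerForm H).matrix_elem s q).norm.pow 2)
  have h1 : ∫ y, hs (innerForm H (vec y)) ∂(unifSphere n) =
      ∑ s, ∑ q, ∫ y, ‖innerForm H (vec y) s q‖ ^ 2 ∂(unifSphere n) := by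
    unfold hs
    rw [integral_finsetSum _ fun i _ => integrable_sph (by fun_prop)]
    refine Finset.sum_congr rfl fun a _ => ?_
    rw [integral_finsetSum _ fun i _ => integrable_sph (by fun_prop)]
  rw [h1]
  have h2 : hs (ptrL H) + 2 * hs H = ∑ s, ∑ q, (‖ptrL H s q‖ ^ 2 +
      2 * ∑ j, ∑ p, ‖H (j, s) (p, q)‖ ^ 2) := by
    simp only [Finset.sum_add_distrib, ← Finset.mul_sum]
    congr 2
    simp only [hs, Fintype.sum_prod_type]
    rw [Finset.sum_comm]
    refine Finset.sum_congr rfl fun s _ => ?_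
    conv_rhs => rw [Finset.sum_comm]
    exact Finset.sum_congr rfl fun j _ => Finset.sum_comm
  rw [h2, Finset.mul_sum]
  refine Finset.sum_le_sum fun s _ => ?_
  rw [Finset.mul_sum]
  exact Finset.sum_le_sum fun q _ => integral_norm_quadForm_sq_sph_le _

/-- The second moment of the quadratic form of a tensor product of two independent uniform
vectors of the sphere. -/
lemma integral_norm_quadForm_sq_tens_le [NeZero n]
    (H : Matrix (Fin n × Fin n) (Fin n × Fin n) ℂ) :
    ∫ p, ‖tens p ⬝ᵥ (H *ᵥ tens p)‖ ^ 2 ∂((unifSphere n).prod (unifSphere n)) ≤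
      ((n : ℝ) ^ 4)⁻¹ * quadFun H := by
  have hc : Continuous fun p : Sph n × Sph n => ‖tens p ⬝ᵥ (H *ᵥ tens p)‖ ^ 2 :=
    (continuous_quadForm continuous_const continuous_tens continuous_tens).norm.pow 2
  rw [integral_prod _ (integrable_sph2 hc)]
  have c1 : Continuous fun x : Sph n => ‖vec x ⬝ᵥ (ptrR H *ᵥ vec x)‖ ^ 2 :=
    (continuous_quadForm continuous_const continuous_vec' continuous_vec').norm.pow 2
  have c2 := continuous_hs (continuous_innerForm H)
  -- Integrate over the second factor first. The trace of the inner matrix is then a quadratic form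
  -- in the first factor, with matrix `ptrR H`.
  calc ∫ x, ∫ y, ‖tens (x, y) ⬝ᵥ (H *ᵥ tens (x, y))‖ ^ 2 ∂(unifSphere n) ∂(unifSphere n)
      ≤ ∫ x, ((n : ℝ) ^ 2)⁻¹ * (‖vec x ⬝ᵥ (ptrR H *ᵥ vec x)‖ ^ 2 +
          2 * hs (innerForm H (vec x))) ∂(unifSphere n) := by
        refine integral_mono_of_continuous (continuous_integral_right hc) (by fun_prop) fun x => ?_
        simp only [quadForm_tens, ← trace_innerForm]
        exact integral_norm_quadForm_sq_sph_le _
    _ = ((n : ℝ) ^ 2)⁻¹ * (∫ x, ‖vec x ⬝ᵥ (ptrR H *ᵥ vec x)‖ ^ 2 ∂(unifSphere n) +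
          2 * ∫ x, hs (innerForm H (vec x)) ∂(unifSphere n)) := by
        rw [integral_const_mul, integral_add (integrable_sph c1) (integrable_sph (by fun_prop)),
          integral_const_mul]
    _ ≤ ((n : ℝ) ^ 2)⁻¹ * (((n : ℝ) ^ 2)⁻¹ * (‖(ptrR H).trace‖ ^ 2 + 2 * hs (ptrR H)) +
          2 * (((n : ℝ) ^ 2)⁻¹ * (hs (ptrL H) + 2 * hs H))) := by
        gcongr
        · exact integral_norm_quadForm_sq_sph_le _
        · exact integral_hs_innerForm_le H
    _ = ((n : ℝ) ^ 4)⁻¹ * quadFun H := by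
        rw [trace_ptrR, quadFun, show (n : ℝ) ^ 4 = n ^ 2 * n ^ 2 by ring, mul_inv]
        ring

/-- The contraction of a tensor product vector, acted upon by a matrix, with its first factor is
close to its second factor. -/
lemma integral_contract_right_le [NeZero n] (H : Matrix (Fin n × Fin n) (Fin n × Fin n) ℂ) :
    ∫ p, nsq (innerForm H (vec p.1) *ᵥ vec p.2) ∂((unifSphere n).prod (unifSphere n)) ≤
      ((n : ℝ) ^ 3)⁻¹ * quadFun H := by
  have c0 : Continuous fun p : Sph n × Sph n => innerForm H (vec p.1) *ᵥ vec p.2 :=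
    ((continuous_innerForm H).comp continuous_fst).matrix_mulVec
      (continuous_vec'.comp continuous_snd)
  have hc : Continuous fun p : Sph n × Sph n => nsq (innerForm H (vec p.1) *ᵥ vec p.2) := by
    unfold nsq
    fun_prop
  rw [integral_prod _ (integrable_sph2 hc)]
  -- `‖K y‖²` is the quadratic form of `Kᴴ K`, whose trace is `hs K`. This average gains only `n⁻¹`,
  -- which explains the power `n⁻³` in place of `n⁻⁴`.
  have hK : ∀ K : Matrix (Fin n) (Fin n) ℂ, ∫ y, nsq (K *ᵥ vec y) ∂(unifSphere n) =
      (n : ℝ)⁻¹ * hs K := by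
    intro K
    have e : ∀ y : Sph n, vec y ⬝ᵥ ((Kᴴ * K) *ᵥ vec y) = ((nsq (K *ᵥ vec y) : ℝ) : ℂ) := by
      intro y
      have hs : star (vec y) = vec y := by ext i; simp [vec]
      rw [← star_dotProduct_self_eq_nsq, Matrix.star_mulVec, hs, ← Matrix.dotProduct_mulVec,
        Matrix.mulVec_mulVec]
    have h := integral_quadForm_sph (Kᴴ * K)
    simp_rw [e] at h
    rw [integral_complex_ofReal] at h
    have ht : (Kᴴ * K).trace = ((hs K : ℝ) : ℂ) := by
      rw [Matrix.trace_mul_comm]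
      simp [Matrix.trace, Matrix.mul_apply, hs, Complex.mul_conj']
    rw [ht] at h
    apply Complex.ofReal_injective
    rw [h]
    simp
  simp_rw [hK]
  rw [integral_const_mul]
  have hn : (0 : ℝ) < n := Nat.cast_pos.2 (Nat.pos_of_ne_zero (NeZero.ne n))
  calc (n : ℝ)⁻¹ * ∫ x, hs (innerForm H (vec x)) ∂(unifSphere n)
      ≤ (n : ℝ)⁻¹ * (((n : ℝ) ^ 2)⁻¹ * (hs (ptrL H) + 2 * hs H)) := by
        gcongr; exact integral_hs_innerForm_le H
    _ = ((n : ℝ) ^ 3)⁻¹ * (hs (ptrL H) + 2 * hs H) := by field_simp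
    _ ≤ ((n : ℝ) ^ 3)⁻¹ * quadFun H := by
        gcongr
        have := hs_nonneg (ptrR H); have := hs_nonneg (ptrL H); have := hs_nonneg H
        unfold quadFun
        nlinarith [sq_nonneg ‖H.trace‖]

end QuadraticForms

/-! ### Resolvents of submodels: bounds, continuity and the removal of one summand. -/

section ModelBasics

variable {n m : ℕ}

/-- The points of the complex plane far from the real axis, relative to the bound `T`. -/
def Far (T : ℝ) (z : ℂ) : Prop := 1 ≤ |z.im| ∧ 2 * T ≤ |z.im|

lemma Far.im_ne_zero {T : ℝ} {z : ℂ} (hz : Far T z) : z.im ≠ 0 := by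
  intro h; have := hz.1; rw [h] at this; norm_num at this

lemma dotProduct_tensorVec_self (ω : Sample n m) (α : Fin m) :
    tensorVec ω α ⬝ᵥ tensorVec ω α = 1 := by
  have h := star_dotProduct_self_eq_nsq (tensorVec ω α)
  have h2 : star (tensorVec ω α) = tensorVec ω α := by
    ext i; simp [tensorVec]
  rw [h2, tensorVec_eq_tens, nsq_tens] at h
  rw [tensorVec_eq_tens, h]; simp

lemma nsq_tensorVec (ω : Sample n m) (α : Fin m) : nsq (tensorVec ω α) = 1 := by
  rw [tensorVec_eq_tens, nsq_tens]

lemma transpose_covMat (τ : Fin m → ℝ) (S : Finset (Fin m)) (ω : Sample n m) :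
    (covMat τ S ω)ᵀ = covMat τ S ω := by
  simp [covMat, Matrix.transpose_sum, Matrix.transpose_vecMulVec]

lemma isHermitian_covMat (τ : Fin m → ℝ) (S : Finset (Fin m)) (ω : Sample n m) :
    (covMat τ S ω).IsHermitian := by
  have h : (covMat τ S ω)ᴴ = (covMat τ S ω)ᵀ := by
    ext i j
    simp [covMat, Matrix.sum_apply, vecMulVec_apply, tensorVec]
  rw [Matrix.IsHermitian, h, transpose_covMat]

lemma transpose_resolventOn (τ : Fin m → ℝ) (S : Finset (Fin m)) (z : ℂ) (ω : Sample n m) :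
    (resolventOn τ S z ω)ᵀ = resolventOn τ S z ω := by
  simp [resolventOn, Matrix.transpose_nonsing_inv, transpose_covMat]

lemma isUnit_det_covMat_sub (τ : Fin m → ℝ) (S : Finset (Fin m)) {z : ℂ} (hz : z.im ≠ 0)
    (ω : Sample n m) :
    IsUnit (covMat τ S ω - z • (1 : Matrix (Fin n × Fin n) (Fin n × Fin n) ℂ)).det :=
  isUnit_det_sub_smul (isHermitian_covMat τ S ω) hz

lemma nsq_resolventOn_le (τ : Fin m → ℝ) (S : Finset (Fin m)) {z : ℂ} (hz : z.im ≠ 0)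
    (ω : Sample n m) (v : Fin n × Fin n → ℂ) :
    z.im ^ 2 * nsq (resolventOn τ S z ω *ᵥ v) ≤ nsq v :=
  nsq_resolvent_le (isHermitian_covMat τ S ω) hz v

lemma contr_resolventOn (τ : Fin m → ℝ) (S : Finset (Fin m)) {z : ℂ} (hz : 1 ≤ |z.im|)
    (ω : Sample n m) : Contr (resolventOn τ S z ω) := fun v => by
  have h0 : z.im ≠ 0 := by intro h; rw [h] at hz; norm_num at hz
  have h := nsq_resolventOn_le τ S h0 ω v
  have h1 : 1 ≤ z.im ^ 2 := by rw [← sq_abs]; nlinarith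
  nlinarith [nsq_nonneg (resolventOn τ S z ω *ᵥ v)]

lemma continuous_tensorVec (α : Fin m) :
    Continuous fun ω : Sample n m => tensorVec ω α := by
  simp_rw [tensorVec_eq_tens]
  exact continuous_tens.comp (continuous_apply α)

lemma continuous_covMat (τ : Fin m → ℝ) (S : Finset (Fin m)) :
    Continuous fun ω : Sample n m => covMat τ S ω := by
  unfold covMat
  refine continuous_finsetSum _ fun β _ => ?_
  have h := (continuous_tensorVec (n := n) β).matrix_vecMulVec (continuous_tensorVec β)
  exact h.const_smul (τ β : ℂ)

lemma continuous_resolventOn (τ : Fin m → ℝ) (S : Finset (Fin m)) {z : ℂ} (hz : z.im ≠ 0) :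
    Continuous fun ω : Sample n m => resolventOn τ S z ω := by
  have hc := (continuous_covMat (n := n) τ S).sub
    (continuous_const (y := z • (1 : Matrix (Fin n × Fin n) (Fin n × Fin n) ℂ)))
  simp only [resolventOn, Matrix.inv_def, Ring.inverse_eq_inv']
  exact (hc.matrix_det.inv₀ fun ω => (isUnit_det_covMat_sub τ S hz ω).ne_zero).smul
    hc.matrix_adjugate

lemma tensorVec_update_of_ne {α β : Fin m} (h : β ≠ α) (ω : Sample n m) (x : Sph n × Sph n) :
    tensorVec (Function.update ω α x) β = tensorVec ω β := by
  rw [tensorVec_eq_tens, tensorVec_eq_tens, Function.update_of_ne h]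

/-- The independence of `G^α` and `Y_α`, in the form used by resampling and by Efron–Stein. -/
lemma resolventOn_erase_update (τ : Fin m → ℝ) (S : Finset (Fin m)) (z : ℂ) (α : Fin m)
    (ω : Sample n m) (x : Sph n × Sph n) :
    resolventOn τ (S.erase α) z (Function.update ω α x) = resolventOn τ (S.erase α) z ω := by
  have : covMat τ (S.erase α) (Function.update ω α x) = covMat τ (S.erase α) ω := by
    refine Finset.sum_congr rfl fun β hβ => ?_
    rw [tensorVec_update_of_ne (Finset.ne_of_mem_erase hβ)]
  rw [resolventOn, this, resolventOn]

/-- The quantity `A_α` of the submodel indexed by `S`. -/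
def denom (τ : Fin m → ℝ) (S : Finset (Fin m)) (α : Fin m) (z : ℂ) (ω : Sample n m) : ℂ :=
  1 + τ α * ((resolventOn τ (S.erase α) z ω *ᵥ tensorVec ω α) ⬝ᵥ tensorVec ω α)

/-- Here the condition `2T ≤ |Im z|` enters; it keeps each `A_α`, and each `1 + τ x` with `|Im z|
‖x‖ ≤ 1`, at distance at least `1/2` from zero. -/
lemma norm_mul_le_half {T t : ℝ} {z : ℂ} (hz : Far T z) (ht : |t| ≤ T) {x : ℂ}
    (hx : |z.im| * ‖x‖ ≤ 1) : ‖(t : ℂ) * x‖ ≤ 1 / 2 := by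
  rw [norm_mul, Complex.norm_real, Real.norm_eq_abs]
  have h2 := hz.2
  have h3 : |t| * ‖x‖ ≤ T * ‖x‖ := by gcongr
  nlinarith [norm_nonneg x]

lemma half_le_norm_one_add {x : ℂ} (hx : ‖x‖ ≤ 1 / 2) : 1 / 2 ≤ ‖1 + x‖ := by
  have h := norm_sub_norm_le (1 : ℂ) (-x)
  rw [sub_neg_eq_add, norm_neg, norm_one] at h
  linarith

lemma im_mul_norm_quadForm_le (τ : Fin m → ℝ) (S : Finset (Fin m)) {z : ℂ} (hz : z.im ≠ 0)
    (ω : Sample n m) (v w : Fin n × Fin n → ℂ) (hv : nsq v ≤ 1) (hw : nsq w ≤ 1) :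
    |z.im| * ‖(resolventOn τ S z ω *ᵥ v) ⬝ᵥ w‖ ≤ 1 := by
  have h := norm_dotProduct_sq_le (resolventOn τ S z ω *ᵥ v) w
  have h1 := nsq_resolventOn_le τ S hz ω v
  refine (sq_le_one_iff₀ (by positivity)).1 ?_
  rw [mul_pow, sq_abs]
  have h2 := nsq_nonneg (resolventOn τ S z ω *ᵥ v)
  have h3 := nsq_nonneg w
  calc z.im ^ 2 * ‖(resolventOn τ S z ω *ᵥ v) ⬝ᵥ w‖ ^ 2
      ≤ z.im ^ 2 * (nsq (resolventOn τ S z ω *ᵥ v) * nsq w) := by gcongr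
    _ = (z.im ^ 2 * nsq (resolventOn τ S z ω *ᵥ v)) * nsq w := by ring
    _ ≤ 1 * 1 := by gcongr; exact h1.trans hv
    _ = 1 := one_mul 1

variable {T : ℝ} {τ : Fin m → ℝ} {z : ℂ}

lemma half_le_norm_denom (hz : Far T z) (hτ : ∀ α, |τ α| ≤ T) (S : Finset (Fin m)) (α : Fin m)
    (ω : Sample n m) : 1 / 2 ≤ ‖denom τ S α z ω‖ :=
  half_le_norm_one_add (norm_mul_le_half hz (hτ α)
    (im_mul_norm_quadForm_le τ _ hz.im_ne_zero ω _ _ (nsq_tensorVec ω α).le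
      (nsq_tensorVec ω α).le))

lemma ne_zero_of_half_le {x : ℂ} (h : 1 / 2 ≤ ‖x‖) : x ≠ 0 := by
  intro h0; rw [h0, norm_zero] at h; norm_num at h

lemma norm_inv_le_two {x : ℂ} (h : 1 / 2 ≤ ‖x‖) : ‖x⁻¹‖ ≤ 2 := by
  rw [norm_inv]
  exact inv_le_of_inv_le₀ (by norm_num) (by simpa using h)

lemma denom_ne_zero (hz : Far T z) (hτ : ∀ α, |τ α| ≤ T) (S : Finset (Fin m)) (α : Fin m)
    (ω : Sample n m) : denom τ S α z ω ≠ 0 := ne_zero_of_half_le (half_le_norm_denom hz hτ S α ω)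

/-- The vector `G^α Y_α` of the submodel indexed by `S`. -/
def resVec (τ : Fin m → ℝ) (S : Finset (Fin m)) (α : Fin m) (z : ℂ) (ω : Sample n m) :
    Fin n × Fin n → ℂ := resolventOn τ (S.erase α) z ω *ᵥ tensorVec ω α

lemma nsq_resVec_le (hz : Far T z) (S : Finset (Fin m)) (α : Fin m) (ω : Sample n m) :
    nsq (resVec τ S α z ω) ≤ 1 :=
  (contr_resolventOn τ _ hz.1 ω _).trans (nsq_tensorVec ω α).le

/-- The rank one formula solved for the full resolvent, which is legitimate because `A_α` does not
vanish; all dependence on `Y_α` becomes explicit. -/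
lemma resolventOn_mulVec (hz : Far T z) (hτ : ∀ α, |τ α| ≤ T) {S : Finset (Fin m)} {α : Fin m}
    (hα : α ∈ S) (ω : Sample n m) : resolventOn τ S z ω *ᵥ tensorVec ω α =
      (denom τ S α z ω)⁻¹ • resVec τ S α z ω ∧
    resolventOn τ S z ω = resolventOn τ (S.erase α) z ω -
      (τ α * (denom τ S α z ω)⁻¹) • vecMulVec (resVec τ S α z ω) (resVec τ S α z ω) := by
  have hW : covMat τ S ω - z • (1 : Matrix (Fin n × Fin n) (Fin n × Fin n) ℂ) =
      (covMat τ (S.erase α) ω - z • (1 : Matrix (Fin n × Fin n) (Fin n × Fin n) ℂ)) +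
        (τ α : ℂ) • vecMulVec (tensorVec ω α) (tensorVec ω α) := by
    rw [covMat, covMat, ← Finset.sum_erase_add _ _ hα]
    abel
  have h := inv_rankOne hW (isUnit_det_covMat_sub τ S hz.im_ne_zero ω)
    (isUnit_det_covMat_sub τ _ hz.im_ne_zero ω) (by simp [transpose_covMat])
  have hd := denom_ne_zero hz hτ S α ω
  have h1 : resolventOn τ S z ω *ᵥ tensorVec ω α =
      (denom τ S α z ω)⁻¹ • resVec τ S α z ω := by
    have h2 : denom τ S α z ω • (resolventOn τ S z ω *ᵥ tensorVec ω α) = resVec τ S α z ω := h.2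
    rw [← h2, smul_smul, inv_mul_cancel₀ hd, one_smul]
  refine ⟨h1, ?_⟩
  have h3 : resolventOn τ (S.erase α) z ω = resolventOn τ S z ω + (τ α : ℂ) •
    vecMulVec (resVec τ S α z ω) (resolventOn τ S z ω *ᵥ tensorVec ω α) := h.1
  rw [h1, Matrix.vecMulVec_smul, smul_smul] at h3
  rw [h3]; abel

lemma continuous_resVec (S : Finset (Fin m)) (α : Fin m) (hz : z.im ≠ 0) :
    Continuous fun ω : Sample n m => resVec τ S α z ω :=
  (continuous_resolventOn τ _ hz).matrix_mulVec (continuous_tensorVec α)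

lemma continuous_denom (S : Finset (Fin m)) (α : Fin m) (hz : z.im ≠ 0) :
    Continuous fun ω : Sample n m => denom τ S α z ω :=
  continuous_const.add (continuous_const.mul
    ((continuous_resVec S α hz).dotProduct (continuous_tensorVec α)))

lemma norm_weight_sq_le (hz : Far T z) (hτ : ∀ α, |τ α| ≤ T) (S : Finset (Fin m)) (α : Fin m)
    (ω : Sample n m) : ‖(τ α * (denom τ S α z ω)⁻¹ : ℂ)‖ ^ 2 ≤ 4 * T ^ 2 := by
  have h1 := norm_inv_le_two (half_le_norm_denom hz hτ S α ω)
  have h2 : ‖(τ α * (denom τ S α z ω)⁻¹ : ℂ)‖ ≤ T * 2 := by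
    rw [norm_mul, Complex.norm_real, Real.norm_eq_abs]
    have := hτ α
    gcongr
    exact (abs_nonneg _).trans this
  calc _ ≤ (T * 2) ^ 2 := by gcongr
    _ = 4 * T ^ 2 := by ring

end ModelBasics

/-! ### Signed permutation symmetry and scalar expectations. -/

section Isotropy

variable {n m : ℕ}

instance isProbabilityMeasure_law [NeZero n] : IsProbabilityMeasure (law n m) := by
  unfold law; infer_instance

/-- The action of a pair of linear isometries on the sample space. -/
def act (U V : EuclideanSpace ℝ (Fin n) ≃ₗᵢ[ℝ] EuclideanSpace ℝ (Fin n)) (ω : Sample n m) :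
    Sample n m := fun α => (sphMap U (ω α).1, sphMap V (ω α).2)

lemma integral_act [NeZero n] {Φ : Sample n m → ℂ} (hΦ : Continuous Φ)
    (U V : EuclideanSpace ℝ (Fin n) ≃ₗᵢ[ℝ] EuclideanSpace ℝ (Fin n)) :
    ∫ ω, Φ (act U V ω) ∂(law n m) = ∫ ω, Φ ω ∂(law n m) := by
  have h : MeasurePreserving (act (m := m) U V) (law n m) (law n m) :=
    measurePreserving_pi _ _ fun _ =>
      (measurePreserving_sphMap U).prod (measurePreserving_sphMap V)
  conv_rhs => rw [← h.map_eq]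
  rw [integral_map h.measurable.aemeasurable hΦ.measurable.aestronglyMeasurable]

/-- A linear isometry that permutes the coordinates and changes some of their signs. -/
structure IsSignedPerm (U : EuclideanSpace ℝ (Fin n) ≃ₗᵢ[ℝ] EuclideanSpace ℝ (Fin n))
    (e : Equiv.Perm (Fin n)) (s : Fin n → ℝ) : Prop where
  apply : ∀ y i, (U y) i = s i * y (e i)
  sq : ∀ i, s i * s i = 1

lemma exists_isSignedPerm_flip (j : Fin n) :
    ∃ U, IsSignedPerm U (Equiv.refl _) (fun i => if i = j then -1 else 1) := by
  refine ⟨LinearIsometryEquiv.piLpCongrRight 2 fun i =>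
    if i = j then LinearIsometryEquiv.neg ℝ else LinearIsometryEquiv.refl ℝ ℝ, fun y i => ?_,
    fun i => ?_⟩
  · by_cases h : i = j <;> simp [h]
  · by_cases h : i = j <;> simp [h]

lemma exists_isSignedPerm_perm (e : Equiv.Perm (Fin n)) :
    ∃ U, IsSignedPerm U e (fun _ => 1) := by
  refine ⟨LinearIsometryEquiv.piLpCongrLeft 2 ℝ ℝ e.symm, fun y i => ?_, fun i => by norm_num⟩
  rw [LinearIsometryEquiv.piLpCongrLeft_apply]
  simp [Equiv.piCongrLeft']

/-- Equivariance under the signed permutations of the coordinates of the two factors. -/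
def Equivariant (Φ : Sample n m → Matrix (Fin n × Fin n) (Fin n × Fin n) ℂ) : Prop :=
  ∀ U V e₁ e₂ s₁ s₂, IsSignedPerm U e₁ s₁ → IsSignedPerm V e₂ s₂ → ∀ ω,
    Φ (act U V ω) = diagonal (fun p => ((s₁ p.1 * s₂ p.2 : ℝ) : ℂ)) *
      (Φ ω).submatrix (e₁.prodCongr e₂) (e₁.prodCongr e₂) *
      diagonal (fun p => ((s₁ p.1 * s₂ p.2 : ℝ) : ℂ))

lemma diagonal_sign_mul_self {s₁ s₂ : Fin n → ℝ} (h₁ : ∀ i, s₁ i * s₁ i = 1)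
    (h₂ : ∀ i, s₂ i * s₂ i = 1) :
    diagonal (fun p : Fin n × Fin n => ((s₁ p.1 * s₂ p.2 : ℝ) : ℂ)) *
      diagonal (fun p : Fin n × Fin n => ((s₁ p.1 * s₂ p.2 : ℝ) : ℂ)) = 1 := by
  rw [Matrix.diagonal_mul_diagonal, ← Matrix.diagonal_one]
  congr 1
  ext p
  rw [← Complex.ofReal_mul, mul_mul_mul_comm, h₁, h₂]; simp

/-- The isometries act on `M_n` by conjugation with a signed permutation matrix, which fixes `z`
times the identity and commutes with inversion. -/
lemma equivariant_resolventOn (τ : Fin m → ℝ) (S : Finset (Fin m)) (z : ℂ) :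
    Equivariant (n := n) (resolventOn τ S z) := by
  intro U V e₁ e₂ s₁ s₂ h₁ h₂ ω
  set D : Matrix (Fin n × Fin n) (Fin n × Fin n) ℂ :=
    diagonal (fun p => ((s₁ p.1 * s₂ p.2 : ℝ) : ℂ)) with hD
  set e := e₁.prodCongr e₂ with he
  have hDD : D * D = 1 := diagonal_sign_mul_self h₁.sq h₂.sq
  have hv : ∀ β, tensorVec (act U V ω) β =
      fun p => ((s₁ p.1 * s₂ p.2 : ℝ) : ℂ) * tensorVec ω β (e p) := by
    intro β
    ext p
    simp only [tensorVec, act, sphMap, h₁.apply, h₂.apply, he, Equiv.prodCongr_apply, Prod.map]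
    push_cast; ring
  have hM : covMat τ S (act U V ω) = D * (covMat τ S ω).submatrix e e * D := by
    ext p q
    rw [hD, Matrix.mul_diagonal, Matrix.diagonal_mul]
    simp only [covMat, Matrix.sum_apply, Matrix.submatrix_apply, Matrix.smul_apply,
      vecMulVec_apply, hv, Finset.mul_sum, Finset.sum_mul, smul_eq_mul]
    exact Finset.sum_congr rfl fun β _ => by ring
  have hMz : covMat τ S (act U V ω) - z • (1 : Matrix (Fin n × Fin n) (Fin n × Fin n) ℂ) =
      D * (covMat τ S ω - z • (1 : Matrix (Fin n × Fin n) (Fin n × Fin n) ℂ)).submatrix e e *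
        D := by
    rw [hM, Matrix.submatrix_sub, Pi.sub_apply, Pi.sub_apply, Matrix.submatrix_smul,
      Pi.smul_apply, Pi.smul_apply, Matrix.submatrix_one_equiv, Matrix.mul_sub, Matrix.sub_mul]
    simp [hDD]
  rw [resolventOn, hMz, Matrix.mul_inv_rev, Matrix.mul_inv_rev, Matrix.inv_submatrix_equiv,
    Matrix.inv_eq_right_inv hDD, Matrix.mul_assoc, resolventOn]

lemma Equivariant.mul {Φ Ψ : Sample n m → Matrix (Fin n × Fin n) (Fin n × Fin n) ℂ}
    (hΦ : Equivariant Φ) (hΨ : Equivariant Ψ) : Equivariant fun ω => Φ ω * Ψ ω := by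
  intro U V e₁ e₂ s₁ s₂ h₁ h₂ ω
  have hDD := diagonal_sign_mul_self h₁.sq h₂.sq
  simp only [hΦ _ _ _ _ _ _ h₁ h₂, hΨ _ _ _ _ _ _ h₁ h₂]
  rw [← Matrix.submatrix_mul_equiv _ _ _ (e₁.prodCongr e₂) _]
  simp only [Matrix.mul_assoc]
  rw [← Matrix.mul_assoc (diagonal _) (diagonal _), hDD, Matrix.one_mul]

/-- The expectation of an equivariant random matrix is scalar. -/
lemma Equivariant.integral_eq [NeZero n]
    {Φ : Sample n m → Matrix (Fin n × Fin n) (Fin n × Fin n) ℂ}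
    (hΦ : Equivariant Φ) (hc : Continuous Φ) (p q : Fin n × Fin n) :
    ∫ ω, Φ ω p q ∂(law n m) =
      if p = q then ((n : ℂ) ^ 2)⁻¹ * ∫ ω, (Φ ω).trace ∂(law n m) else 0 := by
  have hce : ∀ p q, Continuous fun ω => Φ ω p q := fun p q => hc.matrix_elem p q
  have key : ∀ U V e₁ e₂ s₁ s₂, IsSignedPerm U e₁ s₁ → IsSignedPerm V e₂ s₂ → ∀ p q,
      ∫ ω, Φ ω p q ∂(law n m) = ((s₁ p.1 * s₂ p.2 : ℝ) : ℂ) * ((s₁ q.1 * s₂ q.2 : ℝ) : ℂ) *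
        ∫ ω, Φ ω (e₁ p.1, e₂ p.2) (e₁ q.1, e₂ q.2) ∂(law n m) := by
    intro U V e₁ e₂ s₁ s₂ h₁ h₂ p q
    rw [← integral_act (hce p q) U V, ← integral_const_mul]
    refine integral_congr_ae (Eventually.of_forall fun ω => ?_)
    simp only [hΦ _ _ _ _ _ _ h₁ h₂]
    rw [Matrix.mul_diagonal, Matrix.diagonal_mul]
    simp only [Matrix.submatrix_apply, Equiv.prodCongr_apply, Prod.map]
    ring
  -- Transpositions in each factor carry one index pair to any other one, so all the diagonal means
  -- agree.
  have diag : ∀ p q, ∫ ω, Φ ω p p ∂(law n m) = ∫ ω, Φ ω q q ∂(law n m) := by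
    intro p q
    obtain ⟨U, hU⟩ := exists_isSignedPerm_perm (Equiv.swap p.1 q.1)
    obtain ⟨V, hV⟩ := exists_isSignedPerm_perm (Equiv.swap p.2 q.2)
    have := key _ _ _ _ _ _ hU hV p p
    simpa using this
  obtain ⟨Ui, hUi⟩ := exists_isSignedPerm_perm (n := n) (Equiv.refl _)
  split_ifs with h
  · subst h
    simp only [Matrix.trace, Matrix.diag]
    rw [integral_finsetSum _ fun i _ => integrable_of_continuous (hce i i)]
    rw [Finset.sum_congr rfl fun i _ => diag i p]
    have hn : (n : ℂ) ≠ 0 := NeZero.ne _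
    simp
    field_simp
  · have hpq : p.1 ≠ q.1 ∨ p.2 ≠ q.2 := by
      by_contra hh
      push Not at hh
      exact h (Prod.ext hh.1 hh.2)
    -- Flip the sign of a coordinate in which the two indices differ, acting trivially on the other
    -- factor.
    have hneg : ∫ ω, Φ ω p q ∂(law n m) = -∫ ω, Φ ω p q ∂(law n m) := by
      rcases hpq with h1 | h1
      · obtain ⟨U, hU⟩ := exists_isSignedPerm_flip p.1
        have := key _ _ _ _ _ _ hU hUi p q
        simpa [h1.symm] using this
      · obtain ⟨U, hU⟩ := exists_isSignedPerm_flip p.2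
        have := key _ _ _ _ _ _ hUi hU p q
        simpa [h1.symm] using this
    exact self_eq_neg.1 hneg

end Isotropy

/-! ### Fluctuations of the trace and of the partial traces of resolvents. -/

section Fluctuations

variable {n m : ℕ} [NeZero n]

lemma continuous_trace {X : Type*} [TopologicalSpace X] {ι : Type*} [Fintype ι]
    {K : X → Matrix ι ι ℂ} (hK : Continuous K) : Continuous fun x => (K x).trace :=
  hK.matrix_trace

lemma continuous_ptrR {X : Type*} [TopologicalSpace X] {ι κ : Type*} [Fintype ι] [Fintype κ]
    {K : X → Matrix (ι × κ) (ι × κ) ℂ} (hK : Continuous K) : Continuous fun x => ptrR (K x) := by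
  have : ∀ i j, Continuous fun x => K x i j := fun i j => hK.matrix_elem i j
  refine continuous_matrix fun j p => ?_
  unfold ptrR
  fun_prop

lemma continuous_ptrL {X : Type*} [TopologicalSpace X] {ι κ : Type*} [Fintype ι] [Fintype κ]
    {K : X → Matrix (ι × κ) (ι × κ) ℂ} (hK : Continuous K) : Continuous fun x => ptrL (K x) := by
  have : ∀ i j, Continuous fun x => K x i j := fun i j => hK.matrix_elem i j
  refine continuous_matrix fun j p => ?_
  unfold ptrL
  fun_prop

lemma continuous_quadFun {X : Type*} [TopologicalSpace X] {ι κ : Type*} [Fintype ι] [Fintype κ]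
    {K : X → Matrix (ι × κ) (ι × κ) ℂ} (hK : Continuous K) :
    Continuous fun x => quadFun (K x) := by
  have h1 := continuous_hs (continuous_ptrR hK)
  have h2 := continuous_hs (continuous_ptrL hK)
  have h3 := continuous_hs hK
  have h4 := continuous_trace hK
  unfold quadFun
  fun_prop

/-- The Efron–Stein inequality for a functional with bounded differences. -/
lemma variance_le_of_bounded_diff {F : Sample n m → ℂ} {F' : Fin m → Sample n m → ℂ}
    (hF : Continuous F) (hF' : ∀ α, Continuous (F' α))
    (hinv : ∀ α ω x, F' α (Function.update ω α x) = F' α ω) {D : ℝ}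
    (hD : ∀ α ω, ‖F ω - F' α ω‖ ^ 2 ≤ D) :
    ∫ ω, ‖F ω - ∫ ω', F ω' ∂(law n m)‖ ^ 2 ∂(law n m) ≤ m * D := by
  refine (efron_stein F F' hF hF' hinv).trans ?_
  have h : ∀ α : Fin m, ∫ ω, ‖F ω - F' α ω‖ ^ 2 ∂(law n m) ≤ D := fun α => by
    have := hF' α
    exact integral_le_of_forall_le (by fun_prop) (hD α)
  exact (Finset.sum_le_sum fun α _ => h α).trans (by simp)

/-- The Efron–Stein inequality for a random matrix with bounded differences. -/
lemma integral_hs_sub_le {ι κ : Type*} [Fintype ι] [Fintype κ] {K : Sample n m → Matrix ι κ ℂ}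
    {K' : Fin m → Sample n m → Matrix ι κ ℂ} (hK : Continuous K) (hK' : ∀ α, Continuous (K' α))
    (hinv : ∀ α ω x, K' α (Function.update ω α x) = K' α ω) {D : ℝ}
    (hD : ∀ α ω, hs (K ω - K' α ω) ≤ D) :
    ∫ ω, hs (K ω - Matrix.of fun i j => ∫ ω', K ω' i j ∂(law n m)) ∂(law n m) ≤ m * D := by
  have hc : ∀ i j, Continuous fun ω => K ω i j := fun i j => hK.matrix_elem i j
  have hc' : ∀ α i j, Continuous fun ω => K' α ω i j := fun α i j => (hK' α).matrix_elem i j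
  have split : ∀ L : Sample n m → Matrix ι κ ℂ, Continuous L →
      ∫ ω, hs (K ω - L ω) ∂(law n m) = ∑ i, ∑ j, ∫ ω, ‖K ω i j - L ω i j‖ ^ 2 ∂(law n m) := by
    intro L hL
    have hcL : ∀ i j, Continuous fun ω => L ω i j := fun i j => hL.matrix_elem i j
    simp only [hs, Matrix.sub_apply]
    rw [integral_finsetSum _ fun i _ => integrable_of_continuous (by fun_prop)]
    refine Finset.sum_congr rfl fun i _ => ?_
    rw [integral_finsetSum _ fun i _ => integrable_of_continuous (by fun_prop)]
  rw [split (fun _ => Matrix.of fun i j => ∫ ω', K ω' i j ∂(law n m)) continuous_const]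
  calc ∑ i, ∑ j, ∫ ω, ‖K ω i j - ∫ ω', K ω' i j ∂(law n m)‖ ^ 2 ∂(law n m)
      ≤ ∑ i, ∑ j, ∑ α, ∫ ω, ‖K ω i j - K' α ω i j‖ ^ 2 ∂(law n m) := by
        refine Finset.sum_le_sum fun i _ => Finset.sum_le_sum fun j _ => ?_
        exact efron_stein _ (fun α ω => K' α ω i j) (hc i j) (fun α => hc' α i j)
          fun α ω x => by rw [hinv]
    _ = ∑ α, ∫ ω, hs (K ω - K' α ω) ∂(law n m) := by
        simp_rw [fun α => split (K' α) (hK' α)]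
        rw [Finset.sum_comm]
        rw [Finset.sum_congr rfl fun j _ => Finset.sum_comm, Finset.sum_comm]
        exact Finset.sum_congr rfl fun α _ => Finset.sum_comm
    _ ≤ ∑ _α : Fin m, D := by
        refine Finset.sum_le_sum fun α _ => ?_
        exact integral_le_of_forall_le (continuous_hs (hK.sub (hK' α))) (hD α)
    _ = m * D := by simp

/-- The normalized expected trace. -/
def meanTr (Φ : Sample n m → Matrix (Fin n × Fin n) (Fin n × Fin n) ℂ) : ℂ :=
  ((n : ℂ) ^ 2)⁻¹ * ∫ ω, (Φ ω).trace ∂(law n m)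

lemma norm_trace_le {H : Matrix (Fin n × Fin n) (Fin n × Fin n) ℂ} {r : ℝ} (hr : 0 ≤ r)
    (h : hs H ≤ r ^ 2 * (n : ℝ) ^ 2) : ‖H.trace‖ ≤ r * (n : ℝ) ^ 2 := by
  have h1 := norm_trace_mul_sq_le H 1
  rw [Matrix.mul_one, hs_one] at h1
  simp only [Fintype.card_prod, Fintype.card_fin, Nat.cast_mul] at h1
  refine abs_le_of_sq_le_sq' ?_ (by positivity) |>.2
  nlinarith [sq_nonneg (n : ℝ)]

lemma norm_meanTr_le {Φ : Sample n m → Matrix (Fin n × Fin n) (Fin n × Fin n) ℂ}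
    {r : ℝ} (hr : 0 ≤ r) (h : ∀ ω, hs (Φ ω) ≤ r ^ 2 * (n : ℝ) ^ 2) : ‖meanTr Φ‖ ≤ r := by
  have hn : (0 : ℝ) < n := Nat.cast_pos.2 (Nat.pos_of_ne_zero (NeZero.ne n))
  have h1 := norm_integral_le_of_forall_le (μ := law n m) fun ω => norm_trace_le hr (h ω)
  rw [meanTr, norm_mul, norm_inv, norm_pow, Complex.norm_natCast, inv_mul_le_iff₀ (by positivity)]
  linarith

/-- The fluctuations, around its scalar mean, of an equivariant random matrix with bounded
differences. -/
lemma integral_quadFun_sub_le {Φ : Sample n m → Matrix (Fin n × Fin n) (Fin n × Fin n) ℂ}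
    {Φ' : Fin m → Sample n m → Matrix (Fin n × Fin n) (Fin n × Fin n) ℂ} (hc : Continuous Φ)
    (hc' : ∀ α, Continuous (Φ' α)) (he : Equivariant Φ)
    (hinv : ∀ α ω x, Φ' α (Function.update ω α x) = Φ' α ω) {D : ℝ}
    (hT : ∀ α ω, ‖(Φ ω - Φ' α ω).trace‖ ^ 2 ≤ D) (hR : ∀ α ω, hs (ptrR (Φ ω - Φ' α ω)) ≤ D)
    (hL : ∀ α ω, hs (ptrL (Φ ω - Φ' α ω)) ≤ D) (hb : ∀ ω, hs (Φ ω) ≤ (n : ℝ) ^ 2) :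
    ∫ ω, quadFun (Φ ω - meanTr Φ • 1) ∂(law n m) ≤ 5 * m * D + 16 * (n : ℝ) ^ 2 := by
  set c := meanTr Φ with hcdef
  have hn : (n : ℂ) ≠ 0 := NeZero.ne _
  have hce : ∀ p q, Continuous fun ω => Φ ω p q := fun p q => hc.matrix_elem p q
  have hI := fun p q => he.integral_eq hc p q
  have e1 : ∀ ω, (Φ ω - c • 1).trace = (Φ ω).trace - ∫ ω', (Φ ω').trace ∂(law n m) := by
    intro ω
    rw [Matrix.trace_sub, Matrix.trace_smul, Matrix.trace_one, hcdef, meanTr]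
    simp only [Fintype.card_prod, Fintype.card_fin, Nat.cast_mul, smul_eq_mul]
    field_simp
  -- Since the mean of `Φ` is the scalar matrix `c`, subtracting it centres every entry of the
  -- partial trace, and Efron–Stein applies entrywise.
  have e2 : ∀ ω, ptrR (Φ ω - c • 1) =
      ptrR (Φ ω) - Matrix.of fun i j => ∫ ω', ptrR (Φ ω') i j ∂(law n m) := by
    intro ω
    rw [ptrR_sub]
    congr 1
    ext j p
    simp only [ptrR, Matrix.of_apply]
    rw [integral_finsetSum _ fun s _ => integrable_of_continuous (hce _ _)]
    refine Finset.sum_congr rfl fun s _ => ?_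
    rw [hI, Matrix.smul_apply, Matrix.one_apply]
    simp [hcdef, meanTr]
  have e3 : ∀ ω, ptrL (Φ ω - c • 1) =
      ptrL (Φ ω) - Matrix.of fun i j => ∫ ω', ptrL (Φ ω') i j ∂(law n m) := by
    intro ω
    rw [ptrL_sub]
    congr 1
    ext j p
    simp only [ptrL, Matrix.of_apply]
    rw [integral_finsetSum _ fun s _ => integrable_of_continuous (hce _ _)]
    refine Finset.sum_congr rfl fun s _ => ?_
    rw [hI, Matrix.smul_apply, Matrix.one_apply]
    simp [hcdef, meanTr]
  have hc1 : Continuous fun ω => Φ ω - c • (1 : Matrix (Fin n × Fin n) (Fin n × Fin n) ℂ) :=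
    hc.sub continuous_const
  have b1 : ∫ ω, ‖(Φ ω - c • 1).trace‖ ^ 2 ∂(law n m) ≤ m * D := by
    simp_rw [e1]
    refine variance_le_of_bounded_diff (F' := fun α ω => (Φ' α ω).trace) (continuous_trace hc)
      (fun α => continuous_trace (hc' α)) (fun α ω x => by rw [hinv]) fun α ω => ?_
    rw [← Matrix.trace_sub]; exact hT α ω
  have b2 : ∫ ω, hs (ptrR (Φ ω - c • 1)) ∂(law n m) ≤ m * D := by
    simp_rw [e2]
    refine integral_hs_sub_le (K' := fun α ω => ptrR (Φ' α ω)) (continuous_ptrR hc)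
      (fun α => continuous_ptrR (hc' α)) (fun α ω x => by rw [hinv]) fun α ω => ?_
    rw [← ptrR_sub]; exact hR α ω
  have b3 : ∫ ω, hs (ptrL (Φ ω - c • 1)) ∂(law n m) ≤ m * D := by
    simp_rw [e3]
    refine integral_hs_sub_le (K' := fun α ω => ptrL (Φ' α ω)) (continuous_ptrL hc)
      (fun α => continuous_ptrL (hc' α)) (fun α ω x => by rw [hinv]) fun α ω => ?_
    rw [← ptrL_sub]; exact hL α ω
  -- No cancellation is needed in the full Hilbert–Schmidt norm: the trivial bound already has the
  -- order `n²`.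
  have b4 : ∫ ω, hs (Φ ω - c • 1) ∂(law n m) ≤ 4 * (n : ℝ) ^ 2 := by
    refine integral_le_of_forall_le (continuous_hs hc1) fun ω => (hs_sub_le _ _).trans ?_
    have h1 := hb ω
    have h2 : ‖c‖ ≤ 1 := norm_meanTr_le zero_le_one fun ω => by simpa using hb ω
    rw [hs_smul, hs_one]
    simp only [Fintype.card_prod, Fintype.card_fin, Nat.cast_mul]
    have h3 : ‖c‖ ^ 2 ≤ 1 := pow_le_one₀ (norm_nonneg _) h2
    nlinarith [sq_nonneg (n : ℝ)]
  have c1 := (continuous_trace hc1).norm.pow 2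
  have c2 := continuous_hs (continuous_ptrR hc1)
  have c3 := continuous_hs (continuous_ptrL hc1)
  have c4 := continuous_hs hc1
  -- The weights `1, 2, 2` of the trace and the partial traces give `5 m D`; the weight `4` on `4
  -- n²` gives `16 n²`.
  unfold quadFun
  rw [integral_add (integrable_of_continuous (by fun_prop))
    (integrable_of_continuous (by fun_prop)), integral_add (integrable_of_continuous (by fun_prop))
    (integrable_of_continuous (by fun_prop)), integral_add (integrable_of_continuous (by fun_prop))
    (integrable_of_continuous (by fun_prop)), integral_const_mul, integral_const_mul,
    integral_const_mul]
  linarith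

variable {T : ℝ} {τ : Fin m → ℝ} {z : ℂ}

lemma hs_resolventOn_le (hz : Far T z) (S : Finset (Fin m)) (ω : Sample n m) :
    hs (resolventOn τ S z ω) ≤ (n : ℝ) ^ 2 := by
  have := (contr_resolventOn τ S hz.1 ω).hs_le
  simpa [pow_two] using this

/-- The normalized expected trace of the resolvent of the submodel indexed by `S`. -/
def meanRes (n : ℕ) [NeZero n] (τ : Fin m → ℝ) (S : Finset (Fin m)) (z : ℂ) : ℂ :=
  meanTr (n := n) (resolventOn τ S z)

lemma norm_meanRes_le_one (hz : Far T z) (S : Finset (Fin m)) : ‖meanRes n τ S z‖ ≤ 1 :=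
  norm_meanTr_le zero_le_one fun ω => by simpa using hs_resolventOn_le hz S ω

lemma hs_resolventOn_le_inv (hz : z.im ≠ 0) (S : Finset (Fin m)) (ω : Sample n m) :
    hs (resolventOn τ S z ω) ≤ (|z.im|⁻¹) ^ 2 * (n : ℝ) ^ 2 := by
  have hk : Contr ((z.im : ℂ) • resolventOn τ S z ω) := fun v => by
    rw [Matrix.smul_mulVec, nsq_smul, Complex.norm_real, Real.norm_eq_abs, sq_abs]
    exact nsq_resolventOn_le τ S hz ω v
  have h := hk.hs_le
  rw [hs_smul, Complex.norm_real, Real.norm_eq_abs] at h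
  have h0 : 0 < |z.im| := abs_pos.2 hz
  rw [inv_pow, inv_mul_eq_div, le_div_iff₀ (by positivity)]
  simp only [Fintype.card_prod, Fintype.card_fin, Nat.cast_mul] at h
  linarith

lemma im_mul_norm_meanRes_le (hz : z.im ≠ 0) (S : Finset (Fin m)) :
    |z.im| * ‖meanRes n τ S z‖ ≤ 1 := by
  have h := norm_meanTr_le (r := |z.im|⁻¹) (by positivity)
    fun ω => hs_resolventOn_le_inv (n := n) (τ := τ) hz S ω
  have h0 : 0 < |z.im| := abs_pos.2 hz
  calc |z.im| * ‖meanRes n τ S z‖ ≤ |z.im| * |z.im|⁻¹ := by gcongr; exact h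
    _ = 1 := mul_inv_cancel₀ h0.ne'

lemma half_le_norm_one_add_meanRes (hz : Far T z) {t : ℝ} (ht : |t| ≤ T) (S : Finset (Fin m)) :
    1 / 2 ≤ ‖1 + t * meanRes n τ S z‖ :=
  half_le_norm_one_add (norm_mul_le_half hz ht (im_mul_norm_meanRes_le hz.im_ne_zero S))

/-- If `α ∉ S` nothing changes and the coefficient is zero. Including this case allows an arbitrary
`S`, in particular the index set of `G^α`, whose own fluctuations govern `A_α`. -/
lemma resolventOn_sub_erase (hz : Far T z) (hτ : ∀ α, |τ α| ≤ T) (S : Finset (Fin m)) (α : Fin m)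
    (ω : Sample n m) : ∃ c : ℂ, ‖c‖ ^ 2 ≤ 4 * T ^ 2 ∧ resolventOn τ S z ω -
      resolventOn τ (S.erase α) z ω = c • vecMulVec (resVec τ S α z ω) (resVec τ S α z ω) := by
  by_cases h : α ∈ S
  · refine ⟨-(τ α * (denom τ S α z ω)⁻¹), ?_, ?_⟩
    · rw [norm_neg]; exact norm_weight_sq_le hz hτ S α ω
    · conv_lhs => rw [(resolventOn_mulVec hz hτ h ω).2]
      rw [neg_smul]; abel
  · exact ⟨0, by simp; positivity, by rw [Finset.erase_eq_of_notMem h]; simp⟩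

lemma mul_le_of_le_one {a b c d : ℝ} (ha : 0 ≤ a) (h1 : a ≤ c) (h2 : b ≤ d)
    (hd : d ≤ 1) : a * b ≤ c := by
  nlinarith

/-- Each difference is of rank one with bounded weight, hence changes the trace and both partial
traces by `O(1)`. The total is `O(m + n²)`, while the trivial bound for the squared trace would be
`n⁴`. -/
lemma integral_quadFun_resolventOn_le (hz : Far T z) (hτ : ∀ α, |τ α| ≤ T)
    (S : Finset (Fin m)) :
    ∫ ω, quadFun (resolventOn τ S z ω - meanRes n τ S z • 1) ∂(law n m) ≤
      20 * T ^ 2 * m + 16 * (n : ℝ) ^ 2 := by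
  have key : ∀ α (ω : Sample n m), ∃ c : ℂ, ‖c‖ ^ 2 ≤ 4 * T ^ 2 ∧ resolventOn τ S z ω -
      resolventOn τ (S.erase α) z ω = c • vecMulVec (resVec τ S α z ω) (resVec τ S α z ω) :=
    fun α ω => resolventOn_sub_erase hz hτ S α ω
  have hv : ∀ α (ω : Sample n m), nsq (resVec τ S α z ω) * nsq (resVec τ S α z ω) ≤ 1 :=
    fun α ω => mul_le_one₀ (nsq_resVec_le hz S α ω) (nsq_nonneg _) (nsq_resVec_le hz S α ω)
  refine (integral_quadFun_sub_le (D := 4 * T ^ 2)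
    (Φ' := fun α ω => resolventOn τ (S.erase α) z ω) (continuous_resolventOn τ S hz.im_ne_zero)
    (fun α => continuous_resolventOn τ _ hz.im_ne_zero) (equivariant_resolventOn τ S z)
    (fun α ω x => resolventOn_erase_update τ S z α ω x) ?_ ?_ ?_
    (fun ω => hs_resolventOn_le hz S ω)).trans (le_of_eq (by ring))
  · intro α ω
    obtain ⟨c, hc, h⟩ := key α ω
    rw [h, Matrix.trace_smul, norm_smul, mul_pow]
    exact mul_le_of_le_one (by positivity) hc
      (norm_trace_vecMulVec_sq_le _ _) (hv α ω)
  · intro α ω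
    obtain ⟨c, hc, h⟩ := key α ω
    rw [h, ptrR_smul, hs_smul]
    exact mul_le_of_le_one (by positivity) hc (hs_ptrR_vecMulVec_le _ _) (hv α ω)
  · intro α ω
    obtain ⟨c, hc, h⟩ := key α ω
    rw [h, ptrL_smul, hs_smul]
    exact mul_le_of_le_one (by positivity) hc (hs_ptrL_vecMulVec_le _ _) (hv α ω)

/-- The normalized expected trace of the squared resolvent of the submodel indexed by `S`. -/
def meanResSq (n : ℕ) [NeZero n] (τ : Fin m → ℝ) (S : Finset (Fin m)) (z : ℂ) : ℂ :=
  meanTr (n := n) (fun ω => resolventOn τ S z ω * resolventOn τ S z ω)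

lemma hs_resolventOn_sq_le (hz : Far T z) (S : Finset (Fin m)) (ω : Sample n m) :
    hs (resolventOn τ S z ω * resolventOn τ S z ω) ≤ (n : ℝ) ^ 2 :=
  ((contr_resolventOn τ S hz.1 ω).hs_mul_le _).trans (hs_resolventOn_le hz S ω)

lemma norm_meanResSq_le_one (hz : Far T z) (S : Finset (Fin m)) : ‖meanResSq n τ S z‖ ≤ 1 :=
  norm_meanTr_le zero_le_one fun ω => by simpa using hs_resolventOn_sq_le hz S ω

lemma integral_quadFun_resolventOn_sq_le (hz : Far T z) (hτ : ∀ α, |τ α| ≤ T)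
    (S : Finset (Fin m)) :
    ∫ ω, quadFun (resolventOn τ S z ω * resolventOn τ S z ω - meanResSq n τ S z • 1) ∂(law n m) ≤
      80 * T ^ 2 * m + 16 * (n : ℝ) ^ 2 := by
  have key : ∀ α (ω : Sample n m), ∃ (c : ℂ) (u u₁ u₂ : Fin n × Fin n → ℂ), ‖c‖ ^ 2 ≤ 4 * T ^ 2 ∧
      nsq u₁ * nsq u ≤ 1 ∧ nsq u * nsq u₂ ≤ 1 ∧
      resolventOn τ S z ω * resolventOn τ S z ω -
        resolventOn τ (S.erase α) z ω * resolventOn τ (S.erase α) z ω =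
        c • (vecMulVec u₁ u + vecMulVec u u₂) := by
    intro α ω
    obtain ⟨c, hc, h⟩ := resolventOn_sub_erase hz hτ S α ω
    set R := resolventOn τ S z ω
    set R₀ := resolventOn τ (S.erase α) z ω with hR₀
    set u := resVec τ S α z ω with hu
    have hu1 : nsq u ≤ 1 := nsq_resVec_le hz S α ω
    have h1 : nsq (R *ᵥ u) ≤ 1 := (contr_resolventOn τ S hz.1 ω u).trans hu1
    have h2 : nsq (R₀ *ᵥ u) ≤ 1 := (contr_resolventOn τ _ hz.1 ω u).trans hu1
    refine ⟨c, u, R *ᵥ u, R₀ *ᵥ u, hc, mul_le_one₀ h1 (nsq_nonneg _) hu1,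
      mul_le_one₀ hu1 (nsq_nonneg _) h2, ?_⟩
    have hsym : u ᵥ* R₀ = R₀ *ᵥ u := by
      rw [← Matrix.mulVec_transpose, hR₀, transpose_resolventOn]
    -- Telescoping turns the difference of squares into two rank one matrices. For this reason the
    -- constant is `16 T²` here and `4 T²` for the resolvent itself.
    have : R * R - R₀ * R₀ = R * (R - R₀) + (R - R₀) * R₀ := by
      rw [Matrix.mul_sub, Matrix.sub_mul]; abel
    rw [this, h, Matrix.mul_smul, Matrix.smul_mul, Matrix.mul_vecMulVec, Matrix.vecMulVec_mul, hsym,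
      smul_add]
  have fin : ∀ c x : ℝ, 0 ≤ c → 0 ≤ x → c ≤ 4 * T ^ 2 → x ≤ 2 * 1 + 2 * 1 →
      c * x ≤ 16 * T ^ 2 := by
    intro c x h1 h2 h3 h4
    nlinarith
  refine (integral_quadFun_sub_le (D := 16 * T ^ 2)
    (Φ' := fun α ω => resolventOn τ (S.erase α) z ω * resolventOn τ (S.erase α) z ω)
    ((continuous_resolventOn τ S hz.im_ne_zero).matrix_mul
      (continuous_resolventOn τ S hz.im_ne_zero))
    (fun α => (continuous_resolventOn τ _ hz.im_ne_zero).matrix_mul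
      (continuous_resolventOn τ _ hz.im_ne_zero))
    ((equivariant_resolventOn τ S z).mul (equivariant_resolventOn τ S z))
    (fun α ω x => by rw [resolventOn_erase_update]) ?_ ?_ ?_
    (fun ω => hs_resolventOn_sq_le hz S ω)).trans (le_of_eq (by ring))
  · intro α ω
    obtain ⟨c, u, u₁, u₂, hc, hu1, hu2, h⟩ := key α ω
    rw [h, Matrix.trace_smul, norm_smul, mul_pow, Matrix.trace_add]
    refine fin _ _ (by positivity) (by positivity) hc ((norm_add_sq_le _ _).trans ?_)
    gcongr
    · exact (norm_trace_vecMulVec_sq_le _ _).trans hu1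
    · exact (norm_trace_vecMulVec_sq_le _ _).trans hu2
  · intro α ω
    obtain ⟨c, u, u₁, u₂, hc, hu1, hu2, h⟩ := key α ω
    rw [h, ptrR_smul, hs_smul, ptrR_add]
    refine fin _ _ (by positivity) (hs_nonneg _) hc ((hs_add_le _ _).trans ?_)
    gcongr
    · exact (hs_ptrR_vecMulVec_le _ _).trans hu1
    · exact (hs_ptrR_vecMulVec_le _ _).trans hu2
  · intro α ω
    obtain ⟨c, u, u₁, u₂, hc, hu1, hu2, h⟩ := key α ω
    rw [h, ptrL_smul, hs_smul, ptrL_add]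
    refine fin _ _ (by positivity) (hs_nonneg _) hc ((hs_add_le _ _).trans ?_)
    gcongr
    · exact (hs_ptrL_vecMulVec_le _ _).trans hu1
    · exact (hs_ptrL_vecMulVec_le _ _).trans hu2

end Fluctuations

/-! ### Averaging over `Y_α` with an independent matrix frozen. -/

section Resampling

variable {n m : ℕ} [NeZero n]
  {H : Sample n m → Matrix (Fin n × Fin n) (Fin n × Fin n) ℂ} {α : Fin m}

/-- As `H` ignores the coordinate `α`, the vector `Y_α` can be integrated first; its form averages
to the normalized trace. -/
lemma integral_quadForm_resample (hc : Continuous H)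
    (hinv : ∀ ω x, H (Function.update ω α x) = H ω) :
    ∫ ω, tensorVec ω α ⬝ᵥ (H ω *ᵥ tensorVec ω α) ∂(law n m) = meanTr H := by
  rw [law, integral_update
    (continuous_quadForm hc (continuous_tensorVec α) (continuous_tensorVec α)) α]
  simp only [tensorVec_eq_tens, hinv, Function.update_self, integral_quadForm_tens]
  rw [integral_const_mul, meanTr, law]

lemma integral_norm_quadForm_sq_resample_le (hc : Continuous H)
    (hinv : ∀ ω x, H (Function.update ω α x) = H ω) :
    ∫ ω, ‖tensorVec ω α ⬝ᵥ (H ω *ᵥ tensorVec ω α)‖ ^ 2 ∂(law n m) ≤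
      ((n : ℝ) ^ 4)⁻¹ * ∫ ω, quadFun (H ω) ∂(law n m) := by
  have c1 : Continuous fun p : Sample n m × (Sph n × Sph n) =>
      ‖tens p.2 ⬝ᵥ (H p.1 *ᵥ tens p.2)‖ ^ 2 :=
    (continuous_quadForm (hc.comp continuous_fst) (continuous_tens.comp continuous_snd)
      (continuous_tens.comp continuous_snd)).norm.pow 2
  have c2 : Continuous fun ω => ‖tensorVec ω α ⬝ᵥ (H ω *ᵥ tensorVec ω α)‖ ^ 2 :=
    (continuous_quadForm hc (continuous_tensorVec α) (continuous_tensorVec α)).norm.pow 2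
  rw [← integral_const_mul, law, integral_update c2 α]
  simp only [tensorVec_eq_tens, hinv, Function.update_self]
  exact integral_mono_of_continuous (continuous_integral_right c1)
    (continuous_const.mul (continuous_quadFun hc)) fun ω => integral_norm_quadForm_sq_tens_le _

/-- Contraction of the first index of a vector of a tensor product. -/
def contrFst (u : Fin n × Fin n → ℂ) (v : Fin n → ℂ) : Fin n → ℂ := fun s => ∑ j, u (j, s) * v j

/-- Contraction of the second index of a vector of a tensor product. -/
def contrSnd (u : Fin n × Fin n → ℂ) (v : Fin n → ℂ) : Fin n → ℂ := fun j => ∑ s, u (j, s) * v s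

lemma contrFst_tens (K : Matrix (Fin n × Fin n) (Fin n × Fin n) ℂ) (p : Sph n × Sph n) :
    contrFst (K *ᵥ tens p) (vec p.1) = innerForm K (vec p.1) *ᵥ vec p.2 := by
  ext s
  simp only [contrFst, Matrix.mulVec, dotProduct, innerForm, Matrix.of_apply, tens,
    Fintype.sum_prod_type, Finset.sum_mul, Finset.mul_sum]
  rw [Finset.sum_comm' (t' := Finset.univ) (s' := fun _ => Finset.univ) (by simp)]
  rw [Finset.sum_congr rfl fun _ _ => Finset.sum_comm, Finset.sum_comm]
  refine Finset.sum_congr rfl fun q _ => ?_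
  rw [Finset.sum_comm]
  exact Finset.sum_congr rfl fun j _ => Finset.sum_congr rfl fun p _ => by ring

lemma nsq_comp_swap_contr (K : Matrix (Fin n × Fin n) (Fin n × Fin n) ℂ) (p : Sph n × Sph n) :
    contrSnd (K *ᵥ tens p) (vec p.2) = contrFst (swapT K *ᵥ tens p.swap) (vec p.swap.1) := by
  ext j
  simp only [contrFst, contrSnd, swapT]
  refine Finset.sum_congr rfl fun s _ => ?_
  congr 1
  simp only [Matrix.mulVec, dotProduct, Matrix.submatrix_apply, Prod.swap]
  rw [← (Equiv.prodComm (Fin n) (Fin n)).sum_comp]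
  refine Finset.sum_congr rfl fun q _ => ?_
  change K (j, s) (q.2, q.1) * _ = _
  simp [tens, mul_comm]

lemma quadFun_swapT (K : Matrix (Fin n × Fin n) (Fin n × Fin n) ℂ) :
    quadFun (swapT K) = quadFun K := by
  have h1 : (swapT K).trace = K.trace := by
    rw [← trace_ptrR, ← trace_ptrR]
    simp only [swapT, ptrR, Matrix.trace, Matrix.diag, Matrix.submatrix_apply, Prod.swap]
    exact Finset.sum_comm
  have h2 : ptrL (swapT K) = ptrR K := rfl
  rw [quadFun, quadFun, h1, h2, ptrR_swapT, hs_swapT]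
  ring

lemma continuous_contrFst {X : Type*} [TopologicalSpace X] {u : X → Fin n × Fin n → ℂ}
    {v : X → Fin n → ℂ} (hu : Continuous u) (hv : Continuous v) :
    Continuous fun x => contrFst (u x) (v x) := by
  unfold contrFst; fun_prop

lemma continuous_contrSnd {X : Type*} [TopologicalSpace X] {u : X → Fin n × Fin n → ℂ}
    {v : X → Fin n → ℂ} (hu : Continuous u) (hv : Continuous v) :
    Continuous fun x => contrSnd (u x) (v x) := by
  unfold contrSnd; fun_prop

lemma continuous_nsq {X ι : Type*} [TopologicalSpace X] [Fintype ι] {v : X → ι → ℂ}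
    (hv : Continuous v) : Continuous fun x => nsq (v x) := by
  unfold nsq; fun_prop

lemma integral_nsq_contrFst_le (K : Matrix (Fin n × Fin n) (Fin n × Fin n) ℂ) :
    ∫ p, nsq (contrFst (K *ᵥ tens p) (vec p.1)) ∂((unifSphere n).prod (unifSphere n)) ≤
      ((n : ℝ) ^ 3)⁻¹ * quadFun K := by
  simp_rw [contrFst_tens]
  exact integral_contract_right_le K

/-- Exchange the two factors: the law of the pair and `quadFun` are both invariant. -/
lemma integral_nsq_contrSnd_le (K : Matrix (Fin n × Fin n) (Fin n × Fin n) ℂ) :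
    ∫ p, nsq (contrSnd (K *ᵥ tens p) (vec p.2)) ∂((unifSphere n).prod (unifSphere n)) ≤
      ((n : ℝ) ^ 3)⁻¹ * quadFun K := by
  simp_rw [nsq_comp_swap_contr]
  rw [integral_prod_swap (f := fun p : Sph n × Sph n =>
    nsq (contrFst (swapT K *ᵥ tens p) (vec p.1))), ← quadFun_swapT K]
  exact integral_nsq_contrFst_le _

lemma integral_nsq_contrFst_resample_le (hc : Continuous H)
    (hinv : ∀ ω x, H (Function.update ω α x) = H ω) :
    ∫ ω, nsq (contrFst (H ω *ᵥ tensorVec ω α) (vec (ω α).1)) ∂(law n m) ≤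
      ((n : ℝ) ^ 3)⁻¹ * ∫ ω, quadFun (H ω) ∂(law n m) := by
  have c0 : Continuous fun ω : Sample n m => vec (ω α).1 :=
    continuous_vec'.comp (continuous_fst.comp (continuous_apply α))
  have c1 : Continuous fun p : Sample n m × (Sph n × Sph n) =>
      nsq (contrFst (H p.1 *ᵥ tens p.2) (vec p.2.1)) :=
    continuous_nsq (continuous_contrFst
      ((hc.comp continuous_fst).matrix_mulVec (continuous_tens.comp continuous_snd))
      (continuous_vec'.comp (continuous_fst.comp continuous_snd)))
  rw [← integral_const_mul, law, integral_update (continuous_nsq (continuous_contrFst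
    (hc.matrix_mulVec (continuous_tensorVec α)) c0)) α]
  simp only [tensorVec_eq_tens, hinv, Function.update_self]
  exact integral_mono_of_continuous (continuous_integral_right c1)
    (continuous_const.mul (continuous_quadFun hc)) fun ω => integral_nsq_contrFst_le _

lemma integral_nsq_contrSnd_resample_le (hc : Continuous H)
    (hinv : ∀ ω x, H (Function.update ω α x) = H ω) :
    ∫ ω, nsq (contrSnd (H ω *ᵥ tensorVec ω α) (vec (ω α).2)) ∂(law n m) ≤
      ((n : ℝ) ^ 3)⁻¹ * ∫ ω, quadFun (H ω) ∂(law n m) := by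
  have c0 : Continuous fun ω : Sample n m => vec (ω α).2 :=
    continuous_vec'.comp (continuous_snd.comp (continuous_apply α))
  have c1 : Continuous fun p : Sample n m × (Sph n × Sph n) =>
      nsq (contrSnd (H p.1 *ᵥ tens p.2) (vec p.2.2)) :=
    continuous_nsq (continuous_contrSnd
      ((hc.comp continuous_fst).matrix_mulVec (continuous_tens.comp continuous_snd))
      (continuous_vec'.comp (continuous_snd.comp continuous_snd)))
  rw [← integral_const_mul, law, integral_update (continuous_nsq (continuous_contrSnd
    (hc.matrix_mulVec (continuous_tensorVec α)) c0)) α]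
  simp only [tensorVec_eq_tens, hinv, Function.update_self]
  exact integral_mono_of_continuous (continuous_integral_right c1)
    (continuous_const.mul (continuous_quadFun hc)) fun ω => integral_nsq_contrSnd_le _

end Resampling

/-! ### Part (i): the variances of `A_α`, `B_α` and `γ_n`. -/

section Variances

variable {n m : ℕ} [NeZero n] {T q : ℝ} {τ : Fin m → ℝ} {z : ℂ}

/-- The constant in the bounds of the fluctuations. -/
def flucConst (T q : ℝ) : ℝ := 80 * T ^ 2 * q + 16

lemma natCast_pos_of_neZero : (0 : ℝ) < n := Nat.cast_pos.2 (Nat.pos_of_ne_zero (NeZero.ne n))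

lemma nonneg_of_card_le (hm : (m : ℝ) ≤ q * (n : ℝ) ^ 2) : 0 ≤ q := by
  have hn : (0 : ℝ) < n := natCast_pos_of_neZero
  have h : 0 ≤ q * (n : ℝ) ^ 2 := (Nat.cast_nonneg m).trans hm
  exact nonneg_of_mul_nonneg_left h (by positivity)

lemma sixteen_le_flucConst (hm : (m : ℝ) ≤ q * (n : ℝ) ^ 2) : 16 ≤ flucConst T q := by
  have := nonneg_of_card_le hm
  unfold flucConst
  nlinarith [mul_nonneg (sq_nonneg T) this]

lemma integral_quadFun_res_le (hz : Far T z) (hτ : ∀ α, |τ α| ≤ T)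
    (hm : (m : ℝ) ≤ q * (n : ℝ) ^ 2) (S : Finset (Fin m)) :
    ∫ ω, quadFun (resolventOn τ S z ω - meanRes n τ S z • 1) ∂(law n m) ≤
      flucConst T q * (n : ℝ) ^ 2 := by
  refine (integral_quadFun_resolventOn_le hz hτ S).trans ?_
  unfold flucConst
  have := Nat.cast_nonneg (α := ℝ) m
  nlinarith [mul_le_mul_of_nonneg_left hm (sq_nonneg T), mul_nonneg (sq_nonneg T) this]

lemma integral_quadFun_resSq_le (hz : Far T z) (hτ : ∀ α, |τ α| ≤ T)
    (hm : (m : ℝ) ≤ q * (n : ℝ) ^ 2) (S : Finset (Fin m)) :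
    ∫ ω, quadFun (resolventOn τ S z ω * resolventOn τ S z ω - meanResSq n τ S z • 1) ∂(law n m) ≤
      flucConst T q * (n : ℝ) ^ 2 := by
  refine (integral_quadFun_resolventOn_sq_le hz hτ S).trans ?_
  unfold flucConst
  nlinarith [mul_le_mul_of_nonneg_left hm (sq_nonneg T)]

/-- The quadratic form of a centered random matrix that is independent of `Y_α`. -/
lemma integral_norm_quadForm_sub_sq_le
    {H : Sample n m → Matrix (Fin n × Fin n) (Fin n × Fin n) ℂ} {α : Fin m} (hc : Continuous H)
    (hinv : ∀ ω x, H (Function.update ω α x) = H ω) (a : ℂ) {V : ℝ}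
    (hV : ∫ ω, quadFun (H ω - a • 1) ∂(law n m) ≤ V) :
    ∫ ω, ‖tensorVec ω α ⬝ᵥ (H ω *ᵥ tensorVec ω α) - a‖ ^ 2 ∂(law n m) ≤ V / (n : ℝ) ^ 4 := by
  have h := integral_norm_quadForm_sq_resample_le (α := α) (H := fun ω => H ω - a • 1)
    (hc.sub continuous_const) (fun ω x => by rw [hinv])
  -- As `(Y_α, Y_α) = 1`, subtracting a scalar from the matrix subtracts the same scalar from the
  -- form.
  have e : ∀ ω : Sample n m, tensorVec ω α ⬝ᵥ ((H ω - a • 1) *ᵥ tensorVec ω α) =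
      tensorVec ω α ⬝ᵥ (H ω *ᵥ tensorVec ω α) - a := by
    intro ω
    rw [Matrix.sub_mulVec, dotProduct_sub, Matrix.smul_mulVec, Matrix.one_mulVec, dotProduct_smul,
      dotProduct_tensorVec_self, smul_eq_mul, mul_one]
  simp only [e] at h
  refine h.trans ?_
  rw [div_eq_inv_mul]
  gcongr

lemma integral_norm_res_quadForm_sub_sq_le (hz : Far T z) (hτ : ∀ α, |τ α| ≤ T)
    (hm : (m : ℝ) ≤ q * (n : ℝ) ^ 2) (S : Finset (Fin m)) (α : Fin m) :
    ∫ ω, ‖resVec τ S α z ω ⬝ᵥ tensorVec ω α - meanRes n τ (S.erase α) z‖ ^ 2 ∂(law n m) ≤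
      flucConst T q / (n : ℝ) ^ 2 := by
  have hn : (0 : ℝ) < n := natCast_pos_of_neZero
  have h := integral_norm_quadForm_sub_sq_le (α := α)
    (continuous_resolventOn τ (S.erase α) hz.im_ne_zero)
    (fun ω x => resolventOn_erase_update τ S z α ω x) _
    (integral_quadFun_res_le (n := n) hz hτ hm (S.erase α))
  have e : flucConst T q * (n : ℝ) ^ 2 / (n : ℝ) ^ 4 = flucConst T q / (n : ℝ) ^ 2 := by
    field_simp
  rw [e] at h
  simpa only [resVec, dotProduct_comm] using h

lemma integral_norm_denom_sub_sq_le (hz : Far T z) (hτ : ∀ α, |τ α| ≤ T)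
    (hm : (m : ℝ) ≤ q * (n : ℝ) ^ 2) (S : Finset (Fin m)) (α : Fin m) :
    ∫ ω, ‖denom τ S α z ω - (1 + τ α * meanRes n τ (S.erase α) z)‖ ^ 2 ∂(law n m) ≤
      T ^ 2 * flucConst T q / (n : ℝ) ^ 2 := by
  have h := integral_norm_res_quadForm_sub_sq_le (n := n) hz hτ hm S α
  have e : ∀ ω : Sample n m, ‖denom τ S α z ω - (1 + τ α * meanRes n τ (S.erase α) z)‖ ^ 2 =
      τ α ^ 2 * ‖resVec τ S α z ω ⬝ᵥ tensorVec ω α - meanRes n τ (S.erase α) z‖ ^ 2 := by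
    intro ω
    have : denom τ S α z ω - (1 + τ α * meanRes n τ (S.erase α) z) =
      (τ α : ℂ) * (resVec τ S α z ω ⬝ᵥ tensorVec ω α - meanRes n τ (S.erase α) z) := by
      rw [denom, resVec]; ring
    rw [this, norm_mul, mul_pow, Complex.norm_real, Real.norm_eq_abs, sq_abs]
  simp_rw [e]
  rw [integral_const_mul, mul_div_assoc]
  have h2 : τ α ^ 2 ≤ T ^ 2 := sq_le_sq.2 ((hτ α).trans (le_abs_self T))
  exact mul_le_mul h2 h (integral_nonneg fun _ => by positivity) (sq_nonneg T)

/-- The quantity `B_α` of the submodel indexed by `S`. -/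
def numer (τ : Fin m → ℝ) (S : Finset (Fin m)) (α : Fin m) (z : ℂ) (ω : Sample n m) : ℂ :=
  τ α * (((resolventOn τ (S.erase α) z ω ^ 2) *ᵥ tensorVec ω α) ⬝ᵥ tensorVec ω α)

lemma continuous_numer (S : Finset (Fin m)) (α : Fin m) (hz : z.im ≠ 0) :
    Continuous fun ω : Sample n m => numer τ S α z ω := by
  have h := continuous_resolventOn (n := n) τ (S.erase α) hz
  have h2 : Continuous fun ω : Sample n m => resolventOn τ (S.erase α) z ω ^ 2 := by
    simp_rw [pow_two]; exact h.matrix_mul h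
  exact continuous_const.mul
    ((h2.matrix_mulVec (continuous_tensorVec α)).dotProduct (continuous_tensorVec α))

lemma integral_norm_numer_sub_sq_le (hz : Far T z) (hτ : ∀ α, |τ α| ≤ T)
    (hm : (m : ℝ) ≤ q * (n : ℝ) ^ 2) (S : Finset (Fin m)) (α : Fin m) :
    ∫ ω, ‖numer τ S α z ω - τ α * meanResSq n τ (S.erase α) z‖ ^ 2 ∂(law n m) ≤
      T ^ 2 * flucConst T q / (n : ℝ) ^ 2 := by
  have hn : (0 : ℝ) < n := natCast_pos_of_neZero
  have hc := continuous_resolventOn (n := n) τ (S.erase α) hz.im_ne_zero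
  have h := integral_norm_quadForm_sub_sq_le (α := α) (hc.matrix_mul hc)
    (fun ω x => by rw [resolventOn_erase_update]) _
    (integral_quadFun_resSq_le (n := n) hz hτ hm (S.erase α))
  have e1 : flucConst T q * (n : ℝ) ^ 2 / (n : ℝ) ^ 4 = flucConst T q / (n : ℝ) ^ 2 := by
    field_simp
  rw [e1] at h
  have e : ∀ ω : Sample n m, ‖numer τ S α z ω - τ α * meanResSq n τ (S.erase α) z‖ ^ 2 =
      τ α ^ 2 * ‖tensorVec ω α ⬝ᵥ ((resolventOn τ (S.erase α) z ω *
        resolventOn τ (S.erase α) z ω) *ᵥ tensorVec ω α) - meanResSq n τ (S.erase α) z‖ ^ 2 := by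
    intro ω
    rw [numer, ← mul_sub, norm_mul, mul_pow, Complex.norm_real, Real.norm_eq_abs, sq_abs,
      dotProduct_comm, pow_two (resolventOn _ _ _ _)]
  simp_rw [e]
  rw [integral_const_mul, mul_div_assoc]
  have h2 : τ α ^ 2 ≤ T ^ 2 := sq_le_sq.2 ((hτ α).trans (le_abs_self T))
  exact mul_le_mul h2 h (integral_nonneg fun _ => by positivity) (sq_nonneg T)

lemma var_A_le (hz : Far T z) (hτ : ∀ α, |τ α| ≤ T)
    (hm : (m : ℝ) ≤ q * (n : ℝ) ^ 2) (α : Fin m) :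
    var (n := n) (A τ α z) ≤ T ^ 2 * flucConst T q / (n : ℝ) ^ 2 :=
  (integral_var_le (continuous_denom Finset.univ α hz.im_ne_zero) _).trans
    (integral_norm_denom_sub_sq_le hz hτ hm Finset.univ α)

lemma var_B_le (hz : Far T z) (hτ : ∀ α, |τ α| ≤ T)
    (hm : (m : ℝ) ≤ q * (n : ℝ) ^ 2) (α : Fin m) :
    var (n := n) (B τ α z) ≤ T ^ 2 * flucConst T q / (n : ℝ) ^ 2 :=
  (integral_var_le (continuous_numer Finset.univ α hz.im_ne_zero) _).trans
    (integral_norm_numer_sub_sq_le hz hτ hm Finset.univ α)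

/-- The trace of the resolvent changes by `-B_α / A_α` when the `α`-th term is added. -/
lemma trace_resolventOn_sub (hz : Far T z) (hτ : ∀ α, |τ α| ≤ T) {S : Finset (Fin m)} {α : Fin m}
    (hα : α ∈ S) (ω : Sample n m) : (resolventOn τ S z ω).trace -
      (resolventOn τ (S.erase α) z ω).trace = -(numer τ S α z ω / denom τ S α z ω) := by
  conv_lhs => rw [(resolventOn_mulVec hz hτ hα ω).2]
  rw [Matrix.trace_sub, Matrix.trace_smul, Matrix.trace_vecMulVec, numer, div_eq_mul_inv,
    smul_eq_mul]
  have : resVec τ S α z ω ⬝ᵥ resVec τ S α z ω =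
      ((resolventOn τ (S.erase α) z ω ^ 2) *ᵥ tensorVec ω α) ⬝ᵥ tensorVec ω α := by
    rw [pow_two, ← Matrix.mulVec_mulVec, resVec, Matrix.dotProduct_mulVec,
      ← Matrix.mulVec_transpose, transpose_resolventOn]
  rw [this]; ring

lemma norm_div_sub_div_sq_le {A B a b : ℂ} {T : ℝ} (hA : 1 / 2 ≤ ‖A‖) (ha : 1 / 2 ≤ ‖a‖)
    (hb : ‖b‖ ≤ T) :
    ‖B / A - b / a‖ ^ 2 ≤ 8 * ‖B - b‖ ^ 2 + 32 * T ^ 2 * ‖A - a‖ ^ 2 := by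
  have hA0 := ne_zero_of_half_le hA
  have ha0 := ne_zero_of_half_le ha
  have e : B / A - b / a = (B - b) * A⁻¹ - b * A⁻¹ * a⁻¹ * (A - a) := by field_simp; ring
  have h1 := norm_inv_le_two hA
  have h2 := norm_inv_le_two ha
  have hT : 0 ≤ T := (norm_nonneg b).trans hb
  rw [e]
  refine (norm_sub_sq_le _ _).trans ?_
  rw [norm_mul, norm_mul, norm_mul, norm_mul]
  have h3 : ‖B - b‖ * ‖A⁻¹‖ ≤ ‖B - b‖ * 2 := by gcongr
  have h4 : ‖b‖ * ‖A⁻¹‖ * ‖a⁻¹‖ * ‖A - a‖ ≤ T * 2 * 2 * ‖A - a‖ := by gcongr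
  calc _ ≤ 2 * (‖B - b‖ * 2) ^ 2 + 2 * (T * 2 * 2 * ‖A - a‖) ^ 2 := by gcongr
    _ = _ := by ring

/-- The comparison functional matters. Efron–Stein with `Tr G^α` alone has increments of order `1`
and yields only `O(n²)`. Subtracting in addition the constant `b α / a α`, the deterministic
approximation of `B_α / A_α`, leaves increments with second moment `O(n⁻²)`, and there are `O(n²)`
of them. -/
lemma var_gam_le (hz : Far T z) (hτ : ∀ α, |τ α| ≤ T)
    (hm : (m : ℝ) ≤ q * (n : ℝ) ^ 2) :
    var (n := n) (gam τ z) ≤ q * (8 + 32 * T ^ 2) * (T ^ 2 * flucConst T q) := by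
  have hn : (0 : ℝ) < n := natCast_pos_of_neZero
  set S : Finset (Fin m) := Finset.univ with hS
  set a : Fin m → ℂ := fun α => 1 + τ α * meanRes n τ (S.erase α) z with ha
  set b : Fin m → ℂ := fun α => τ α * meanResSq n τ (S.erase α) z with hb
  have hbT : ∀ α, ‖b α‖ ≤ T := by
    intro α
    simp only [hb]
    rw [norm_mul, Complex.norm_real, Real.norm_eq_abs]
    have h1 := norm_meanResSq_le_one (n := n) (τ := τ) hz (S.erase α)
    nlinarith [hτ α, abs_nonneg (τ α), norm_nonneg (meanResSq n τ (S.erase α) z)]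
  have hcd := fun α => continuous_denom (n := n) (τ := τ) S α hz.im_ne_zero
  have hcn := fun α => continuous_numer (n := n) (τ := τ) S α hz.im_ne_zero
  have hd := fun α (ω : Sample n m) => half_le_norm_denom hz hτ S α ω
  have hct := fun S => continuous_trace (continuous_resolventOn (n := n) τ S hz.im_ne_zero)
  have h1 := efron_stein (μ := (unifSphere n).prod (unifSphere n))
    (fun ω : Sample n m => (resolventOn τ S z ω).trace)
    (fun α ω => (resolventOn τ (S.erase α) z ω).trace - b α / a α)
    (hct S) (fun α => (hct _).sub continuous_const)
    (fun α ω x => by rw [resolventOn_erase_update])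
  refine h1.trans ?_
  have h2 : ∀ α : Fin m, ∫ ω, ‖(resolventOn τ S z ω).trace -
      ((resolventOn τ (S.erase α) z ω).trace - b α / a α)‖ ^ 2 ∂(law n m) ≤
      (8 + 32 * T ^ 2) * (T ^ 2 * flucConst T q / (n : ℝ) ^ 2) := by
    intro α
    have hα : α ∈ S := Finset.mem_univ α
    have h3 : ∀ ω : Sample n m, ‖(resolventOn τ S z ω).trace -
        ((resolventOn τ (S.erase α) z ω).trace - b α / a α)‖ ^ 2 ≤
        8 * ‖numer τ S α z ω - b α‖ ^ 2 + 32 * T ^ 2 * ‖denom τ S α z ω - a α‖ ^ 2 := by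
      intro ω
      have e : (resolventOn τ S z ω).trace -
          ((resolventOn τ (S.erase α) z ω).trace - b α / a α) =
          -(numer τ S α z ω / denom τ S α z ω - b α / a α) := by
        have := trace_resolventOn_sub hz hτ hα ω
        linear_combination this
      rw [e, norm_neg]
      exact norm_div_sub_div_sq_le (hd α ω) (half_le_norm_one_add_meanRes hz (hτ α) _) (hbT α)
    have c1 := hcd α
    have c2 := hcn α
    have c3 := hct S
    have c4 := hct (S.erase α)
    refine (integral_mono_of_continuous (by fun_prop) (by fun_prop) h3).trans ?_
    rw [integral_add (integrable_of_continuous (by fun_prop))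
      (integrable_of_continuous (by fun_prop)), integral_const_mul, integral_const_mul, add_mul]
    gcongr
    · exact integral_norm_numer_sub_sq_le hz hτ hm S α
    · exact integral_norm_denom_sub_sq_le hz hτ hm S α
  refine (Finset.sum_le_sum fun α _ => h2 α).trans ?_
  rw [Finset.sum_const, Finset.card_univ, Fintype.card_fin, nsmul_eq_mul]
  have hQ := sixteen_le_flucConst (T := T) hm
  calc (m : ℝ) * ((8 + 32 * T ^ 2) * (T ^ 2 * flucConst T q / (n : ℝ) ^ 2))
      ≤ (q * (n : ℝ) ^ 2) * ((8 + 32 * T ^ 2) * (T ^ 2 * flucConst T q / (n : ℝ) ^ 2)) := by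
        gcongr
    _ = _ := by field_simp

end Variances

/-! ### The law of the weights and the limiting equation. -/

section WeightLaw

variable {σ : Measure ℝ} [IsProbabilityMeasure σ] {T c : ℝ}

/-- Truncation of the real line to the interval `[0, T]`. -/
def clamp (T t : ℝ) : ℝ := max 0 (min T t)

lemma continuous_clamp : Continuous (clamp T) := by unfold clamp; fun_prop

lemma clamp_mem (hT : 0 ≤ T) (t : ℝ) : clamp T t ∈ Set.Icc 0 T :=
  ⟨le_max_left _ _, max_le hT (min_le_left _ _)⟩

lemma clamp_eq_self {t : ℝ} (ht : t ∈ Set.Icc 0 T) : clamp T t = t := by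
  rw [clamp, min_eq_right ht.2, max_eq_right ht.1]

lemma continuous_comp_clamp (hT : 0 ≤ T) {h : ℝ → ℂ} (hh : ContinuousOn h (Set.Icc 0 T)) :
    Continuous fun t => h (clamp T t) :=
  hh.comp_continuous continuous_clamp (clamp_mem hT)

lemma integrable_of_continuousOn_Icc (hT : 0 ≤ T) (hσ : ∀ᵐ t ∂σ, t ∈ Set.Icc 0 T) {h : ℝ → ℂ}
    (hh : ContinuousOn h (Set.Icc 0 T)) : Integrable h σ := by
  obtain ⟨B, hB⟩ := isCompact_Icc.exists_bound_of_continuousOn hh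
  have h1 : Integrable (fun t => h (clamp T t)) σ :=
    Integrable.of_bound (continuous_comp_clamp hT hh).aestronglyMeasurable B
      (Eventually.of_forall fun t => hB _ (clamp_mem hT t))
  refine h1.congr ?_
  filter_upwards [hσ] with t ht
  rw [clamp_eq_self ht]

lemma integral_countingMeasure {m : ℕ} (τ : Fin m → ℝ) {φ : ℝ → ℝ} :
    ∫ t, φ t ∂(countingMeasure τ) = (m : ℝ)⁻¹ * ∑ α, φ (τ α) := by
  rw [countingMeasure, integral_smul_measure, integral_finsetSum_measure]
  · simp
  · intro α _
    exact integrable_dirac (by simp)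

lemma norm_average_le {m : ℕ} (v : Fin m → ℂ) {b : ℝ} (hb : 0 ≤ b) (hv : ∀ α, ‖v α‖ ≤ b) :
    ‖(m : ℂ)⁻¹ * ∑ α, v α‖ ≤ b := by
  rcases Nat.eq_zero_or_pos m with h | h
  · subst h; simpa using hb
  · have h0 : (0 : ℝ) < m := Nat.cast_pos.2 h
    rw [norm_mul, norm_inv, Complex.norm_natCast, inv_mul_le_iff₀ h0]
    exact (norm_sum_le _ _).trans ((Finset.sum_le_sum fun α _ => hv α).trans (by simp))

/-- Comparison of the average over the weights with the integral over their limiting law. -/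
lemma norm_sum_weights_sub_integral_le {n m : ℕ} (hn : 1 ≤ n) {τ : Fin m → ℝ} {K C : ℝ}
    (hT : 0 ≤ T) (hc : 0 ≤ c) (hσ : ∀ᵐ t ∂σ, t ∈ Set.Icc 0 T) (hτ : ∀ α, τ α ∈ Set.Icc 0 T)
    (hrate : ∀ φ : ℝ →ᵇ ℝ, |(∫ t, φ t ∂(countingMeasure τ)) - ∫ t, φ t ∂σ| ≤
      C / (n : ℝ) ^ 2 * ‖φ‖)
    (hK : |(m : ℝ) - c * (n : ℝ) ^ 2| ≤ K) {h : ℝ → ℂ} (hh : ContinuousOn h (Set.Icc 0 T))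
    {b : ℝ} (hb : ∀ t ∈ Set.Icc 0 T, ‖h t‖ ≤ b) :
    ‖((n : ℂ) ^ 2)⁻¹ * ∑ α, h (τ α) - c * ∫ t, h t ∂σ‖ ≤ (K + 2 * c * C) * b / (n : ℝ) ^ 2 := by
  have hn0 : (0 : ℝ) < n := Nat.cast_pos.2 hn
  have hnC : (n : ℂ) ≠ 0 := by exact_mod_cast hn0.ne'
  have hb0 : 0 ≤ b := (norm_nonneg _).trans (hb 0 ⟨le_rfl, hT⟩)
  have hhc := continuous_comp_clamp hT hh
  have hbc : ∀ t, ‖h (clamp T t)‖ ≤ b := fun t => hb _ (clamp_mem hT t)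
  -- No sign is assumed for `C`; the rate tested on the constant function `1` supplies it.
  have hC : 0 ≤ C / (n : ℝ) ^ 2 := by
    have := hrate (BoundedContinuousFunction.const ℝ 1)
    have h1 := (abs_nonneg _).trans this
    rwa [BoundedContinuousFunction.norm_const_eq, norm_one, mul_one] at h1
  -- The rate concerns real bounded continuous functions on the whole line. It is applied to the
  -- real and imaginary parts of `h` composed with the truncation to `[0, T]`, which costs a factor
  -- `2`.
  have part : ∀ p : ℂ → ℝ, Continuous p → (∀ w, |p w| ≤ ‖w‖) →
      |(m : ℝ)⁻¹ * ∑ α, p (h (τ α)) - ∫ t, p (h (clamp T t)) ∂σ| ≤ C / (n : ℝ) ^ 2 * b := by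
    intro p hp hpb
    have hpb' : ∀ t, ‖p (h (clamp T t))‖ ≤ b := fun t => (hpb _).trans (hbc t)
    set φ : ℝ →ᵇ ℝ := BoundedContinuousFunction.ofNormedAddCommGroup
      (fun t => p (h (clamp T t))) (hp.comp hhc) b hpb' with hφ
    have h1 := hrate φ
    rw [integral_countingMeasure] at h1
    have h2 : ∀ α, φ (τ α) = p (h (τ α)) := fun α => by
      simp [hφ, clamp_eq_self (hτ α)]
    simp only [h2] at h1
    refine h1.trans ?_
    gcongr
    exact BoundedContinuousFunction.norm_ofNormedAddCommGroup_le _ hb0 hpb'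
  set s : ℂ := (m : ℂ)⁻¹ * ∑ α, h (τ α) with hs
  have hint : Integrable (fun t => h (clamp T t)) σ :=
    Integrable.of_bound hhc.aestronglyMeasurable b (Eventually.of_forall hbc)
  have hI : ∫ t, h t ∂σ = ∫ t, h (clamp T t) ∂σ := by
    refine integral_congr_ae ?_
    filter_upwards [hσ] with t ht
    rw [clamp_eq_self ht]
  have hsI : ‖s - ∫ t, h t ∂σ‖ ≤ 2 * (C / (n : ℝ) ^ 2 * b) := by
    have hre := part Complex.re Complex.continuous_re Complex.abs_re_le_norm
    have him := part Complex.im Complex.continuous_im Complex.abs_im_le_norm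
    have e1 : (s - ∫ t, h t ∂σ).re =
        (m : ℝ)⁻¹ * ∑ α, (h (τ α)).re - ∫ t, (h (clamp T t)).re ∂σ := by
      have := integral_re hint
      simp only [RCLike.re_to_complex] at this
      rw [Complex.sub_re, hI, this, hs, ← Complex.ofReal_natCast, ← Complex.ofReal_inv,
        Complex.re_ofReal_mul, Complex.re_sum]
    have e2 : (s - ∫ t, h t ∂σ).im =
        (m : ℝ)⁻¹ * ∑ α, (h (τ α)).im - ∫ t, (h (clamp T t)).im ∂σ := by
      have := integral_im hint
      simp only [RCLike.im_to_complex] at this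
      rw [Complex.sub_im, hI, this, hs, ← Complex.ofReal_natCast, ← Complex.ofReal_inv,
        Complex.im_ofReal_mul, Complex.im_sum]
    have := Complex.norm_le_abs_re_add_abs_im (s - ∫ t, h t ∂σ)
    rw [e1, e2] at this
    linarith
  have hsb : ‖s‖ ≤ b := norm_average_le _ hb0 fun α => hb _ (hτ α)
  have hms : ((n : ℂ) ^ 2)⁻¹ * ∑ α, h (τ α) = ((m : ℂ) / (n : ℂ) ^ 2) * s := by
    rcases Nat.eq_zero_or_pos m with h0 | h0
    · subst h0; simp
    · have : (m : ℂ) ≠ 0 := by exact_mod_cast h0.ne'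
      rw [hs]; field_simp
  -- Two sources of error: the number of weights compared with `c n²`, measured by `K`, and their
  -- law compared with `σ`, measured by `C`.
  have e : ((n : ℂ) ^ 2)⁻¹ * ∑ α, h (τ α) - c * ∫ t, h t ∂σ =
      ((((m : ℝ) - c * (n : ℝ) ^ 2) / (n : ℝ) ^ 2 : ℝ) : ℂ) * s + c * (s - ∫ t, h t ∂σ) := by
    rw [hms]; push_cast; field_simp; ring
  rw [e]
  refine (norm_add_le _ _).trans ?_
  rw [norm_mul _ s, norm_mul (c : ℂ), Complex.norm_real, Complex.norm_real, Real.norm_eq_abs,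
    Real.norm_eq_abs,
    abs_div, abs_of_nonneg hc, abs_of_nonneg (show 0 ≤ (n : ℝ) ^ 2 by positivity)]
  calc |(m : ℝ) - c * (n : ℝ) ^ 2| / (n : ℝ) ^ 2 * ‖s‖ + c * ‖s - ∫ t, h t ∂σ‖
      ≤ K / (n : ℝ) ^ 2 * b + c * (2 * (C / (n : ℝ) ^ 2 * b)) := by
        have hK0 : 0 ≤ K := (abs_nonneg _).trans hK
        gcongr
    _ = (K + 2 * c * C) * b / (n : ℝ) ^ 2 := by ring

/-- The limiting law of the weights is concentrated on `[0, T]`. -/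
lemma ConditionA.ae_mem_Icc (hT : 0 ≤ T) {m : ℕ → ℕ} {τ : (n : ℕ) → Fin (m n) → ℝ} {C : ℝ}
    (hA : ConditionA m τ σ T C) : ∀ᵐ t ∂σ, t ∈ Set.Icc 0 T := by
  -- The truncated distance to `[0, T]` is a test function with zero integral against every counting
  -- measure, hence against `σ`.
  have hcont : Continuous fun t => min 1 |t - clamp T t| := by
    have := continuous_clamp (T := T)
    fun_prop
  have hnn : ∀ t, 0 ≤ min 1 |t - clamp T t| := fun t => le_min zero_le_one (abs_nonneg _)
  have hbd : ∀ t, ‖min 1 |t - clamp T t|‖ ≤ 1 := fun t => by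
    rw [Real.norm_of_nonneg (hnn t)]; exact min_le_left _ _
  set φ : ℝ →ᵇ ℝ := BoundedContinuousFunction.ofNormedAddCommGroup
      (fun t => min 1 |t - clamp T t|) hcont 1 hbd with hφ
  have h0 : ∀ n, ∫ t, φ t ∂(countingMeasure (τ n)) = 0 := by
    intro n
    rw [integral_countingMeasure]
    have : ∀ α, φ (τ n α) = 0 := fun α => by
      simp [hφ, clamp_eq_self ⟨hA.nonneg n α, hA.le_bound n α⟩]
    simp [this]
  have hle : ∀ n : ℕ, 1 ≤ n → ∫ t, φ t ∂σ ≤ C / (n : ℝ) ^ 2 * ‖φ‖ := by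
    intro n hn
    have := hA.rate n hn φ
    rw [h0, zero_sub, abs_neg] at this
    exact (le_abs_self _).trans this
  have hlim : Tendsto (fun n : ℕ => C / (n : ℝ) ^ 2 * ‖φ‖) atTop (𝓝 0) := by
    have : Tendsto (fun n : ℕ => C / (n : ℝ) ^ 2) atTop (𝓝 0) :=
      tendsto_const_nhds.div_atTop ((tendsto_pow_atTop two_ne_zero).comp
        tendsto_natCast_atTop_atTop)
    simpa using this.mul_const ‖φ‖
  have hzero : ∫ t, φ t ∂σ ≤ 0 :=
    ge_of_tendsto hlim ((eventually_ge_atTop 1).mono hle)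
  have hz : ∫ t, φ t ∂σ = 0 := le_antisymm hzero (integral_nonneg hnn)
  have hint : Integrable φ σ := φ.integrable σ
  replace hz := (integral_eq_zero_iff_of_nonneg (f := φ) hnn hint).1 hz
  filter_upwards [hz] with t ht
  have h1 : min 1 |t - clamp T t| = 0 := ht
  have h2 : |t - clamp T t| = 0 := by
    rcases min_choice 1 |t - clamp T t| with h | h
    · rw [h] at h1; norm_num at h1
    · rwa [h] at h1
  have h3 : t = clamp T t := by linarith [abs_eq_zero.1 h2]
  rw [h3]
  exact clamp_mem hT t

/-- The nonzero denominators of the limiting equation. -/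
lemma one_add_mul_ne_zero {w : ℂ} (hw : w.im ≠ 0) (t : ℝ) : (1 + t * w : ℂ) ≠ 0 := by
  intro h
  have h1 := congrArg Complex.im h
  simp only [Complex.add_im, Complex.one_im, Complex.im_ofReal_mul, Complex.zero_im, zero_add,
    mul_eq_zero, hw, or_false] at h1
  rw [h1] at h
  simp at h

/-- The solution of the limiting equation is bounded by `1 / |Im z|`, and the equation can be
written without the constant term `c`. -/
lemma limit_equation (hc : 0 ≤ c) (hT : 0 ≤ T) (hσ : ∀ᵐ t ∂σ, t ∈ Set.Icc 0 T) {z w : ℂ}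
    (hz : z.im ≠ 0) (hzw : 0 ≤ w.im * z.im)
    (heq : z * w = -1 + c - ∫ t : ℝ, (c : ℂ) / (1 + t * w) ∂σ) :
    |z.im| * ‖w‖ ≤ 1 ∧ z * w = -1 + c * ∫ t : ℝ, t * w / (1 + t * w) ∂σ := by
  -- For a real `w` the right side is real, so `z * w` is real with `z` nonreal, which forces `w =
  -- 0`; the equation then reads `0 = -1`.
  have hw : w.im ≠ 0 := by
    intro h0
    have hwr : w = (w.re : ℂ) := Complex.ext rfl (by simpa using h0)
    have e1 : ∫ t : ℝ, (c : ℂ) / (1 + t * w) ∂σ = ((∫ t : ℝ, c / (1 + t * w.re) ∂σ : ℝ) : ℂ) := by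
      rw [← integral_complex_ofReal]
      refine integral_congr_ae (Eventually.of_forall fun t => ?_)
      simp only
      rw [hwr]; push_cast; simp
    have h2 := congrArg Complex.im heq
    rw [e1] at h2
    simp only [Complex.mul_im, h0, mul_zero, zero_add, Complex.sub_im, Complex.add_im,
      Complex.neg_im, Complex.one_im, neg_zero, Complex.ofReal_im, sub_zero, add_zero,
      mul_eq_zero, hz, false_or] at h2
    have h3 : w = 0 := Complex.ext h2 h0
    rw [h3] at heq
    simp at heq
  have hne := one_add_mul_ne_zero hw
  have c1 : Continuous fun t : ℝ => (1 + t * w : ℂ) := by fun_prop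
  have i1 : Integrable (fun t : ℝ => t * w / (1 + t * w : ℂ)) σ :=
    integrable_of_continuousOn_Icc hT hσ
      ((Continuous.div (by fun_prop) c1 hne).continuousOn)
  have i2 : Integrable (fun t : ℝ => (t : ℂ) / (1 + t * w : ℂ)) σ :=
    integrable_of_continuousOn_Icc hT hσ
      ((Continuous.div (by fun_prop) c1 hne).continuousOn)
  have e2 : z * w = -1 + c * ∫ t : ℝ, t * w / (1 + t * w) ∂σ := by
    have : ∀ t : ℝ, (c : ℂ) / (1 + t * w) = c - c * (t * w / (1 + t * w)) := by
      intro t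
      have := hne t
      field_simp
      ring
    rw [heq, integral_congr_ae (Eventually.of_forall this),
      integral_sub (integrable_const _) (i1.const_mul _), integral_const_mul]
    simp only [integral_const, probReal_univ, one_smul]
    ring
  refine ⟨?_, e2⟩
  -- The equation becomes `(z - c J) w = -1`. Since `t ≥ 0`, `Im J` and `Im w` have opposite signs,
  -- so `-c J` can only increase `|Im z|`, and the bound on `w` follows.
  set J := ∫ t : ℝ, (t : ℂ) / (1 + t * w : ℂ) ∂σ with hJ
  have e3 : (z - c * J) * w = -1 := by
    have : ∫ t : ℝ, t * w / (1 + t * w) ∂σ = J * w := by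
      rw [hJ, ← integral_mul_const]
      exact integral_congr_ae (Eventually.of_forall fun t => by simp only; ring)
    rw [this] at e2
    linear_combination e2
  have hJim : J.im * w.im ≤ 0 := by
    have h1 := integral_im i2
    simp only [RCLike.im_to_complex] at h1
    rw [← hJ] at h1
    rw [← h1, ← integral_mul_const]
    refine integral_nonpos fun t => ?_
    simp only [Pi.zero_apply]
    rw [Complex.div_im]
    simp only [Complex.ofReal_im, Complex.add_im, Complex.one_im, Complex.im_ofReal_mul,
      Complex.ofReal_re, zero_mul, zero_div, zero_add, zero_sub]
    rw [neg_mul, neg_nonpos, div_mul_eq_mul_div]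
    refine div_nonneg ?_ (Complex.normSq_nonneg _)
    nlinarith [mul_self_nonneg (t * w.im)]
  have hJz : J.im * z.im ≤ 0 := by
    by_contra h
    push Not at h
    have h1 : 0 < w.im * z.im := lt_of_le_of_ne hzw (mul_ne_zero hw hz).symm
    have h2 : J.im * z.im * (w.im * z.im) ≤ 0 := by
      have : J.im * z.im * (w.im * z.im) = (J.im * w.im) * z.im ^ 2 := by ring
      rw [this]
      exact mul_nonpos_of_nonpos_of_nonneg hJim (sq_nonneg _)
    nlinarith [mul_pos h h1]
  have hnorm : |z.im| ≤ ‖z - c * J‖ := by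
    refine le_trans ?_ (Complex.abs_im_le_norm _)
    rw [Complex.sub_im, Complex.im_ofReal_mul]
    refine sq_le_sq.1 ?_
    nlinarith [mul_nonneg hc (neg_nonneg.2 hJz), sq_nonneg (c * J.im)]
  have h5 := congrArg norm e3
  rw [norm_mul, norm_neg, norm_one] at h5
  rw [← h5]
  gcongr

lemma norm_frac_le {t : ℝ} {w : ℂ} (ht : 0 ≤ t) (htT : t ≤ T) (hw : 1 / 2 ≤ ‖(1 + t * w : ℂ)‖)
    (hw1 : ‖w‖ ≤ 1) : ‖(t * w / (1 + t * w) : ℂ)‖ ≤ 2 * T := by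
  rw [div_eq_mul_inv, norm_mul, norm_mul, Complex.norm_real, Real.norm_of_nonneg ht]
  have h1 := norm_inv_le_two hw
  have hT : 0 ≤ T := ht.trans htT
  calc t * ‖w‖ * ‖(1 + t * w : ℂ)⁻¹‖ ≤ T * 1 * 2 := by gcongr
    _ = 2 * T := by ring

/-- Stability of the limiting equation far from the real axis. -/
lemma norm_sub_le_of_approx_equation (hc : 0 ≤ c) (hT : 0 ≤ T) (hσ : ∀ᵐ t ∂σ, t ∈ Set.Icc 0 T)
    {z w F : ℂ} (hz : Far T z) (hzc : 8 * c * T ≤ |z.im|) (hw : |z.im| * ‖w‖ ≤ 1)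
    (hF : |z.im| * ‖F‖ ≤ 1) {ε : ℝ}
    (hwe : z * w = -1 + c * ∫ t : ℝ, t * w / (1 + t * w) ∂σ)
    (hFe : ‖z * F - (-1 + c * ∫ t : ℝ, t * F / (1 + t * F) ∂σ)‖ ≤ ε) : ‖F - w‖ ≤ 2 * ε := by
  have hbd : ∀ x : ℂ, |z.im| * ‖x‖ ≤ 1 → ∀ t ∈ Set.Icc 0 T, 1 / 2 ≤ ‖(1 + t * x : ℂ)‖ := by
    intro x hx t ht
    exact half_le_norm_one_add (norm_mul_le_half hz (by rw [abs_of_nonneg ht.1]; exact ht.2) hx)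
  have hint : ∀ x : ℂ, |z.im| * ‖x‖ ≤ 1 →
      Integrable (fun t : ℝ => t * x / (1 + t * x : ℂ)) σ := by
    intro x hx
    refine integrable_of_continuousOn_Icc hT hσ (ContinuousOn.div (by fun_prop) (by fun_prop) ?_)
    exact fun t ht => ne_zero_of_half_le (hbd x hx t ht)
  -- The integrands differ by `t (F - w)` over two denominators of modulus at least `1/2`, hence the
  -- constant `4T`.
  have h1 : ‖∫ t : ℝ, t * F / (1 + t * F) ∂σ - ∫ t : ℝ, t * w / (1 + t * w) ∂σ‖ ≤
      4 * T * ‖F - w‖ := by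
    rw [← integral_sub (hint F hF) (hint w hw)]
    have := norm_integral_le_of_norm_le_const (μ := σ) (C := 4 * T * ‖F - w‖)
      (f := fun t : ℝ => (t * F / (1 + t * F) - t * w / (1 + t * w) : ℂ)) ?_
    · simpa using this
    filter_upwards [hσ] with t ht
    have b1 := hbd F hF t ht
    have b2 := hbd w hw t ht
    have n1 := ne_zero_of_half_le b1
    have n2 := ne_zero_of_half_le b2
    have e : (t * F / (1 + t * F) - t * w / (1 + t * w) : ℂ) =
        t * (1 + t * F : ℂ)⁻¹ * (1 + t * w : ℂ)⁻¹ * (F - w) := by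
      field_simp; ring
    rw [e, norm_mul, norm_mul, norm_mul, Complex.norm_real, Real.norm_of_nonneg ht.1]
    have := ht.2
    have hh1 := norm_inv_le_two b1
    have hh2 := norm_inv_le_two b2
    calc _ ≤ T * 2 * 2 * ‖F - w‖ := by gcongr
      _ = _ := by ring
  have h2 : z * (F - w) = (z * F - (-1 + c * ∫ t : ℝ, t * F / (1 + t * F) ∂σ)) +
      c * (∫ t : ℝ, t * F / (1 + t * F) ∂σ - ∫ t : ℝ, t * w / (1 + t * w) ∂σ) := by
    linear_combination -hwe
  have h3 : ‖z‖ * ‖F - w‖ ≤ ε + c * (4 * T * ‖F - w‖) := by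
    rw [← norm_mul, h2]
    refine (norm_add_le _ _).trans ?_
    rw [norm_mul, Complex.norm_real, Real.norm_of_nonneg hc]
    gcongr
  -- As `4 c T ≤ |Im z| / 2`, the nonlinear term absorbs at most half of `‖z‖ ‖F - w‖`; then `1 ≤
  -- |Im z|` gives the factor `2`.
  have h4 := Complex.abs_im_le_norm z
  have h5 := hz.1
  nlinarith [norm_nonneg (F - w)]

end WeightLaw

/-! ### Part (ii): the approximate self-consistent equation and its solution. -/

section SelfConsistent

variable {n m : ℕ} [NeZero n] {T q : ℝ} {τ : Fin m → ℝ} {z : ℂ}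

lemma norm_natCast_sq_inv : ‖((n : ℂ) ^ 2)⁻¹‖ = ((n : ℝ) ^ 2)⁻¹ := by simp

lemma nonneg_of_abs_le {t : ℝ} (h : |t| ≤ T) : 0 ≤ T := (abs_nonneg t).trans h

/-- A rank one change moves the trace by at most `2T`, so `G` and `G^α` are interchangeable in
normalized traces at the precision `n⁻²`. -/
lemma norm_meanRes_sub_erase_le (hz : Far T z) (hτ : ∀ α, |τ α| ≤ T) (S : Finset (Fin m))
    (α : Fin m) :
    ‖meanRes n τ S z - meanRes n τ (S.erase α) z‖ ≤ 2 * T / (n : ℝ) ^ 2 := by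
  have hT := nonneg_of_abs_le (hτ α)
  have hct := fun S => continuous_trace (continuous_resolventOn (n := n) τ S hz.im_ne_zero)
  rw [meanRes, meanRes, meanTr, meanTr, ← mul_sub, ← integral_sub
    (integrable_of_continuous (hct _)) (integrable_of_continuous (hct _)), norm_mul,
    norm_natCast_sq_inv, inv_mul_eq_div]
  gcongr
  refine norm_integral_le_of_forall_le fun ω => ?_
  obtain ⟨c, hc, h⟩ := resolventOn_sub_erase hz hτ S α ω
  rw [← Matrix.trace_sub, h, Matrix.trace_smul, norm_smul]
  have h1 := norm_trace_vecMulVec_sq_le (resVec τ S α z ω) (resVec τ S α z ω)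
  have h2 : ‖(vecMulVec (resVec τ S α z ω) (resVec τ S α z ω)).trace‖ ≤ 1 := by
    refine (sq_le_one_iff₀ (norm_nonneg _)).1 (h1.trans ?_)
    exact mul_le_one₀ (nsq_resVec_le hz S α ω) (nsq_nonneg _) (nsq_resVec_le hz S α ω)
  have h3 : ‖c‖ ≤ 2 * T := by
    refine abs_le_of_sq_le_sq' ?_ (by positivity) |>.2
    nlinarith
  calc _ ≤ 2 * T * 1 := by gcongr
    _ = 2 * T := mul_one _

/-- The resolvent identity, paired with an arbitrary matrix. -/
lemma trace_mul_resolventOn (hz : Far T z) (hτ : ∀ α, |τ α| ≤ T) (S : Finset (Fin m))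
    (ω : Sample n m) (P : Matrix (Fin n × Fin n) (Fin n × Fin n) ℂ) :
    z * (P * resolventOn τ S z ω).trace = -P.trace + ∑ α ∈ S,
      τ α * (denom τ S α z ω)⁻¹ * (resVec τ S α z ω ⬝ᵥ (P *ᵥ tensorVec ω α)) := by
  have h1 : covMat τ S ω * resolventOn τ S z ω - z • resolventOn τ S z ω = 1 := by
    have := Matrix.mul_nonsing_inv _ (isUnit_det_covMat_sub τ S hz.im_ne_zero ω)
    rw [Matrix.sub_mul, Matrix.smul_mul, Matrix.one_mul] at this
    exact this
  have h2 : z * (P * resolventOn τ S z ω).trace =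
      -P.trace + (P * (covMat τ S ω * resolventOn τ S z ω)).trace := by
    have h3 : covMat τ S ω * resolventOn τ S z ω = 1 + z • resolventOn τ S z ω := by
      rw [← h1]; abel
    rw [h3, Matrix.mul_add, Matrix.trace_add, Matrix.mul_one, Matrix.mul_smul, Matrix.trace_smul]
    simp
  rw [h2, covMat, Matrix.sum_mul, Matrix.mul_sum, Matrix.trace_sum]
  congr 1
  refine Finset.sum_congr rfl fun α hα => ?_
  have h4 : tensorVec ω α ᵥ* resolventOn τ S z ω =
      (denom τ S α z ω)⁻¹ • resVec τ S α z ω := by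
    rw [← Matrix.mulVec_transpose, transpose_resolventOn, (resolventOn_mulVec hz hτ hα ω).1]
  rw [Matrix.smul_mul, Matrix.mul_smul, Matrix.trace_smul, Matrix.vecMulVec_mul, h4,
    Matrix.mul_vecMulVec, Matrix.trace_vecMulVec, dotProduct_smul, dotProduct_comm]
  simp only [smul_eq_mul]
  ring

/-- The resolvent identity paired with the identity matrix, together with `τ_α (G^α Y_α, Y_α) = A_α
- 1`. -/
lemma trace_resolventOn_eq (hz : Far T z) (hτ : ∀ α, |τ α| ≤ T) (S : Finset (Fin m))
    (ω : Sample n m) : z * (resolventOn τ S z ω).trace = -(n : ℂ) ^ 2 +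
      ∑ α ∈ S, (1 - (denom τ S α z ω)⁻¹) := by
  have h := trace_mul_resolventOn hz hτ S ω 1
  rw [Matrix.one_mul] at h
  rw [h, Matrix.trace_one]
  congr 1
  · simp [pow_two]
  · refine Finset.sum_congr rfl fun α _ => ?_
    have hd := denom_ne_zero hz hτ S α ω
    have h2 : (τ α : ℂ) * (resVec τ S α z ω ⬝ᵥ tensorVec ω α) = denom τ S α z ω - 1 := by
      rw [denom, resVec]; ring
    rw [Matrix.one_mulVec, mul_right_comm, h2]
    field_simp

lemma integral_denom (hz : Far T z) (S : Finset (Fin m)) (α : Fin m) :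
    ∫ ω, denom τ S α z ω ∂(law n m) = 1 + τ α * meanRes n τ (S.erase α) z := by
  have hc := continuous_resolventOn (n := n) τ (S.erase α) hz.im_ne_zero
  have h := integral_quadForm_resample (α := α) hc
    (fun ω x => resolventOn_erase_update τ S z α ω x)
  have e : ∀ ω : Sample n m, denom τ S α z ω = 1 + τ α * (tensorVec ω α ⬝ᵥ
      (resolventOn τ (S.erase α) z ω *ᵥ tensorVec ω α)) := fun ω => by
    rw [denom, dotProduct_comm]
  simp_rw [e]
  have c1 := continuous_quadForm hc (continuous_tensorVec α) (continuous_tensorVec α)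
  rw [integral_add (integrable_const _) (integrable_of_continuous (by fun_prop)),
    integral_const_mul, h]
  simp [meanRes]

lemma continuous_denom_inv (hz : Far T z) (hτ : ∀ α, |τ α| ≤ T) (S : Finset (Fin m))
    (α : Fin m) : Continuous fun ω : Sample n m => (denom τ S α z ω)⁻¹ :=
  (continuous_denom S α hz.im_ne_zero).inv₀ fun ω => denom_ne_zero hz hτ S α ω

lemma norm_inv_sub_inv_le {a b : ℂ} (ha : 1 / 2 ≤ ‖a‖) (hb : 1 / 2 ≤ ‖b‖) :
    ‖a⁻¹ - b⁻¹‖ ≤ 4 * ‖a - b‖ := by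
  have ha0 := ne_zero_of_half_le ha
  have hb0 := ne_zero_of_half_le hb
  have h1 := norm_inv_le_two ha
  have h2 := norm_inv_le_two hb
  have e : a⁻¹ - b⁻¹ = a⁻¹ * b⁻¹ * (b - a) := by field_simp
  rw [e, norm_mul, norm_mul, norm_sub_rev b a]
  calc _ ≤ 2 * 2 * ‖a - b‖ := by gcongr
    _ = _ := by ring

/-- The expectation of `1 / A_α` up to the variance of `A_α`. -/
lemma norm_integral_denom_inv_sub_le (hz : Far T z) (hτ : ∀ α, |τ α| ≤ T)
    (hm : (m : ℝ) ≤ q * (n : ℝ) ^ 2) (S : Finset (Fin m)) (α : Fin m) :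
    ‖∫ ω, (denom τ S α z ω)⁻¹ ∂(law n m) - (1 + τ α * meanRes n τ S z)⁻¹‖ ≤
      (8 * T ^ 2 * flucConst T q + 8 * T ^ 2) / (n : ℝ) ^ 2 := by
  have hn : (0 : ℝ) < n := natCast_pos_of_neZero
  have hT := nonneg_of_abs_le (hτ α)
  set a : ℂ := 1 + τ α * meanRes n τ (S.erase α) z with ha
  have hcd := continuous_denom (n := n) (τ := τ) S α hz.im_ne_zero
  have hci := continuous_denom_inv (n := n) hz hτ S α
  have hah := half_le_norm_one_add_meanRes (n := n) (τ := τ) hz (hτ α) (S.erase α)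
  have ha0 : a ≠ 0 := ne_zero_of_half_le hah
  have h1 : ‖∫ ω, (denom τ S α z ω)⁻¹ ∂(law n m) - a⁻¹‖ ≤
      8 * (T ^ 2 * flucConst T q / (n : ℝ) ^ 2) := by
    -- Because `a` is exactly the mean of `A_α`, the linear Taylor term can be added at no cost. The
    -- integrand becomes quadratic in `A_α - a`, which improves `O(n⁻¹)` to `O(n⁻²)`.
    have e : ∫ ω, (denom τ S α z ω)⁻¹ ∂(law n m) - a⁻¹ =
        ∫ ω, ((denom τ S α z ω)⁻¹ - a⁻¹ + a⁻¹ ^ 2 * (denom τ S α z ω - a)) ∂(law n m) := by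
      rw [integral_add (integrable_of_continuous (by fun_prop))
        (integrable_of_continuous (by fun_prop)), integral_const_mul,
        integral_sub (integrable_of_continuous hcd) (integrable_const _), integral_denom hz,
        integral_sub (integrable_of_continuous hci) (integrable_const _)]
      simp [ha]
    rw [e]
    refine le_trans ?_ (mul_le_mul_of_nonneg_left
      (integral_norm_denom_sub_sq_le hz hτ hm S α) (by norm_num))
    rw [← integral_const_mul]
    refine norm_integral_le_of_norm_le (integrable_of_continuous (by fun_prop))
      (Eventually.of_forall fun ω => ?_)
    have hd := half_le_norm_denom hz hτ S α ω
    have hd0 := ne_zero_of_half_le hd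
    have e2 : (denom τ S α z ω)⁻¹ - a⁻¹ + a⁻¹ ^ 2 * (denom τ S α z ω - a) =
        (denom τ S α z ω)⁻¹ * a⁻¹ * a⁻¹ * (denom τ S α z ω - a) ^ 2 := by
      field_simp; ring
    rw [e2, norm_mul, norm_mul, norm_mul, norm_pow]
    have := norm_inv_le_two hd
    have := norm_inv_le_two hah
    calc _ ≤ 2 * 2 * 2 * ‖denom τ S α z ω - a‖ ^ 2 := by gcongr
      _ = _ := by ring
  have h2 : ‖a⁻¹ - (1 + τ α * meanRes n τ S z)⁻¹‖ ≤ 4 * (T * (2 * T / (n : ℝ) ^ 2)) := by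
    refine (norm_inv_sub_inv_le hah (half_le_norm_one_add_meanRes hz (hτ α) S)).trans ?_
    gcongr
    have e3 : a - (1 + τ α * meanRes n τ S z) =
      τ α * (meanRes n τ (S.erase α) z - meanRes n τ S z) := by rw [ha]; ring
    rw [e3, norm_mul, Complex.norm_real, Real.norm_eq_abs, norm_sub_rev]
    exact mul_le_mul (hτ α) (norm_meanRes_sub_erase_le hz hτ S α) (norm_nonneg _) hT
  have h3 := norm_sub_le_norm_sub_add_norm_sub (∫ ω, (denom τ S α z ω)⁻¹ ∂(law n m)) a⁻¹
    (1 + τ α * meanRes n τ S z)⁻¹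
  refine h3.trans ((add_le_add h1 h2).trans (le_of_eq ?_))
  ring

/-- The approximate self-consistent equation for the normalized expected trace. -/
lemma norm_meanRes_equation_le (hz : Far T z) (hτ : ∀ α, |τ α| ≤ T)
    (hm : (m : ℝ) ≤ q * (n : ℝ) ^ 2) :
    ‖z * meanRes n τ Finset.univ z - (-1 + ((n : ℂ) ^ 2)⁻¹ * ∑ α, τ α * meanRes n τ Finset.univ z /
      (1 + τ α * meanRes n τ Finset.univ z))‖ ≤
      q * (8 * T ^ 2 * flucConst T q + 8 * T ^ 2) / (n : ℝ) ^ 2 := by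
  have hn : (0 : ℝ) < n := natCast_pos_of_neZero
  have hnC : (n : ℂ) ≠ 0 := NeZero.ne _
  set F := meanRes n τ Finset.univ z with hF
  have hct := continuous_trace (continuous_resolventOn (n := n) τ Finset.univ hz.im_ne_zero)
  have h1 : z * F = -1 + ((n : ℂ) ^ 2)⁻¹ *
      ∑ α, (1 - ∫ ω, (denom τ Finset.univ α z ω)⁻¹ ∂(law n m)) := by
    have hci := fun α => continuous_denom_inv (n := n) hz hτ Finset.univ α
    rw [hF, meanRes, meanTr, mul_left_comm, ← integral_const_mul]
    simp_rw [trace_resolventOn_eq hz hτ]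
    rw [integral_add (integrable_const _) (integrable_of_continuous (by fun_prop)),
      integral_finsetSum _ fun α _ => integrable_of_continuous (by fun_prop), mul_add]
    congr 1
    · simp [hnC]
    · congr 1
      refine Finset.sum_congr rfl fun α _ => ?_
      rw [integral_sub (integrable_const _) (integrable_of_continuous (hci α))]
      simp
  have h2 : z * F - (-1 + ((n : ℂ) ^ 2)⁻¹ * ∑ α, τ α * F / (1 + τ α * F)) = ((n : ℂ) ^ 2)⁻¹ *
      ∑ α, -(∫ ω, (denom τ Finset.univ α z ω)⁻¹ ∂(law n m) - (1 + τ α * F)⁻¹) := by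
    rw [h1, add_sub_add_left_eq_sub, ← mul_sub, ← Finset.sum_sub_distrib]
    congr 1
    refine Finset.sum_congr rfl fun α _ => ?_
    have h0 := ne_zero_of_half_le (half_le_norm_one_add_meanRes (n := n) (τ := τ) hz (hτ α)
      Finset.univ)
    have : (τ α : ℂ) * F / (1 + τ α * F) = 1 - (1 + τ α * F)⁻¹ := by
      rw [← hF] at h0
      field_simp; ring
    rw [this]; ring
  rw [h2, norm_mul, norm_natCast_sq_inv]
  have h3 : ∀ α, ‖-(∫ ω, (denom τ Finset.univ α z ω)⁻¹ ∂(law n m) - (1 + τ α * F)⁻¹)‖ ≤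
      (8 * T ^ 2 * flucConst T q + 8 * T ^ 2) / (n : ℝ) ^ 2 := fun α => by
    rw [norm_neg]; exact norm_integral_denom_inv_sub_le hz hτ hm Finset.univ α
  have h4 := (norm_sum_le Finset.univ _).trans (Finset.sum_le_sum fun α _ => h3 α)
  rw [Finset.sum_const, Finset.card_univ, Fintype.card_fin, nsmul_eq_mul] at h4
  have hQ := sixteen_le_flucConst (T := T) hm
  calc _ ≤ ((n : ℝ) ^ 2)⁻¹ *
        ((m : ℝ) * ((8 * T ^ 2 * flucConst T q + 8 * T ^ 2) / (n : ℝ) ^ 2)) := by gcongr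
    _ ≤ ((n : ℝ) ^ 2)⁻¹ * ((q * (n : ℝ) ^ 2) *
        ((8 * T ^ 2 * flucConst T q + 8 * T ^ 2) / (n : ℝ) ^ 2)) := by gcongr
    _ = _ := by field_simp

lemma expect_g : expect (n := n) (g τ z) = meanRes n τ Finset.univ z := by
  simp only [expect, g, meanRes, meanTr, gam, G]
  rw [integral_const_mul]

/-- The data attached to one value of the dimension: the weights are in `[0, T]`, their number is
close to `c n²` and their law is close to `σ`. -/
structure WeightData (n : ℕ) (m : ℕ) (τ : Fin m → ℝ) (σ : Measure ℝ) (T c C K : ℝ) : Prop where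
  hT : 0 ≤ T
  hc : 0 ≤ c
  supp : ∀ᵐ t ∂σ, t ∈ Set.Icc 0 T
  mem : ∀ α, τ α ∈ Set.Icc 0 T
  rate : ∀ φ : ℝ →ᵇ ℝ, |(∫ t, φ t ∂(countingMeasure τ)) - ∫ t, φ t ∂σ| ≤ C / (n : ℝ) ^ 2 * ‖φ‖
  card : |(m : ℝ) - c * (n : ℝ) ^ 2| ≤ K

variable {σ : Measure ℝ} [IsProbabilityMeasure σ] {c C K : ℝ}

lemma WeightData.abs_le (h : WeightData n m τ σ T c C K) (α : Fin m) : |τ α| ≤ T := by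
  rw [abs_of_nonneg (h.mem α).1]; exact (h.mem α).2

lemma WeightData.norm_sum_sub_le (hd : WeightData n m τ σ T c C K) {h : ℝ → ℂ}
    (hh : ContinuousOn h (Set.Icc 0 T)) {b : ℝ} (hb : ∀ t ∈ Set.Icc 0 T, ‖h t‖ ≤ b) :
    ‖((n : ℂ) ^ 2)⁻¹ * ∑ α, h (τ α) - c * ∫ t, h t ∂σ‖ ≤ (K + 2 * c * C) * b / (n : ℝ) ^ 2 :=
  norm_sum_weights_sub_integral_le (Nat.one_le_iff_ne_zero.2 (NeZero.ne n)) hd.hT hd.hc hd.supp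
    hd.mem hd.rate hd.card hh hb

lemma half_le_of_mem_Icc (hz : Far T z) {x : ℂ} (hx : |z.im| * ‖x‖ ≤ 1) {t : ℝ}
    (ht : t ∈ Set.Icc 0 T) : 1 / 2 ≤ ‖(1 + t * x : ℂ)‖ :=
  half_le_norm_one_add (norm_mul_le_half hz (by rw [abs_of_nonneg ht.1]; exact ht.2) hx)

lemma norm_le_one_of_im_mul (hz : Far T z) {x : ℂ} (hx : |z.im| * ‖x‖ ≤ 1) : ‖x‖ ≤ 1 := by
  nlinarith [hz.1, norm_nonneg x]

/-- The convergence rate of the normalized expected trace. -/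
lemma norm_meanRes_sub_limit_le (hd : WeightData n m τ σ T c C K) (hz : Far T z)
    (hzc : 8 * c * T ≤ |z.im|) (hm : (m : ℝ) ≤ q * (n : ℝ) ^ 2) {w : ℂ}
    (hw : |z.im| * ‖w‖ ≤ 1) (hwe : z * w = -1 + c * ∫ t : ℝ, t * w / (1 + t * w) ∂σ) :
    ‖meanRes n τ Finset.univ z - w‖ ≤ 2 * (q * (8 * T ^ 2 * flucConst T q + 8 * T ^ 2) +
      (K + 2 * c * C) * (2 * T)) / (n : ℝ) ^ 2 := by
  set F := meanRes n τ Finset.univ z with hF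
  have hFz : |z.im| * ‖F‖ ≤ 1 := im_mul_norm_meanRes_le hz.im_ne_zero Finset.univ
  have h1 := norm_meanRes_equation_le (n := n) hz hd.abs_le hm
  have h2 := hd.norm_sum_sub_le (h := fun t : ℝ => t * F / (1 + t * F)) (b := 2 * T)
    (ContinuousOn.div (by fun_prop) (by fun_prop)
      fun t ht => ne_zero_of_half_le (half_le_of_mem_Icc hz hFz ht))
    (fun t ht => norm_frac_le ht.1 ht.2 (half_le_of_mem_Icc hz hFz ht)
      (norm_le_one_of_im_mul hz hFz))
  refine (norm_sub_le_of_approx_equation hd.hc hd.hT hd.supp hz hzc hw hFz hwe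
    (ε := (q * (8 * T ^ 2 * flucConst T q + 8 * T ^ 2) +
      (K + 2 * c * C) * (2 * T)) / (n : ℝ) ^ 2) ?_).trans (le_of_eq (by ring))
  rw [add_div]
  refine le_trans ?_ (add_le_add h1 h2)
  refine le_trans (le_of_eq ?_) (norm_add_le _ _)
  congr 1
  ring

end SelfConsistent

/-! ### The two pairing maps and their values on rank one matrices. -/

section Contractions

variable {n : ℕ} [NeZero n]

/-- A linear map on the matrices of the tensor product, such as the partial trace and the partial
transposition, that pairs two resolvents in the quantities `g⁽¹⁾` and `g⁽²⁾`. The number `r ^ 2`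
is the size of the image of a matrix of rank one. -/
structure PairingMap (n : ℕ) (r : ℝ)
    (L : Matrix (Fin n × Fin n) (Fin n × Fin n) ℂ →ₗ[ℂ] Matrix (Fin n × Fin n) (Fin n × Fin n) ℂ) :
    Prop where
  map_one : L 1 = 1
  hs_le : ∀ H, hs (L H) ≤ hs H
  hs_rankOne : ∀ u, hs (L (vecMulVec u u)) ≤ r ^ 2 * (nsq u * nsq u)
  trace_adj : ∀ H K, (L H * K).trace = (H * L K).trace
  -- The vectors stand for `G^α(z₁) Y` and `G^α(z₂) Y`, the numbers for normalized traces. If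
  -- contracting `uᵢ` with one factor of `Y` almost gives `aᵢ` times the other factor, the rank one
  -- form is almost `r² a₁ a₂²`.
  form : ∀ (p : Sph n × Sph n) (u₁ u₂ : Fin n × Fin n → ℂ) (a₁ a₂ : ℂ), nsq u₁ ≤ 1 → nsq u₂ ≤ 1 →
    ‖a₁‖ ≤ 1 → ‖a₂‖ ≤ 1 →
    ‖u₁ ⬝ᵥ (L (vecMulVec u₂ u₂) *ᵥ tens p) - r ^ 2 * (a₁ * a₂ ^ 2)‖ ≤
      r ^ 2 * (√(nsq (contrSnd u₁ (vec p.2) - a₁ • vec p.1)) +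
        √(nsq (contrSnd u₂ (vec p.2) - a₂ • vec p.1)) +
        √(nsq (contrFst u₂ (vec p.1) - a₂ • vec p.2)) +
        ‖u₁ ⬝ᵥ tens p - a₁‖ + ‖u₂ ⬝ᵥ tens p - a₂‖)

lemma nsq_contrSnd_le (u : Fin n × Fin n → ℂ) (v : Fin n → ℂ) :
    nsq (contrSnd u v) ≤ nsq u * nsq v := by
  have h := nsq_mulVec_le (Matrix.of fun j s => u (j, s)) v
  have e : hs (Matrix.of fun j s => u (j, s)) = nsq u := by
    simp [hs, nsq, Fintype.sum_prod_type]
  rwa [e] at h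

lemma nsq_contrFst_le (u : Fin n × Fin n → ℂ) (v : Fin n → ℂ) :
    nsq (contrFst u v) ≤ nsq u * nsq v := by
  have h := nsq_contrSnd_le (u ∘ Prod.swap) v
  rwa [nsq_swap] at h

lemma norm_dotProduct_le_sqrt (u v : Fin n → ℂ) (hv : nsq v ≤ 1) : ‖u ⬝ᵥ v‖ ≤ √(nsq u) := by
  refine Real.le_sqrt_of_sq_le ((norm_dotProduct_sq_le u v).trans ?_)
  exact mul_le_of_le_one_right (nsq_nonneg u) hv

lemma contrSnd_sub (u : Fin n × Fin n → ℂ) (v w : Fin n → ℂ) :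
    contrSnd u (v - w) = contrSnd u v - contrSnd u w := by
  ext j; simp [contrSnd, mul_sub]

lemma contrSnd_smul (u : Fin n × Fin n → ℂ) (c : ℂ) (v : Fin n → ℂ) :
    contrSnd u (c • v) = c • contrSnd u v := by
  ext j; simp [contrSnd, Finset.mul_sum, mul_left_comm]

lemma vec_dotProduct_contrSnd (u : Fin n × Fin n → ℂ) (p : Sph n × Sph n) :
    vec p.1 ⬝ᵥ contrSnd u (vec p.2) = u ⬝ᵥ tens p := by
  simp only [dotProduct, contrSnd, tens, Fintype.sum_prod_type, Finset.mul_sum]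
  exact Finset.sum_congr rfl fun _ _ => Finset.sum_congr rfl fun _ _ => by ring

/-- Stability of a trilinear form in the directions of the two factors. -/
lemma norm_trilinear_sub_le (p : Sph n × Sph n) {u : Fin n × Fin n → ℂ} {v w : Fin n → ℂ}
    {a b c : ℂ} (hu : nsq u ≤ 1) (hw : nsq w ≤ 1) (hb : ‖b‖ ≤ 1) (hc : ‖c‖ ≤ 1) :
    ‖v ⬝ᵥ contrSnd u w - b * c * a‖ ≤ √(nsq (v - b • vec p.1)) + √(nsq (w - c • vec p.2)) +
      ‖u ⬝ᵥ tens p - a‖ := by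
  -- The three arguments are replaced one at a time: `v` by `b y¹`, then `w` by `c y²`, and finally
  -- the form of `u` by `a`.
  have e : v ⬝ᵥ contrSnd u w - b * c * a = (v - b • vec p.1) ⬝ᵥ contrSnd u w +
      b * (contrSnd u (w - c • vec p.2) ⬝ᵥ vec p.1) + b * c * (u ⬝ᵥ tens p - a) := by
    rw [contrSnd_sub, contrSnd_smul, sub_dotProduct, sub_dotProduct, smul_dotProduct,
      smul_dotProduct, dotProduct_comm (contrSnd u w), dotProduct_comm (contrSnd u (vec p.2)),
      vec_dotProduct_contrSnd]
    simp only [smul_eq_mul]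
    ring
  have h1 : ‖(v - b • vec p.1) ⬝ᵥ contrSnd u w‖ ≤ √(nsq (v - b • vec p.1)) :=
    norm_dotProduct_le_sqrt _ _ ((nsq_contrSnd_le u w).trans (mul_le_one₀ hu (nsq_nonneg w) hw))
  have h2 : ‖contrSnd u (w - c • vec p.2) ⬝ᵥ vec p.1‖ ≤ √(nsq (w - c • vec p.2)) := by
    refine (norm_dotProduct_le_sqrt _ _ (nsq_vec _).le).trans (Real.sqrt_le_sqrt ?_)
    exact (nsq_contrSnd_le _ _).trans (mul_le_of_le_one_left (nsq_nonneg _) hu)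
  rw [e]
  refine (norm_add₃_le).trans ?_
  rw [norm_mul, norm_mul, norm_mul]
  have h3 := norm_nonneg (u ⬝ᵥ tens p - a)
  have h4 := norm_nonneg (contrSnd u (w - c • vec p.2) ⬝ᵥ vec p.1)
  have h5 : ‖b‖ * ‖c‖ ≤ 1 := mul_le_one₀ hb (norm_nonneg _) hc
  have h6 : ‖b‖ * ‖contrSnd u (w - c • vec p.2) ⬝ᵥ vec p.1‖ ≤
      1 * √(nsq (w - c • vec p.2)) := mul_le_mul hb h2 h4 zero_le_one
  have h7 : ‖b‖ * ‖c‖ * ‖u ⬝ᵥ tens p - a‖ ≤ 1 * ‖u ⬝ᵥ tens p - a‖ := by gcongr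
  linarith

/-- The normalized partial trace, followed by the tensor product with the identity. -/
def reduceMap (n : ℕ) :
    Matrix (Fin n × Fin n) (Fin n × Fin n) ℂ →ₗ[ℂ] Matrix (Fin n × Fin n) (Fin n × Fin n) ℂ where
  toFun H := Matrix.of fun x y => (n : ℂ)⁻¹ * if x.2 = y.2 then ptrR H x.1 y.1 else 0
  map_add' H K := by
    ext x y
    simp only [ptrR_add, Matrix.of_apply, Matrix.add_apply]
    split_ifs <;> ring
  map_smul' c H := by
    ext x y
    simp only [ptrR_smul, Matrix.of_apply, Matrix.smul_apply, smul_eq_mul, RingHom.id_apply]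
    split_ifs <;> ring

lemma reduceMap_apply (H : Matrix (Fin n × Fin n) (Fin n × Fin n) ℂ) (x y : Fin n × Fin n) :
    reduceMap n H x y = (n : ℂ)⁻¹ * if x.2 = y.2 then ptrR H x.1 y.1 else 0 := rfl

lemma hs_reduceMap (H : Matrix (Fin n × Fin n) (Fin n × Fin n) ℂ) :
    hs (reduceMap n H) = (n : ℝ)⁻¹ * hs (ptrR H) := by
  have hn : (n : ℝ) ≠ 0 := NeZero.ne _
  simp only [hs, reduceMap_apply, Fintype.sum_prod_type, norm_mul, mul_pow, apply_ite norm, ite_pow,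
    norm_zero, norm_inv, Complex.norm_natCast]
  simp [Finset.mul_sum]
  refine Finset.sum_congr rfl fun _ _ => Finset.sum_congr rfl fun _ _ => ?_
  field_simp

lemma trace_reduceMap_mul (H K : Matrix (Fin n × Fin n) (Fin n × Fin n) ℂ) :
    (reduceMap n H * K).trace = (n : ℂ)⁻¹ * (ptrR H * ptrR K).trace := by
  simp only [Matrix.trace, Matrix.diag, Matrix.mul_apply, reduceMap_apply, Fintype.sum_prod_type,
    mul_assoc, ← Finset.mul_sum]
  congr 1
  refine Finset.sum_congr rfl fun j _ => ?_
  rw [Finset.sum_comm]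
  refine Finset.sum_congr rfl fun p _ => ?_
  simp [ptrR, Finset.mul_sum]

lemma reduceMap_form (p : Sph n × Sph n) (u₁ u₂ : Fin n × Fin n → ℂ) :
    u₁ ⬝ᵥ (reduceMap n (vecMulVec u₂ u₂) *ᵥ tens p) =
      (n : ℂ)⁻¹ * (contrSnd u₁ (vec p.2) ⬝ᵥ contrSnd u₂ (contrFst u₂ (vec p.1))) := by
  simp only [dotProduct, Matrix.mulVec, reduceMap_apply, Fintype.sum_prod_type, contrSnd, contrFst,
    tens, ptrR, vecMulVec_apply]
  simp only [Finset.mul_sum, Finset.sum_mul, mul_ite, ite_mul, mul_zero, zero_mul,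
    Finset.sum_ite_eq, Finset.mem_univ, if_true]
  refine Finset.sum_congr rfl fun j _ => ?_
  conv_rhs => rw [Finset.sum_congr rfl fun _ _ => Finset.sum_comm, Finset.sum_comm]
  refine Finset.sum_congr rfl fun s _ => ?_
  conv_rhs => rw [Finset.sum_comm]
  refine Finset.sum_congr rfl fun k _ => Finset.sum_congr rfl fun q _ => by ring

/-- The partial trace of a rank one matrix keeps bounded Hilbert–Schmidt norm, and spreading it over
`n` diagonal blocks with weight `n⁻¹` divides its square by `n`. Hence `r² = 1/n`, the origin of the
factor `1/n` in (iii). -/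
lemma pairingMap_reduceMap : PairingMap n (√(n : ℝ))⁻¹ (reduceMap n) := by
  have hn : (0 : ℝ) < n := natCast_pos_of_neZero
  have hr : ((√(n : ℝ))⁻¹) ^ 2 = (n : ℝ)⁻¹ := by rw [inv_pow, Real.sq_sqrt hn.le]
  refine ⟨?_, ?_, ?_, ?_, ?_⟩
  · ext x y
    rw [reduceMap_apply, Matrix.one_apply]
    have hnC : (n : ℂ) ≠ 0 := NeZero.ne _
    simp only [ptrR, Matrix.one_apply, Prod.ext_iff]
    by_cases h1 : x.2 = y.2 <;> by_cases h2 : x.1 = y.1 <;> simp [h1, h2, hnC]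
  · intro H
    rw [hs_reduceMap, inv_mul_le_iff₀ hn]
    simpa using hs_ptrR_le H
  · intro u
    rw [hs_reduceMap, hr]
    gcongr
    exact hs_ptrR_vecMulVec_le u u
  · intro H K
    rw [trace_reduceMap_mul, Matrix.trace_mul_comm H, trace_reduceMap_mul, Matrix.trace_mul_comm]
  · intro p u₁ u₂ a₁ a₂ h₁ h₂ ha₁ ha₂
    have hrC : (((√(n : ℝ))⁻¹ : ℝ) : ℂ) ^ 2 = (n : ℂ)⁻¹ := by
      rw [← Complex.ofReal_pow, hr]; simp
    rw [reduceMap_form, hrC, ← mul_sub, norm_mul, hr, norm_inv, Complex.norm_natCast]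
    gcongr
    have h := norm_trilinear_sub_le p (v := contrSnd u₁ (vec p.2)) (w := contrFst u₂ (vec p.1))
      (a := a₂) h₂ ((nsq_contrFst_le _ _).trans (by rw [nsq_vec, mul_one]; exact h₂)) ha₁ ha₂
    have e : a₁ * a₂ ^ 2 = a₁ * a₂ * a₂ := by ring
    rw [e]
    have := Real.sqrt_nonneg (nsq (contrSnd u₂ (vec p.2) - a₂ • vec p.1))
    have := norm_nonneg (u₁ ⬝ᵥ tens p - a₁)
    linarith

/-- The partial transposition. -/
def transposeMap (n : ℕ) :
    Matrix (Fin n × Fin n) (Fin n × Fin n) ℂ →ₗ[ℂ] Matrix (Fin n × Fin n) (Fin n × Fin n) ℂ where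
  toFun H := Matrix.of fun x y => H (y.1, x.2) (x.1, y.2)
  map_add' _ _ := rfl
  map_smul' _ _ := rfl

lemma transposeMap_apply (H : Matrix (Fin n × Fin n) (Fin n × Fin n) ℂ) (x y : Fin n × Fin n) :
    transposeMap n H x y = H (y.1, x.2) (x.1, y.2) := rfl

lemma hs_transposeMap (H : Matrix (Fin n × Fin n) (Fin n × Fin n) ℂ) :
    hs (transposeMap n H) = hs H := by
  simp only [hs, transposeMap_apply, Fintype.sum_prod_type]
  rw [Finset.sum_congr rfl fun _ _ => Finset.sum_comm, Finset.sum_comm]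
  exact Finset.sum_congr rfl fun _ _ => Finset.sum_comm

lemma trace_transposeMap_mul (H K : Matrix (Fin n × Fin n) (Fin n × Fin n) ℂ) :
    (transposeMap n H * K).trace = (H * transposeMap n K).trace := by
  simp only [Matrix.trace, Matrix.diag, Matrix.mul_apply, transposeMap_apply,
    Fintype.sum_prod_type]
  rw [Finset.sum_congr rfl fun _ _ => Finset.sum_comm, Finset.sum_comm]
  exact Finset.sum_congr rfl fun _ _ => Finset.sum_comm

lemma transposeMap_form (p : Sph n × Sph n) (u₁ u₂ : Fin n × Fin n → ℂ) :
    u₁ ⬝ᵥ (transposeMap n (vecMulVec u₂ u₂) *ᵥ tens p) =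
      contrSnd u₂ (vec p.2) ⬝ᵥ contrSnd u₁ (contrFst u₂ (vec p.1)) := by
  simp only [dotProduct, Matrix.mulVec, transposeMap_apply, Fintype.sum_prod_type, contrSnd,
    contrFst, tens, vecMulVec_apply]
  simp only [Finset.mul_sum, Finset.sum_mul]
  refine Finset.sum_congr rfl fun j _ => ?_
  refine Finset.sum_congr rfl fun s _ => ?_
  exact Finset.sum_congr rfl fun k _ => Finset.sum_congr rfl fun q _ => by ring

/-- Partial transposition permutes the entries, so it is an isometry and nothing is gained on rank
one matrices. In the trilinear form `u₂` now provides both outer vectors and `u₁` the middle one. -/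
lemma pairingMap_transposeMap : PairingMap n 1 (transposeMap n) := by
  refine ⟨?_, ?_, ?_, ?_, ?_⟩
  · ext x y
    rw [transposeMap_apply, Matrix.one_apply, Matrix.one_apply]
    simp only [Prod.ext_iff]
    by_cases h1 : x.2 = y.2 <;> by_cases h2 : x.1 = y.1 <;> simp [h1, h2, eq_comm]
  · intro H; rw [hs_transposeMap]
  · intro u; rw [hs_transposeMap, hs_vecMulVec]; simp
  · exact trace_transposeMap_mul
  · intro p u₁ u₂ a₁ a₂ h₁ h₂ ha₁ ha₂
    have h := norm_trilinear_sub_le p (v := contrSnd u₂ (vec p.2)) (w := contrFst u₂ (vec p.1))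
      (a := a₁) h₁ ((nsq_contrFst_le _ _).trans (by rw [nsq_vec, mul_one]; exact h₂)) ha₂ ha₂
    have e : a₁ * a₂ ^ 2 = a₂ * a₂ * a₁ := by ring
    rw [transposeMap_form]
    simp only [Complex.ofReal_one, one_pow, one_mul]
    rw [e]
    have := Real.sqrt_nonneg (nsq (contrSnd u₁ (vec p.2) - a₁ • vec p.1))
    have := norm_nonneg (u₂ ⬝ᵥ tens p - a₂)
    linarith

end Contractions

/-! ### Fluctuations of the pairings and decoupling of their main term. -/

section Pairings

variable {n m : ℕ} [NeZero n] {T q r : ℝ} {τ : Fin m → ℝ} {z₁ z₂ : ℂ}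
  {L : Matrix (Fin n × Fin n) (Fin n × Fin n) ℂ →ₗ[ℂ] Matrix (Fin n × Fin n) (Fin n × Fin n) ℂ}

/-- The product of a resolvent and of the image of another one under a linear map. -/
def pairMat (L : Matrix (Fin n × Fin n) (Fin n × Fin n) ℂ →ₗ[ℂ]
    Matrix (Fin n × Fin n) (Fin n × Fin n) ℂ) (τ : Fin m → ℝ) (S : Finset (Fin m)) (z₁ z₂ : ℂ)
    (ω : Sample n m) : Matrix (Fin n × Fin n) (Fin n × Fin n) ℂ :=
  resolventOn τ S z₁ ω * L (resolventOn τ S z₂ ω)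

lemma continuous_map_matrix (L : Matrix (Fin n × Fin n) (Fin n × Fin n) ℂ →ₗ[ℂ]
    Matrix (Fin n × Fin n) (Fin n × Fin n) ℂ) : Continuous L :=
  L.continuous_of_finiteDimensional

lemma continuous_pairMat (hz₁ : Far T z₁) (hz₂ : Far T z₂) (S : Finset (Fin m)) :
    Continuous fun ω : Sample n m => pairMat L τ S z₁ z₂ ω :=
  (continuous_resolventOn τ S hz₁.im_ne_zero).matrix_mul
    ((continuous_map_matrix L).comp (continuous_resolventOn τ S hz₂.im_ne_zero))

lemma pairMat_erase_update (S : Finset (Fin m)) (α : Fin m) (ω : Sample n m)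
    (x : Sph n × Sph n) : pairMat L τ (S.erase α) z₁ z₂ (Function.update ω α x) =
      pairMat L τ (S.erase α) z₁ z₂ ω := by
  rw [pairMat, resolventOn_erase_update, resolventOn_erase_update, pairMat]

lemma PairingMap.hs_pairMat_le (hL : PairingMap n r L) (hz₁ : Far T z₁) (hz₂ : Far T z₂)
    (S : Finset (Fin m)) (ω : Sample n m) : hs (pairMat L τ S z₁ z₂ ω) ≤ (n : ℝ) ^ 2 :=
  ((contr_resolventOn τ S hz₁.1 ω).hs_mul_le _).trans
    ((hL.hs_le _).trans (hs_resolventOn_le hz₂ S ω))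

lemma PairingMap.norm_meanTr_pairMat_le (hL : PairingMap n r L) (hz₁ : Far T z₁)
    (hz₂ : Far T z₂) (S : Finset (Fin m)) :
    ‖meanTr (n := n) (pairMat L τ S z₁ z₂)‖ ≤ 1 :=
  norm_meanTr_le zero_le_one fun ω => by simpa using hL.hs_pairMat_le hz₁ hz₂ S ω

lemma PairingMap.hs_map_sub_le (hL : PairingMap n r L) {z : ℂ} (hz : Far T z)
    (hτ : ∀ α, |τ α| ≤ T) (S : Finset (Fin m)) (α : Fin m) (ω : Sample n m) :
    hs (L (resolventOn τ S z ω - resolventOn τ (S.erase α) z ω)) ≤ 4 * T ^ 2 * r ^ 2 := by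
  obtain ⟨c, hc, h⟩ := resolventOn_sub_erase hz hτ S α ω
  rw [h, map_smul, hs_smul]
  have h1 := nsq_resVec_le (τ := τ) hz S α ω
  have h2 : nsq (resVec τ S α z ω) * nsq (resVec τ S α z ω) ≤ 1 := mul_le_one₀ h1 (nsq_nonneg _) h1
  have h3 := hL.hs_rankOne (resVec τ S α z ω)
  have h4 : hs (L (vecMulVec (resVec τ S α z ω) (resVec τ S α z ω))) ≤ r ^ 2 :=
    h3.trans (mul_le_of_le_one_right (sq_nonneg r) h2)
  exact mul_le_mul hc h4 (hs_nonneg _) (by positivity)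

/-- Change one resolvent at a time; the adjointness of `L` puts it on the rank one difference, of
size `r`, while the other factor has Hilbert–Schmidt norm at most `n`. -/
lemma PairingMap.norm_trace_sub_sq_le (hL : PairingMap n r L) (hz₁ : Far T z₁) (hz₂ : Far T z₂)
    (hτ : ∀ α, |τ α| ≤ T) (S : Finset (Fin m)) (α : Fin m) (ω : Sample n m) :
    ‖(pairMat L τ S z₁ z₂ ω).trace - (pairMat L τ (S.erase α) z₁ z₂ ω).trace‖ ^ 2 ≤
      16 * T ^ 2 * r ^ 2 * (n : ℝ) ^ 2 := by
  set R₁ := resolventOn τ S z₁ ω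
  set R₂ := resolventOn τ S z₂ ω with hR₂
  set Q₁ := resolventOn τ (S.erase α) z₁ ω with hQ₁
  set Q₂ := resolventOn τ (S.erase α) z₂ ω
  have e : (pairMat L τ S z₁ z₂ ω).trace - (pairMat L τ (S.erase α) z₁ z₂ ω).trace =
      (L (R₁ - Q₁) * R₂).trace + (Q₁ * L (R₂ - Q₂)).trace := by
    rw [hL.trace_adj, map_sub, Matrix.mul_sub, Matrix.sub_mul, Matrix.trace_sub, Matrix.trace_sub]
    simp only [pairMat]
    ring
  rw [e]
  refine (norm_add_sq_le _ _).trans ?_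
  have h1 : ‖(L (R₁ - Q₁) * R₂).trace‖ ^ 2 ≤ 4 * T ^ 2 * r ^ 2 * (n : ℝ) ^ 2 :=
    (norm_trace_mul_sq_le _ _).trans (mul_le_mul (hL.hs_map_sub_le hz₁ hτ S α ω)
      (hs_resolventOn_le hz₂ S ω) (hs_nonneg _) (by positivity))
  have h2 : ‖(Q₁ * L (R₂ - Q₂)).trace‖ ^ 2 ≤ (n : ℝ) ^ 2 * (4 * T ^ 2 * r ^ 2) :=
    (norm_trace_mul_sq_le _ _).trans (mul_le_mul (hs_resolventOn_le hz₁ _ ω)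
      (hL.hs_map_sub_le hz₂ hτ S α ω) (hs_nonneg _) (by positivity))
  linarith

lemma PairingMap.norm_meanTr_sub_le (hL : PairingMap n r L) (hr : 0 ≤ r) (hz₁ : Far T z₁)
    (hz₂ : Far T z₂) (hτ : ∀ α, |τ α| ≤ T) (S : Finset (Fin m)) (α : Fin m) :
    ‖meanTr (n := n) (pairMat L τ S z₁ z₂) - meanTr (n := n) (pairMat L τ (S.erase α) z₁ z₂)‖ ≤
      4 * T * r / n := by
  have hn : (0 : ℝ) < n := natCast_pos_of_neZero
  have hT := nonneg_of_abs_le (hτ α)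
  have hct := fun S => continuous_trace (continuous_pairMat (L := L) (τ := τ) hz₁ hz₂ S)
  rw [meanTr, meanTr, ← mul_sub, ← integral_sub
    (integrable_of_continuous (hct _)) (integrable_of_continuous (hct _)), norm_mul,
    norm_natCast_sq_inv, inv_mul_le_iff₀ (by positivity)]
  have e : (n : ℝ) ^ 2 * (4 * T * r / n) = 4 * T * r * n := by field_simp
  rw [e]
  refine norm_integral_le_of_forall_le fun ω => ?_
  refine abs_le_of_sq_le_sq' ?_ (by positivity) |>.2
  refine (hL.norm_trace_sub_sq_le hz₁ hz₂ hτ S α ω).trans (le_of_eq (by ring))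

lemma trace_sub_smul_one (H : Matrix (Fin n × Fin n) (Fin n × Fin n) ℂ) (a : ℂ) :
    (H - a • 1).trace = H.trace - (n : ℂ) ^ 2 * a := by
  rw [Matrix.trace_sub, Matrix.trace_smul, Matrix.trace_one]
  simp [pow_two, mul_comm]

/-- The crude bound of partial traces by `n` times the full norm suffices for pairings: it costs
`n³`, which `n⁻¹ ≤ r²` makes smaller than the allowed `r² n⁴`. -/
lemma quadFun_le (H : Matrix (Fin n × Fin n) (Fin n × Fin n) ℂ) :
    quadFun H ≤ ‖H.trace‖ ^ 2 + 8 * n * hs H := by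
  have h1 := hs_ptrR_le H
  have h2 := hs_ptrL_le H
  have hn : (1 : ℝ) ≤ n := by exact_mod_cast Nat.one_le_iff_ne_zero.2 (NeZero.ne n)
  have h3 := hs_nonneg H
  simp only [Fintype.card_fin] at h1 h2
  unfold quadFun
  nlinarith

/-- The constant in the bound of the fluctuations of the pairings. -/
def pairConst (T q : ℝ) : ℝ := 16 * T ^ 2 * q + 32

lemma PairingMap.integral_quadForm_sub_sq_le (hL : PairingMap n r L) (hz₁ : Far T z₁)
    (hz₂ : Far T z₂) (hτ : ∀ α, |τ α| ≤ T) (hm : (m : ℝ) ≤ q * (n : ℝ) ^ 2)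
    (hrn : (n : ℝ)⁻¹ ≤ r ^ 2) (S : Finset (Fin m)) (α : Fin m) :
    ∫ ω, ‖tensorVec ω α ⬝ᵥ (pairMat L τ (S.erase α) z₁ z₂ ω *ᵥ tensorVec ω α) -
      meanTr (n := n) (pairMat L τ (S.erase α) z₁ z₂)‖ ^ 2 ∂(law n m) ≤ pairConst T q * r ^ 2 := by
  have hn : (0 : ℝ) < n := natCast_pos_of_neZero
  have hnC : (n : ℂ) ≠ 0 := NeZero.ne _
  set S' := S.erase α
  set a := meanTr (n := n) (pairMat L τ S' z₁ z₂) with ha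
  have hc := continuous_pairMat (L := L) (τ := τ) hz₁ hz₂ S'
  have hc1 : Continuous fun ω : Sample n m => pairMat L τ S' z₁ z₂ ω -
      a • (1 : Matrix (Fin n × Fin n) (Fin n × Fin n) ℂ) := hc.sub continuous_const
  have hvar : ∫ ω, ‖(pairMat L τ S' z₁ z₂ ω).trace -
      ∫ ω', (pairMat L τ S' z₁ z₂ ω').trace ∂(law n m)‖ ^ 2 ∂(law n m) ≤
      m * (16 * T ^ 2 * r ^ 2 * (n : ℝ) ^ 2) :=
    variance_le_of_bounded_diff (F' := fun β ω => (pairMat L τ (S'.erase β) z₁ z₂ ω).trace)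
      (continuous_trace hc)
      (fun β => continuous_trace (continuous_pairMat hz₁ hz₂ _))
      (fun β ω x => by rw [pairMat_erase_update])
      fun β ω => hL.norm_trace_sub_sq_le hz₁ hz₂ hτ S' β ω
  have ha' : (n : ℂ) ^ 2 * a = ∫ ω', (pairMat L τ S' z₁ z₂ ω').trace ∂(law n m) := by
    rw [ha, meanTr]; field_simp
  have hV : ∫ ω, quadFun (pairMat L τ S' z₁ z₂ ω - a • 1) ∂(law n m) ≤
      pairConst T q * r ^ 2 * (n : ℝ) ^ 4 := by
    have h1 : ∀ ω : Sample n m, quadFun (pairMat L τ S' z₁ z₂ ω - a • 1) ≤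
        ‖(pairMat L τ S' z₁ z₂ ω).trace -
          ∫ ω', (pairMat L τ S' z₁ z₂ ω').trace ∂(law n m)‖ ^ 2 + 32 * (n : ℝ) ^ 3 := by
      intro ω
      refine (quadFun_le _).trans ?_
      rw [trace_sub_smul_one, ha']
      have h2 : hs (pairMat L τ S' z₁ z₂ ω - a • 1) ≤ 4 * (n : ℝ) ^ 2 := by
        refine (hs_sub_le _ _).trans ?_
        rw [hs_smul, hs_one]
        have h3 := hL.hs_pairMat_le (τ := τ) hz₁ hz₂ S' ω
        have h4 : ‖a‖ ^ 2 ≤ 1 :=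
          pow_le_one₀ (norm_nonneg _) (hL.norm_meanTr_pairMat_le hz₁ hz₂ S')
        simp only [Fintype.card_prod, Fintype.card_fin, Nat.cast_mul]
        nlinarith [sq_nonneg (n : ℝ)]
      have h5 : 8 * n * hs (pairMat L τ S' z₁ z₂ ω - a • 1) ≤ 8 * n * (4 * (n : ℝ) ^ 2) := by
        gcongr
      linarith
    have c1 := continuous_trace hc
    refine (integral_mono_of_continuous (continuous_quadFun hc1) (by fun_prop) h1).trans ?_
    rw [integral_add (integrable_of_continuous (by fun_prop)) (integrable_const _)]
    simp only [integral_const, probReal_univ, one_smul]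
    have h6 : (n : ℝ) ^ 3 ≤ r ^ 2 * (n : ℝ) ^ 4 := by
      have : (n : ℝ)⁻¹ * (n : ℝ) ^ 4 ≤ r ^ 2 * (n : ℝ) ^ 4 := by gcongr
      refine le_trans (le_of_eq ?_) this
      field_simp
    have h7 : (m : ℝ) * (16 * T ^ 2 * r ^ 2 * (n : ℝ) ^ 2) ≤
        q * (n : ℝ) ^ 2 * (16 * T ^ 2 * r ^ 2 * (n : ℝ) ^ 2) := by gcongr
    unfold pairConst
    nlinarith
  have h := integral_norm_quadForm_sub_sq_le (α := α) hc
    (fun ω x => pairMat_erase_update S α ω x) a hV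
  have e : pairConst T q * r ^ 2 * (n : ℝ) ^ 4 / (n : ℝ) ^ 4 = pairConst T q * r ^ 2 := by
    field_simp
  rwa [e] at h

lemma quadForm_pairMat (S : Finset (Fin m)) (α : Fin m) (ω : Sample n m) :
    tensorVec ω α ⬝ᵥ (pairMat L τ (S.erase α) z₁ z₂ ω *ᵥ tensorVec ω α) =
      resVec τ S α z₁ ω ⬝ᵥ (L (resolventOn τ (S.erase α) z₂ ω) *ᵥ tensorVec ω α) := by
  rw [pairMat, ← Matrix.mulVec_mulVec, Matrix.dotProduct_mulVec, ← Matrix.mulVec_transpose,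
    transpose_resolventOn, resVec]

/-- The constant in the bound of the first sum of the expansion of the pairing. -/
def covConst (T q : ℝ) : ℝ :=
  4 * (T + 1) * flucConst T q * pairConst T q + (8 * T ^ 2 * flucConst T q + 8 * T ^ 2) + 8 * T

/-- Decoupling of `1 / A_α` and of the quadratic form of the pairing. -/
lemma PairingMap.norm_integral_first_le (hL : PairingMap n r L) (hr : 0 < r) (hr1 : r ≤ 1)
    (hz₁ : Far T z₁) (hz₂ : Far T z₂) (hτ : ∀ α, |τ α| ≤ T) (hm : (m : ℝ) ≤ q * (n : ℝ) ^ 2)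
    (hrn : (n : ℝ)⁻¹ ≤ r ^ 2) (α : Fin m) :
    ‖∫ ω, (denom τ Finset.univ α z₁ ω)⁻¹ * (resVec τ Finset.univ α z₁ ω ⬝ᵥ
        (L (resolventOn τ (Finset.univ.erase α) z₂ ω) *ᵥ tensorVec ω α)) ∂(law n m) -
      (1 + τ α * meanRes n τ Finset.univ z₁)⁻¹ *
        meanTr (n := n) (pairMat L τ Finset.univ z₁ z₂)‖ ≤ covConst T q * (r / n) := by
  have hn : (0 : ℝ) < n := natCast_pos_of_neZero
  have hT := nonneg_of_abs_le (hτ α)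
  set S : Finset (Fin m) := Finset.univ
  set a : ℂ := 1 + τ α * meanRes n τ (S.erase α) z₁ with ha
  set b : ℂ := (1 + τ α * meanRes n τ S z₁)⁻¹ with hb
  set P := meanTr (n := n) (pairMat L τ S z₁ z₂) with hP
  set P' := meanTr (n := n) (pairMat L τ (S.erase α) z₁ z₂) with hP'
  set ξ : Sample n m → ℂ := fun ω =>
    tensorVec ω α ⬝ᵥ (pairMat L τ (S.erase α) z₁ z₂ ω *ᵥ tensorVec ω α) with hξ
  have hcp := continuous_pairMat (L := L) (τ := τ) hz₁ hz₂ (S.erase α)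
  have hcξ : Continuous ξ :=
    continuous_quadForm hcp (continuous_tensorVec α) (continuous_tensorVec α)
  have hci := continuous_denom_inv (n := n) hz₁ hτ S α
  have hcd := continuous_denom (n := n) (τ := τ) S α hz₁.im_ne_zero
  have hξm : ∫ ω, ξ ω ∂(law n m) = P' :=
    integral_quadForm_resample hcp (fun ω x => pairMat_erase_update S α ω x)
  have hah := half_le_norm_one_add_meanRes (n := n) (τ := τ) hz₁ (hτ α) (S.erase α)
  have hQ := sixteen_le_flucConst (T := T) hm
  have hq := nonneg_of_card_le hm
  have hPC : 32 ≤ pairConst T q := by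
    unfold pairConst; nlinarith [mul_nonneg (sq_nonneg T) hq]
  simp_rw [← quadForm_pairMat]
  change ‖∫ ω, (denom τ S α z₁ ω)⁻¹ * ξ ω ∂(law n m) - b * P‖ ≤ _
  -- Both factors are centred. A covariance remains, of size `n⁻¹` times `r` by Cauchy–Schwarz,
  -- together with two deterministic replacements: the mean of `1/A_α` by `b`, and the trace without
  -- the index `α` by the full one.
  have e1 : ∫ ω, (denom τ S α z₁ ω)⁻¹ * ξ ω ∂(law n m) - b * P =
      ∫ ω, ((denom τ S α z₁ ω)⁻¹ - a⁻¹) * (ξ ω - P') ∂(law n m) +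
      (∫ ω, (denom τ S α z₁ ω)⁻¹ ∂(law n m) - b) * P' - b * (P - P') := by
    have : ∀ ω, ((denom τ S α z₁ ω)⁻¹ - a⁻¹) * (ξ ω - P') =
        (denom τ S α z₁ ω)⁻¹ * ξ ω - (denom τ S α z₁ ω)⁻¹ * P' - a⁻¹ * (ξ ω - P') := by
      intro ω; ring
    simp_rw [this]
    rw [integral_sub (integrable_of_continuous (by fun_prop))
      (integrable_of_continuous (by fun_prop)), integral_sub
      (integrable_of_continuous (by fun_prop)) (integrable_of_continuous (by fun_prop)),
      integral_const_mul, integral_mul_const, integral_sub (integrable_of_continuous hcξ)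
      (integrable_const _), hξm]
    simp
    ring
  have b1 : ‖∫ ω, ((denom τ S α z₁ ω)⁻¹ - a⁻¹) * (ξ ω - P') ∂(law n m)‖ ≤
      (4 * (T + 1) * flucConst T q / n) * (pairConst T q * r) := by
    refine norm_integral_mul_le (by fun_prop) (by fun_prop) (by positivity) (by positivity) ?_ ?_
    · have h1 : ∀ ω : Sample n m, ‖(denom τ S α z₁ ω)⁻¹ - a⁻¹‖ ^ 2 ≤ 16 * ‖denom τ S α z₁ ω - a‖ ^ 2 := by
        intro ω
        have := norm_inv_sub_inv_le (half_le_norm_denom hz₁ hτ S α ω) hah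
        calc _ ≤ (4 * ‖denom τ S α z₁ ω - a‖) ^ 2 := by gcongr
          _ = _ := by ring
      refine (integral_mono_of_continuous (by fun_prop) (by fun_prop) h1).trans ?_
      rw [integral_const_mul]
      refine (mul_le_mul_of_nonneg_left (integral_norm_denom_sub_sq_le hz₁ hτ hm S α)
        (by norm_num)).trans ?_
      rw [div_pow, ← mul_div_assoc]
      gcongr
      have h2 : T ^ 2 * flucConst T q ≤ (T + 1) ^ 2 * flucConst T q ^ 2 := by
        gcongr
        · linarith
        · nlinarith
      calc _ ≤ 16 * ((T + 1) ^ 2 * flucConst T q ^ 2) := by gcongr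
        _ = _ := by ring
    · refine (hL.integral_quadForm_sub_sq_le hz₁ hz₂ hτ hm hrn S α).trans ?_
      rw [mul_pow]
      gcongr
      nlinarith
  have hn2 : 1 / (n : ℝ) ^ 2 ≤ r / n := by
    rw [div_le_div_iff₀ (by positivity) hn, one_mul]
    have h1 : (n : ℝ)⁻¹ ≤ r := hrn.trans (by nlinarith)
    have h2 : 1 ≤ r * n := by
      have := mul_le_mul_of_nonneg_right h1 hn.le
      rwa [inv_mul_cancel₀ hn.ne'] at this
    nlinarith
  have b2 : ‖(∫ ω, (denom τ S α z₁ ω)⁻¹ ∂(law n m) - b) * P'‖ ≤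
      (8 * T ^ 2 * flucConst T q + 8 * T ^ 2) * (r / n) := by
    rw [norm_mul]
    have h1 := norm_integral_denom_inv_sub_le (n := n) hz₁ hτ hm S α
    have h2 : ‖P'‖ ≤ 1 := hL.norm_meanTr_pairMat_le hz₁ hz₂ _
    calc _ ≤ (8 * T ^ 2 * flucConst T q + 8 * T ^ 2) / (n : ℝ) ^ 2 * 1 := by gcongr
      _ = (8 * T ^ 2 * flucConst T q + 8 * T ^ 2) * (1 / (n : ℝ) ^ 2) := by ring
      _ ≤ _ := by gcongr
  have b3 : ‖b * (P - P')‖ ≤ 8 * T * (r / n) := by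
    rw [norm_mul]
    have h1 : ‖b‖ ≤ 2 := norm_inv_le_two (half_le_norm_one_add_meanRes hz₁ (hτ α) S)
    have h2 := hL.norm_meanTr_sub_le hr.le hz₁ hz₂ hτ S α
    calc _ ≤ 2 * (4 * T * r / n) := by gcongr
      _ = _ := by ring
  rw [e1]
  refine (norm_sub_le _ _).trans ((add_le_add ((norm_add_le _ _).trans (add_le_add b1 b2))
    b3).trans (le_of_eq ?_))
  unfold covConst
  ring

end Pairings

/-! ### The rank one terms, which produce the correction in the limit. -/

section RankOneTerms

variable {n m : ℕ} [NeZero n] {T q r : ℝ} {τ : Fin m → ℝ} {z z₁ z₂ : ℂ}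
  {L : Matrix (Fin n × Fin n) (Fin n × Fin n) ℂ →ₗ[ℂ] Matrix (Fin n × Fin n) (Fin n × Fin n) ℂ}

lemma sum_vec_sq (y : Sph n) : ∑ j, vec y j * vec y j = 1 := by
  have h := congrArg (fun x : ℝ => (x : ℂ)) (sum_sq_sph y)
  simpa [vec, pow_two] using h

lemma contrFst_tens_self (p : Sph n × Sph n) : contrFst (tens p) (vec p.1) = vec p.2 := by
  ext s
  simp only [contrFst, tens]
  calc ∑ j, vec p.1 j * vec p.2 s * vec p.1 j = (∑ j, vec p.1 j * vec p.1 j) * vec p.2 s := by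
        rw [Finset.sum_mul]; exact Finset.sum_congr rfl fun _ _ => by ring
    _ = vec p.2 s := by rw [sum_vec_sq, one_mul]

lemma contrSnd_tens_self (p : Sph n × Sph n) : contrSnd (tens p) (vec p.2) = vec p.1 := by
  ext j
  simp only [contrSnd, tens]
  calc ∑ s, vec p.1 j * vec p.2 s * vec p.2 s = vec p.1 j * ∑ s, vec p.2 s * vec p.2 s := by
        rw [Finset.mul_sum]; exact Finset.sum_congr rfl fun _ _ => by ring
    _ = vec p.1 j := by rw [sum_vec_sq, mul_one]

lemma contrFst_sub_smul (u w : Fin n × Fin n → ℂ) (a : ℂ) (v : Fin n → ℂ) :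
    contrFst (u - a • w) v = contrFst u v - a • contrFst w v := by
  ext s
  simp [contrFst, sub_mul, Finset.mul_sum, mul_assoc]

lemma contrSnd_sub_smul (u w : Fin n × Fin n → ℂ) (a : ℂ) (v : Fin n → ℂ) :
    contrSnd (u - a • w) v = contrSnd u v - a • contrSnd w v := by
  ext s
  simp [contrSnd, sub_mul, Finset.mul_sum, mul_assoc]

lemma flucConst_div (T q : ℝ) :
    ((n : ℝ) ^ 3)⁻¹ * (flucConst T q * (n : ℝ) ^ 2) = flucConst T q / n := by
  have hn : (n : ℝ) ≠ 0 := NeZero.ne _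
  field_simp

/-- For `Y` itself the contraction with its first factor is exactly the second factor, so only the
centred resolvent contributes. The bound `O(n⁻¹)` in mean square is the weakest estimate of the
proof and determines the loss of `√n` in (iii) and (iv). -/
lemma integral_nsq_contrFst_resVec_le (hz : Far T z) (hτ : ∀ α, |τ α| ≤ T)
    (hm : (m : ℝ) ≤ q * (n : ℝ) ^ 2) (S : Finset (Fin m)) (α : Fin m) :
    ∫ ω, nsq (contrFst (resVec τ S α z ω) (vec (ω α).1) -
      meanRes n τ (S.erase α) z • vec (ω α).2) ∂(law n m) ≤ flucConst T q / n := by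
  have hc := continuous_resolventOn (n := n) τ (S.erase α) hz.im_ne_zero
  have h := integral_nsq_contrFst_resample_le (α := α)
    (H := fun ω => resolventOn τ (S.erase α) z ω - meanRes n τ (S.erase α) z • 1)
    (hc.sub continuous_const) (fun ω x => by rw [resolventOn_erase_update])
  have h2 := integral_quadFun_res_le (n := n) hz hτ hm (S.erase α)
  refine le_trans (le_of_eq ?_) (h.trans ?_)
  · refine integral_congr_ae (Eventually.of_forall fun ω => ?_)
    simp only
    rw [Matrix.sub_mulVec, Matrix.smul_mulVec, Matrix.one_mulVec, contrFst_sub_smul,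
      tensorVec_eq_tens, contrFst_tens_self, resVec, tensorVec_eq_tens]
  · rw [← flucConst_div]; gcongr

lemma integral_nsq_contrSnd_resVec_le (hz : Far T z) (hτ : ∀ α, |τ α| ≤ T)
    (hm : (m : ℝ) ≤ q * (n : ℝ) ^ 2) (S : Finset (Fin m)) (α : Fin m) :
    ∫ ω, nsq (contrSnd (resVec τ S α z ω) (vec (ω α).2) -
      meanRes n τ (S.erase α) z • vec (ω α).1) ∂(law n m) ≤ flucConst T q / n := by
  have hc := continuous_resolventOn (n := n) τ (S.erase α) hz.im_ne_zero
  have h := integral_nsq_contrSnd_resample_le (α := α)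
    (H := fun ω => resolventOn τ (S.erase α) z ω - meanRes n τ (S.erase α) z • 1)
    (hc.sub continuous_const) (fun ω x => by rw [resolventOn_erase_update])
  have h2 := integral_quadFun_res_le (n := n) hz hτ hm (S.erase α)
  refine le_trans (le_of_eq ?_) (h.trans ?_)
  · refine integral_congr_ae (Eventually.of_forall fun ω => ?_)
    simp only
    rw [Matrix.sub_mulVec, Matrix.smul_mulVec, Matrix.one_mulVec, contrSnd_sub_smul,
      tensorVec_eq_tens, contrSnd_tens_self, resVec, tensorVec_eq_tens]
  · rw [← flucConst_div]; gcongr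

/-- The rank one term of the expansion of the pairing. -/
def rankOneTerm (L : Matrix (Fin n × Fin n) (Fin n × Fin n) ℂ →ₗ[ℂ]
    Matrix (Fin n × Fin n) (Fin n × Fin n) ℂ) (τ : Fin m → ℝ) (S : Finset (Fin m)) (α : Fin m)
    (z₁ z₂ : ℂ) (ω : Sample n m) : ℂ :=
  resVec τ S α z₁ ω ⬝ᵥ
    (L (vecMulVec (resVec τ S α z₂ ω) (resVec τ S α z₂ ω)) *ᵥ tensorVec ω α)

lemma continuous_rankOneTerm (hz₁ : Far T z₁) (hz₂ : Far T z₂) (S : Finset (Fin m)) (α : Fin m) :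
    Continuous fun ω : Sample n m => rankOneTerm L τ S α z₁ z₂ ω := by
  have h1 := continuous_resVec (n := n) (τ := τ) S α hz₁.im_ne_zero
  have h2 := continuous_resVec (n := n) (τ := τ) S α hz₂.im_ne_zero
  exact h1.dotProduct (((continuous_map_matrix L).comp (h2.matrix_vecMulVec h2)).matrix_mulVec
    (continuous_tensorVec α))

lemma norm_weighted_sub_le {A₁ A₂ a₁ a₂ X θ : ℂ} (hA₁ : 1 / 2 ≤ ‖A₁‖) (hA₂ : 1 / 2 ≤ ‖A₂‖)
    (ha₁ : 1 / 2 ≤ ‖a₁‖) (ha₂ : 1 / 2 ≤ ‖a₂‖) :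
    ‖A₁⁻¹ * A₂⁻¹ * X - a₁⁻¹ * a₂⁻¹ * θ‖ ≤
      4 * ‖X - θ‖ + ‖θ‖ * (8 * ‖A₁ - a₁‖ + 8 * ‖A₂ - a₂‖) := by
  have e : A₁⁻¹ * A₂⁻¹ * X - a₁⁻¹ * a₂⁻¹ * θ = A₁⁻¹ * A₂⁻¹ * (X - θ) +
      (θ * (a₂⁻¹ * (A₁⁻¹ - a₁⁻¹)) + θ * (A₁⁻¹ * (A₂⁻¹ - a₂⁻¹))) := by ring
  have h1 := norm_inv_le_two hA₁
  have h2 := norm_inv_le_two hA₂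
  have h3 := norm_inv_le_two ha₂
  have h4 := norm_inv_sub_inv_le hA₁ ha₁
  have h5 := norm_inv_sub_inv_le hA₂ ha₂
  rw [e]
  refine (norm_add_le _ _).trans ?_
  refine (add_le_add le_rfl (norm_add_le _ _)).trans ?_
  simp only [norm_mul]
  calc _ ≤ 2 * 2 * ‖X - θ‖ + (‖θ‖ * (2 * (4 * ‖A₁ - a₁‖)) + ‖θ‖ * (2 * (4 * ‖A₂ - a₂‖))) := by
        gcongr
    _ = _ := by ring

lemma norm_integral_sub_le_of_forall_le {F : Sample n m → ℂ} {θ : ℂ} {b : Sample n m → ℝ}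
    (hF : Continuous F) (hb : Continuous b) (h : ∀ ω, ‖F ω - θ‖ ≤ b ω) :
    ‖∫ ω, F ω ∂(law n m) - θ‖ ≤ ∫ ω, b ω ∂(law n m) := by
  have e : ∫ ω, F ω ∂(law n m) - θ = ∫ ω, (F ω - θ) ∂(law n m) := by
    rw [integral_sub (integrable_of_continuous hF) (integrable_const _)]
    simp
  rw [e]
  exact norm_integral_le_of_norm_le (integrable_of_continuous hb) (Eventually.of_forall h)

/-- The constant is `36 = 4 * 5 + 8 + 8`. -/
lemma integral_weighted_sum_le {t₁ t₂ t₃ t₄ t₅ t₆ t₇ : Sample n m → ℝ} {e : ℝ}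
    (c₁ : Continuous t₁) (c₂ : Continuous t₂) (c₃ : Continuous t₃) (c₄ : Continuous t₄)
    (c₅ : Continuous t₅) (c₆ : Continuous t₆) (c₇ : Continuous t₇)
    (i₁ : ∫ ω, t₁ ω ∂(law n m) ≤ e) (i₂ : ∫ ω, t₂ ω ∂(law n m) ≤ e)
    (i₃ : ∫ ω, t₃ ω ∂(law n m) ≤ e) (i₄ : ∫ ω, t₄ ω ∂(law n m) ≤ e)
    (i₅ : ∫ ω, t₅ ω ∂(law n m) ≤ e) (i₆ : ∫ ω, t₆ ω ∂(law n m) ≤ e)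
    (i₇ : ∫ ω, t₇ ω ∂(law n m) ≤ e) :
    ∫ ω, r ^ 2 * (4 * (t₁ ω + t₂ ω + t₃ ω + t₄ ω + t₅ ω) + (8 * t₆ ω + 8 * t₇ ω)) ∂(law n m) ≤
      r ^ 2 * (36 * e) := by
  have j : ∀ {F : Sample n m → ℝ}, Continuous F → Integrable F (law n m) :=
    fun h => integrable_of_continuous h
  rw [integral_const_mul, integral_add (j (by fun_prop)) (j (by fun_prop)), integral_const_mul,
    integral_add (j (by fun_prop)) (j c₅), integral_add (j (by fun_prop)) (j c₄),
    integral_add (j (by fun_prop)) (j c₃), integral_add (j c₁) (j c₂),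
    integral_add (j (by fun_prop)) (j (by fun_prop)), integral_const_mul, integral_const_mul]
  gcongr
  linarith

set_option maxHeartbeats 1000000 in
/-- The expectation of the rank one terms of the expansion of the pairing. -/
lemma PairingMap.norm_integral_rankOneTerm_sub_le (hL : PairingMap n r L)
    (hz₁ : Far T z₁) (hz₂ : Far T z₂) (hτ : ∀ α, |τ α| ≤ T) (hm : (m : ℝ) ≤ q * (n : ℝ) ^ 2)
    (S : Finset (Fin m)) (α : Fin m) :
    ‖∫ ω, (denom τ S α z₁ ω)⁻¹ * (denom τ S α z₂ ω)⁻¹ * rankOneTerm L τ S α z₁ z₂ ω ∂(law n m) -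
      (1 + τ α * meanRes n τ (S.erase α) z₁)⁻¹ * (1 + τ α * meanRes n τ (S.erase α) z₂)⁻¹ *
        (r ^ 2 * (meanRes n τ (S.erase α) z₁ * meanRes n τ (S.erase α) z₂ ^ 2))‖ ≤
      36 * ((T + 1) * flucConst T q) * (r ^ 2 / √n) := by
  have hn : (0 : ℝ) < n := natCast_pos_of_neZero
  have hn1 : (1 : ℝ) ≤ n := by exact_mod_cast Nat.one_le_iff_ne_zero.2 (NeZero.ne n)
  have hT := nonneg_of_abs_le (hτ α)
  have hQ := sixteen_le_flucConst (T := T) hm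
  set x₁ := meanRes n τ (S.erase α) z₁ with hx₁
  set x₂ := meanRes n τ (S.erase α) z₂ with hx₂
  set a₁ : ℂ := 1 + τ α * x₁ with ha₁
  set a₂ : ℂ := 1 + τ α * x₂ with ha₂
  set θ : ℂ := r ^ 2 * (x₁ * x₂ ^ 2) with hθ
  have hx₁1 : ‖x₁‖ ≤ 1 := norm_meanRes_le_one hz₁ _
  have hx₂1 : ‖x₂‖ ≤ 1 := norm_meanRes_le_one hz₂ _
  have hθ1 : ‖θ‖ ≤ r ^ 2 := by
    rw [hθ, norm_mul, norm_mul, norm_pow, norm_pow, Complex.norm_real, Real.norm_eq_abs, sq_abs]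
    have : ‖x₁‖ * ‖x₂‖ ^ 2 ≤ 1 :=
      mul_le_one₀ hx₁1 (by positivity) (pow_le_one₀ (norm_nonneg _) hx₂1)
    exact mul_le_of_le_one_right (sq_nonneg r) this
  -- One common bound for the first moments of all seven errors. The factor `T + 1` makes its square
  -- dominate both `flucConst / n` and `T² flucConst / n²`.
  set e := (T + 1) * flucConst T q / √n with he
  have he0 : 0 < e := by positivity
  have he2 : e ^ 2 = (T + 1) ^ 2 * flucConst T q ^ 2 / n := by
    rw [he, div_pow, mul_pow, Real.sq_sqrt hn.le]
  have hQ2 : flucConst T q ≤ (T + 1) ^ 2 * flucConst T q ^ 2 := by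
    have h1 : 1 ≤ (T + 1) ^ 2 := by nlinarith
    have h2 : flucConst T q ≤ flucConst T q ^ 2 := by nlinarith
    nlinarith [sq_nonneg (flucConst T q)]
  have eb1 : flucConst T q / n ≤ e ^ 2 := by rw [he2]; gcongr
  have eb2 : T ^ 2 * flucConst T q / (n : ℝ) ^ 2 ≤ e ^ 2 := by
    rw [he2]
    have h1 : (n : ℝ) ≤ (n : ℝ) ^ 2 := by nlinarith
    have h2 : T ^ 2 * flucConst T q ≤ (T + 1) ^ 2 * flucConst T q ^ 2 := by
      gcongr
      · linarith
      · nlinarith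
    gcongr
  have eb3 : flucConst T q / (n : ℝ) ^ 2 ≤ e ^ 2 := by
    refine le_trans ?_ eb1
    have h1 : (n : ℝ) ≤ (n : ℝ) ^ 2 := by nlinarith
    gcongr
  have cv1 : Continuous fun ω : Sample n m => vec (ω α).1 :=
    continuous_vec'.comp (continuous_fst.comp (continuous_apply α))
  have cv2 : Continuous fun ω : Sample n m => vec (ω α).2 :=
    continuous_vec'.comp (continuous_snd.comp (continuous_apply α))
  have cu1 := continuous_resVec (n := n) (τ := τ) S α hz₁.im_ne_zero
  have cu2 := continuous_resVec (n := n) (τ := τ) S α hz₂.im_ne_zero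
  have cd1 := continuous_denom (n := n) (τ := τ) S α hz₁.im_ne_zero
  have cd2 := continuous_denom (n := n) (τ := τ) S α hz₂.im_ne_zero
  have ci1 := continuous_denom_inv (n := n) hz₁ hτ S α
  have ci2 := continuous_denom_inv (n := n) hz₂ hτ S α
  have cX := continuous_rankOneTerm (n := n) (L := L) (τ := τ) hz₁ hz₂ S α
  set t₁ : Sample n m → ℝ := fun ω => √(nsq (contrSnd (resVec τ S α z₁ ω) (vec (ω α).2) -
    x₁ • vec (ω α).1)) with ht₁
  set t₂ : Sample n m → ℝ := fun ω => √(nsq (contrSnd (resVec τ S α z₂ ω) (vec (ω α).2) -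
    x₂ • vec (ω α).1)) with ht₂
  set t₃ : Sample n m → ℝ := fun ω => √(nsq (contrFst (resVec τ S α z₂ ω) (vec (ω α).1) -
    x₂ • vec (ω α).2)) with ht₃
  set t₄ : Sample n m → ℝ := fun ω => ‖resVec τ S α z₁ ω ⬝ᵥ tensorVec ω α - x₁‖ with ht₄
  set t₅ : Sample n m → ℝ := fun ω => ‖resVec τ S α z₂ ω ⬝ᵥ tensorVec ω α - x₂‖ with ht₅
  set t₆ : Sample n m → ℝ := fun ω => ‖denom τ S α z₁ ω - a₁‖ with ht₆
  set t₇ : Sample n m → ℝ := fun ω => ‖denom τ S α z₂ ω - a₂‖ with ht₇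
  have c1 : Continuous t₁ :=
    (continuous_nsq ((continuous_contrSnd cu1 cv2).sub (cv1.const_smul x₁))).sqrt
  have c2 : Continuous t₂ :=
    (continuous_nsq ((continuous_contrSnd cu2 cv2).sub (cv1.const_smul x₂))).sqrt
  have c3 : Continuous t₃ :=
    (continuous_nsq ((continuous_contrFst cu2 cv1).sub (cv2.const_smul x₂))).sqrt
  have c4 : Continuous t₄ := ((cu1.dotProduct (continuous_tensorVec α)).sub continuous_const).norm
  have c5 : Continuous t₅ := ((cu2.dotProduct (continuous_tensorVec α)).sub continuous_const).norm
  have c6 : Continuous t₆ := (cd1.sub continuous_const).norm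
  have c7 : Continuous t₇ := (cd2.sub continuous_const).norm
  have i1 : ∫ ω, t₁ ω ∂(law n m) ≤ e := by
    refine integral_le_of_sq_le c1 he0 (eb1.trans' ?_)
    simp only [ht₁, Real.sq_sqrt (nsq_nonneg _)]
    exact integral_nsq_contrSnd_resVec_le hz₁ hτ hm S α
  have i2 : ∫ ω, t₂ ω ∂(law n m) ≤ e := by
    refine integral_le_of_sq_le c2 he0 (eb1.trans' ?_)
    simp only [ht₂, Real.sq_sqrt (nsq_nonneg _)]
    exact integral_nsq_contrSnd_resVec_le hz₂ hτ hm S α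
  have i3 : ∫ ω, t₃ ω ∂(law n m) ≤ e := by
    refine integral_le_of_sq_le c3 he0 (eb1.trans' ?_)
    simp only [ht₃, Real.sq_sqrt (nsq_nonneg _)]
    exact integral_nsq_contrFst_resVec_le hz₂ hτ hm S α
  have i4 : ∫ ω, t₄ ω ∂(law n m) ≤ e :=
    integral_le_of_sq_le c4 he0 (eb3.trans' (integral_norm_res_quadForm_sub_sq_le hz₁ hτ hm S α))
  have i5 : ∫ ω, t₅ ω ∂(law n m) ≤ e :=
    integral_le_of_sq_le c5 he0 (eb3.trans' (integral_norm_res_quadForm_sub_sq_le hz₂ hτ hm S α))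
  have i6 : ∫ ω, t₆ ω ∂(law n m) ≤ e :=
    integral_le_of_sq_le c6 he0 (eb2.trans' (integral_norm_denom_sub_sq_le hz₁ hτ hm S α))
  have i7 : ∫ ω, t₇ ω ∂(law n m) ≤ e :=
    integral_le_of_sq_le c7 he0 (eb2.trans' (integral_norm_denom_sub_sq_le hz₂ hτ hm S α))
  have hpt : ∀ ω : Sample n m, ‖(denom τ S α z₁ ω)⁻¹ * (denom τ S α z₂ ω)⁻¹ *
      rankOneTerm L τ S α z₁ z₂ ω - a₁⁻¹ * a₂⁻¹ * θ‖ ≤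
      r ^ 2 * (4 * (t₁ ω + t₂ ω + t₃ ω + t₄ ω + t₅ ω) + (8 * t₆ ω + 8 * t₇ ω)) := by
    intro ω
    have h1 := norm_weighted_sub_le (X := rankOneTerm L τ S α z₁ z₂ ω) (θ := θ)
      (half_le_norm_denom hz₁ hτ S α ω) (half_le_norm_denom hz₂ hτ S α ω)
      (half_le_norm_one_add_meanRes (n := n) (τ := τ) hz₁ (hτ α) (S.erase α))
      (half_le_norm_one_add_meanRes (n := n) (τ := τ) hz₂ (hτ α) (S.erase α))
    have h2 : ‖rankOneTerm L τ S α z₁ z₂ ω - θ‖ ≤ r ^ 2 * (t₁ ω + t₂ ω + t₃ ω + t₄ ω + t₅ ω) := by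
      have := hL.form (ω α) (resVec τ S α z₁ ω) (resVec τ S α z₂ ω) x₁ x₂
        (nsq_resVec_le hz₁ S α ω) (nsq_resVec_le hz₂ S α ω) hx₁1 hx₂1
      rw [← tensorVec_eq_tens] at this
      exact this
    have h6 : 0 ≤ 8 * t₆ ω + 8 * t₇ ω := by
      have := norm_nonneg (denom τ S α z₁ ω - a₁)
      have := norm_nonneg (denom τ S α z₂ ω - a₂)
      simp only [ht₆, ht₇]; positivity
    have h3 : ‖θ‖ * (8 * t₆ ω + 8 * t₇ ω) ≤ r ^ 2 * (8 * t₆ ω + 8 * t₇ ω) := by gcongr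
    refine h1.trans ?_
    change 4 * ‖rankOneTerm L τ S α z₁ z₂ ω - θ‖ + ‖θ‖ * (8 * t₆ ω + 8 * t₇ ω) ≤ _
    linarith
  have fin : 36 * ((T + 1) * flucConst T q) * (r ^ 2 / √n) = r ^ 2 * (36 * e) := by
    rw [he]; ring
  rw [fin]
  exact (norm_integral_sub_le_of_forall_le ((ci1.mul ci2).mul cX) (by clear_value t₁ t₂ t₃ t₄ t₅ t₆ t₇; fun_prop) hpt).trans
    (integral_weighted_sum_le c1 c2 c3 c4 c5 c6 c7 i1 i2 i3 i4 i5 i6 i7)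

end RankOneTerms

/-! ### The linear equation of a pairing and its solution. -/

section PairingLimit

variable {n m : ℕ} [NeZero n] {T q r : ℝ} {τ : Fin m → ℝ} {z z₁ z₂ w w₁ w₂ : ℂ}
  {L : Matrix (Fin n × Fin n) (Fin n × Fin n) ℂ →ₗ[ℂ] Matrix (Fin n × Fin n) (Fin n × Fin n) ℂ}
  {σ : Measure ℝ} [IsProbabilityMeasure σ] {c C K Δ : ℝ}

/-- The value `w` of the solution of the limiting equation at a point `z` far from the real
line. -/
structure LimitPoint (σ : Measure ℝ) (T c : ℝ) (z w : ℂ) : Prop where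
  far : Far T z
  im_ge : 8 * c * T ≤ |z.im|
  bound : |z.im| * ‖w‖ ≤ 1
  equation : z * w = -1 + c * ∫ t : ℝ, t * w / (1 + t * w) ∂σ

/-- The constant in the rate of convergence of the normalized expected trace. -/
def traceConst (T q c C K : ℝ) : ℝ :=
  2 * (q * (8 * T ^ 2 * flucConst T q + 8 * T ^ 2) + (K + 2 * c * C) * (2 * T))

lemma LimitPoint.norm_meanRes_sub_le (h : LimitPoint σ T c z w) (hd : WeightData n m τ σ T c C K)
    (hm : (m : ℝ) ≤ q * (n : ℝ) ^ 2) :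
    ‖meanRes n τ Finset.univ z - w‖ ≤ traceConst T q c C K / (n : ℝ) ^ 2 :=
  norm_meanRes_sub_limit_le hd h.far h.im_ge hm h.bound h.equation

lemma LimitPoint.norm_le_one (h : LimitPoint σ T c z w) : ‖w‖ ≤ 1 :=
  norm_le_one_of_im_mul h.far h.bound

lemma LimitPoint.half_le (h : LimitPoint σ T c z w) {t : ℝ} (ht : t ∈ Set.Icc 0 T) :
    1 / 2 ≤ ‖(1 + t * w : ℂ)‖ :=
  half_le_of_mem_Icc h.far h.bound ht

lemma norm_cubic_sub_le {δ : ℝ} {a₁ a₂ b₁ b₂ : ℂ} (ha₂ : ‖a₂‖ ≤ 1)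
    (hb₁ : ‖b₁‖ ≤ 1) (hb₂ : ‖b₂‖ ≤ 1) (h₁ : ‖a₁ - b₁‖ ≤ δ) (h₂ : ‖a₂ - b₂‖ ≤ δ) :
    ‖a₁ * a₂ ^ 2 - b₁ * b₂ ^ 2‖ ≤ 3 * δ := by
  have e : a₁ * a₂ ^ 2 - b₁ * b₂ ^ 2 =
      (a₁ - b₁) * (a₂ * a₂) + (b₁ * a₂ * (a₂ - b₂) + b₁ * b₂ * (a₂ - b₂)) := by ring
  have hδ : 0 ≤ δ := (norm_nonneg _).trans h₁
  rw [e]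
  refine (norm_add_le _ _).trans ((add_le_add le_rfl (norm_add_le _ _)).trans ?_)
  simp only [norm_mul]
  calc _ ≤ δ * (1 * 1) + (1 * 1 * δ + 1 * 1 * δ) := by gcongr
    _ = 3 * δ := by ring

/-- The constant in the bound of one term of the expansion of the pairing. -/
def termConst (T q Δ : ℝ) : ℝ :=
  covConst T q + 4 * T * Δ + T * (36 * ((T + 1) * flucConst T q) + (12 + 16 * T) * (2 * T + Δ))

lemma covConst_nonneg (hT : 0 ≤ T) (hm : (m : ℝ) ≤ q * (n : ℝ) ^ 2) : 0 ≤ covConst T q := by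
  have := sixteen_le_flucConst (T := T) hm
  have hq := nonneg_of_card_le hm
  unfold covConst pairConst
  positivity

lemma termConst_nonneg (hT : 0 ≤ T) (hm : (m : ℝ) ≤ q * (n : ℝ) ^ 2) (hΔ : 0 ≤ Δ) :
    0 ≤ termConst T q Δ := by
  have := sixteen_le_flucConst (T := T) hm
  have := covConst_nonneg hT hm
  unfold termConst
  positivity

/-- Since `C` and `K` carry no sign assumption, the signs of the derived constants are read off from
the norm estimates that they bound. -/
lemma nonneg_of_le_div_sq {a : ℝ} (h : 0 ≤ a / (n : ℝ) ^ 2) : 0 ≤ a := by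
  have hn : (0 : ℝ) < (n : ℝ) ^ 2 := pow_pos natCast_pos_of_neZero 2
  by_contra! hneg
  exact absurd h (not_le.2 (div_neg_of_neg_of_pos hneg hn))

/-- As `r ≥ n^{-1/2}`, the decoupling error `r / n` is absorbed by the error `r² / √n` of the rank
one terms. -/
lemma div_le_error (hr : 0 < r) (hrn : (n : ℝ)⁻¹ ≤ r ^ 2) : r / n ≤ r ^ 2 / √n := by
  have hn : (0 : ℝ) < n := natCast_pos_of_neZero
  have hs : 0 < √(n : ℝ) := Real.sqrt_pos.2 hn
  have h1 : (√(n : ℝ))⁻¹ ≤ r := by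
    refine abs_le_of_sq_le_sq' ?_ hr.le |>.2
    rwa [inv_pow, Real.sq_sqrt hn.le]
  calc r / n = r * (√(n : ℝ))⁻¹ / √n := by
        rw [← div_eq_mul_inv, div_div, Real.mul_self_sqrt hn.le]
    _ ≤ r * r / √n := by gcongr
    _ = r ^ 2 / √n := by rw [pow_two]

lemma inv_sq_le_error (hr : 0 < r) (hr1 : r ≤ 1) (hrn : (n : ℝ)⁻¹ ≤ r ^ 2) :
    1 / (n : ℝ) ^ 2 ≤ r ^ 2 / √n := by
  have hn : (0 : ℝ) < n := natCast_pos_of_neZero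
  refine le_trans ?_ (div_le_error hr hrn)
  have h1 : (n : ℝ)⁻¹ ≤ r := hrn.trans (by nlinarith)
  calc 1 / (n : ℝ) ^ 2 = (n : ℝ)⁻¹ / n := by field_simp
    _ ≤ r / n := by gcongr

lemma continuous_first_term (hz₁ : Far T z₁) (hz₂ : Far T z₂) (S S' : Finset (Fin m))
    (α : Fin m) : Continuous fun ω : Sample n m =>
      resVec τ S α z₁ ω ⬝ᵥ (L (resolventOn τ S' z₂ ω) *ᵥ tensorVec ω α) :=
  (continuous_resVec S α hz₁.im_ne_zero).dotProduct
    (((continuous_map_matrix L).comp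
      (continuous_resolventOn τ S' hz₂.im_ne_zero)).matrix_mulVec (continuous_tensorVec α))

/-- The second resolvent still depends on `Y_α`. The rank one formula replaces it by `G^α`, at the
price of the rank one term with weight `-τ_α / A_α(z₂)`. -/
lemma integral_term_eq (hz₁ : Far T z₁) (hz₂ : Far T z₂) (hτ : ∀ α, |τ α| ≤ T)
    {S : Finset (Fin m)} {α : Fin m} (hα : α ∈ S) :
    ∫ ω, (denom τ S α z₁ ω)⁻¹ * (resVec τ S α z₁ ω ⬝ᵥ
        (L (resolventOn τ S z₂ ω) *ᵥ tensorVec ω α)) ∂(law n m) =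
      ∫ ω, (denom τ S α z₁ ω)⁻¹ * (resVec τ S α z₁ ω ⬝ᵥ
        (L (resolventOn τ (S.erase α) z₂ ω) *ᵥ tensorVec ω α)) ∂(law n m) -
      τ α * ∫ ω, (denom τ S α z₁ ω)⁻¹ * (denom τ S α z₂ ω)⁻¹ *
        rankOneTerm L τ S α z₁ z₂ ω ∂(law n m) := by
  have c1 := continuous_denom_inv (n := n) hz₁ hτ S α
  have c2 := continuous_denom_inv (n := n) hz₂ hτ S α
  have c3 : Continuous fun ω : Sample n m => (denom τ S α z₁ ω)⁻¹ * (resVec τ S α z₁ ω ⬝ᵥ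
      (L (resolventOn τ (S.erase α) z₂ ω) *ᵥ tensorVec ω α)) :=
    c1.mul (continuous_first_term hz₁ hz₂ S _ α)
  have c4 : Continuous fun ω : Sample n m => (τ α : ℂ) * ((denom τ S α z₁ ω)⁻¹ *
      (denom τ S α z₂ ω)⁻¹ * rankOneTerm L τ S α z₁ z₂ ω) :=
    continuous_const.mul ((c1.mul c2).mul (continuous_rankOneTerm hz₁ hz₂ S α))
  rw [← integral_const_mul, ← integral_sub (integrable_of_continuous c3)
    (integrable_of_continuous c4)]
  refine integral_congr_ae (Eventually.of_forall fun ω => ?_)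
  simp only
  rw [(resolventOn_mulVec hz₂ hτ hα ω).2, map_sub, map_smul, Matrix.sub_mulVec,
    Matrix.smul_mulVec, dotProduct_sub, dotProduct_smul, rankOneTerm, smul_eq_mul]
  ring

set_option maxHeartbeats 400000 in
/-- One term of the expansion of the pairing. -/
lemma PairingMap.norm_integral_term_sub_le (hL : PairingMap n r L) (hr : 0 < r) (hr1 : r ≤ 1)
    (hrn : (n : ℝ)⁻¹ ≤ r ^ 2) (h₁ : LimitPoint σ T c z₁ w₁) (h₂ : LimitPoint σ T c z₂ w₂)
    (hd : WeightData n m τ σ T c C K) (hm : (m : ℝ) ≤ q * (n : ℝ) ^ 2) (α : Fin m) :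
    ‖∫ ω, (denom τ Finset.univ α z₁ ω)⁻¹ * (resVec τ Finset.univ α z₁ ω ⬝ᵥ
        (L (resolventOn τ Finset.univ z₂ ω) *ᵥ tensorVec ω α)) ∂(law n m) -
      ((1 + τ α * w₁)⁻¹ * meanTr (n := n) (pairMat L τ Finset.univ z₁ z₂) -
        τ α * ((1 + τ α * w₁)⁻¹ * (1 + τ α * w₂)⁻¹ * (r ^ 2 * (w₁ * w₂ ^ 2))))‖ ≤
      termConst T q (traceConst T q c C K) * (r ^ 2 / √n) := by
  have hτ := hd.abs_le
  have hT := hd.hT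
  have hz₁ := h₁.far
  have hz₂ := h₂.far
  set Δ := traceConst T q c C K with hΔ
  set S : Finset (Fin m) := Finset.univ with hS
  set P := meanTr (n := n) (pairMat L τ S z₁ z₂) with hP
  set b₁ : ℂ := (1 + τ α * w₁)⁻¹ with hb₁
  set b₂ : ℂ := (1 + τ α * w₂)⁻¹ with hb₂
  set x₁ := meanRes n τ (S.erase α) z₁ with hx₁
  set x₂ := meanRes n τ (S.erase α) z₂ with hx₂
  set a₁ : ℂ := (1 + τ α * x₁)⁻¹ with ha₁
  set a₂ : ℂ := (1 + τ α * x₂)⁻¹ with ha₂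
  set x := meanRes n τ S z₁ with hx
  set a : ℂ := (1 + τ α * x)⁻¹ with ha
  set X := ∫ ω, (denom τ S α z₁ ω)⁻¹ * (resVec τ S α z₁ ω ⬝ᵥ
        (L (resolventOn τ (S.erase α) z₂ ω) *ᵥ tensorVec ω α)) ∂(law n m) with hX
  set Y := ∫ ω, (denom τ S α z₁ ω)⁻¹ * (denom τ S α z₂ ω)⁻¹ * rankOneTerm L τ S α z₁ z₂ ω
    ∂(law n m) with hY
  have hsplit : ∫ ω, (denom τ S α z₁ ω)⁻¹ * (resVec τ S α z₁ ω ⬝ᵥ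
      (L (resolventOn τ S z₂ ω) *ᵥ tensorVec ω α)) ∂(law n m) = X - τ α * Y :=
    integral_term_eq hz₁ hz₂ hτ (Finset.mem_univ α)
  have f1 : ‖X - a * P‖ ≤ covConst T q * (r / n) :=
    hL.norm_integral_first_le hr hr1 hz₁ hz₂ hτ hm hrn α
  have f3 : ‖Y - a₁ * a₂ * (r ^ 2 * (x₁ * x₂ ^ 2))‖ ≤
      36 * ((T + 1) * flucConst T q) * (r ^ 2 / √n) :=
    hL.norm_integral_rankOneTerm_sub_le hz₁ hz₂ hτ hm S α
  clear_value X Y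
  have hu : ∀ z w, LimitPoint σ T c z w → ‖meanRes n τ S z - w‖ ≤ Δ / (n : ℝ) ^ 2 :=
    fun z w h => h.norm_meanRes_sub_le hd hm
  have he : ∀ z w, LimitPoint σ T c z w →
      ‖meanRes n τ (S.erase α) z - w‖ ≤ (2 * T + Δ) / (n : ℝ) ^ 2 := by
    intro z w h
    have := norm_sub_le_norm_sub_add_norm_sub (meanRes n τ (S.erase α) z) (meanRes n τ S z) w
    rw [norm_sub_rev (meanRes n τ (S.erase α) z) (meanRes n τ S z)] at this
    refine this.trans ((add_le_add (norm_meanRes_sub_erase_le h.far hτ S α) (hu z w h)).trans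
      (le_of_eq ?_))
    ring
  have hlin : ∀ {u v : ℂ} {δ : ℝ}, ‖u - v‖ ≤ δ →
      ‖(1 + τ α * u : ℂ) - (1 + τ α * v)‖ ≤ T * δ := by
    intro u v δ h
    have e : (1 + τ α * u : ℂ) - (1 + τ α * v) = τ α * (u - v) := by ring
    rw [e, norm_mul, Complex.norm_real]
    exact mul_le_mul (hτ α) h (norm_nonneg _) hT
  have f2 : ‖(a - b₁) * P‖ ≤ 4 * T * (Δ / (n : ℝ) ^ 2) := by
    rw [norm_mul]
    have h3 : ‖a - b₁‖ ≤ 4 * T * (Δ / (n : ℝ) ^ 2) := by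
      refine (norm_inv_sub_inv_le (half_le_norm_one_add_meanRes hz₁ (hτ α) S)
        (h₁.half_le (hd.mem α))).trans ?_
      rw [mul_assoc]
      gcongr
      exact hlin (hu _ _ h₁)
    exact (mul_le_of_le_one_right (norm_nonneg _)
      (hL.norm_meanTr_pairMat_le hz₁ hz₂ S)).trans h3
  have f4 : ‖a₁ * a₂ * (r ^ 2 * (x₁ * x₂ ^ 2)) - b₁ * b₂ * (r ^ 2 * (w₁ * w₂ ^ 2))‖ ≤
      r ^ 2 * ((12 + 16 * T) * ((2 * T + Δ) / (n : ℝ) ^ 2)) := by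
    refine (norm_weighted_sub_le (half_le_norm_one_add_meanRes hz₁ (hτ α) _)
      (half_le_norm_one_add_meanRes hz₂ (hτ α) _) (h₁.half_le (hd.mem α))
      (h₂.half_le (hd.mem α))).trans ?_
    have e1 : ‖(r : ℂ) ^ 2‖ = r ^ 2 := by
      rw [norm_pow, Complex.norm_real, Real.norm_eq_abs, sq_abs]
    rw [← mul_sub, norm_mul, norm_mul, e1]
    have g1 := norm_cubic_sub_le (norm_meanRes_le_one hz₂ (S.erase α)) h₁.norm_le_one h₂.norm_le_one (he _ _ h₁) (he _ _ h₂)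
    have g2 : ‖w₁ * w₂ ^ 2‖ ≤ 1 := by
      rw [norm_mul, norm_pow]
      exact mul_le_one₀ h₁.norm_le_one (by positivity)
        (pow_le_one₀ (norm_nonneg _) h₂.norm_le_one)
    have g3 := hlin (he _ _ h₁)
    have g4 := hlin (he _ _ h₂)
    set δ := (2 * T + Δ) / (n : ℝ) ^ 2
    calc _ ≤ 4 * (r ^ 2 * (3 * δ)) + r ^ 2 * 1 * (8 * (T * δ) + 8 * (T * δ)) := by gcongr
      _ = _ := by ring
  have e2 := inv_sq_le_error hr hr1 hrn
  have e1 := div_le_error hr hrn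
  have hΔ0 : 0 ≤ Δ := nonneg_of_le_div_sq (n := n) ((norm_nonneg _).trans (hu _ _ h₁))
  have hcov := covConst_nonneg hT hm
  rw [hsplit]
  have e3 : X - τ α * Y - (b₁ * P - τ α * (b₁ * b₂ * (r ^ 2 * (w₁ * w₂ ^ 2)))) =
      (X - a * P) + (a - b₁) * P - τ α * ((Y - a₁ * a₂ * (r ^ 2 * (x₁ * x₂ ^ 2))) +
        (a₁ * a₂ * (r ^ 2 * (x₁ * x₂ ^ 2)) - b₁ * b₂ * (r ^ 2 * (w₁ * w₂ ^ 2)))) := by ring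
  rw [e3]
  set e := r ^ 2 / √n with he'
  have k1 : covConst T q * (r / n) ≤ covConst T q * e := by gcongr
  have k2 : 4 * T * (Δ / (n : ℝ) ^ 2) ≤ 4 * T * Δ * e := by
    calc _ = 4 * T * Δ * (1 / (n : ℝ) ^ 2) := by ring
      _ ≤ _ := by gcongr
  have k4 : r ^ 2 * ((12 + 16 * T) * ((2 * T + Δ) / (n : ℝ) ^ 2)) ≤
      (12 + 16 * T) * (2 * T + Δ) * e := by
    have : r ^ 2 ≤ 1 := pow_le_one₀ hr.le hr1
    refine (mul_le_of_le_one_left (by positivity) this).trans ?_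
    calc _ = (12 + 16 * T) * (2 * T + Δ) * (1 / (n : ℝ) ^ 2) := by ring
      _ ≤ _ := by gcongr
  have k5 : ‖(τ α : ℂ) * ((Y - a₁ * a₂ * (r ^ 2 * (x₁ * x₂ ^ 2))) +
        (a₁ * a₂ * (r ^ 2 * (x₁ * x₂ ^ 2)) - b₁ * b₂ * (r ^ 2 * (w₁ * w₂ ^ 2))))‖ ≤
      T * (36 * ((T + 1) * flucConst T q) * e + (12 + 16 * T) * (2 * T + Δ) * e) := by
    rw [norm_mul, Complex.norm_real]
    exact mul_le_mul (hτ α) ((norm_add_le _ _).trans (add_le_add f3 (f4.trans k4)))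
      (norm_nonneg _) hT
  refine (norm_sub_le _ _).trans ((add_le_add ((norm_add_le _ _).trans
    (add_le_add (f1.trans k1) (f2.trans k2))) k5).trans (le_of_eq ?_))
  unfold termConst
  ring

/-- The resolvent identity at `z₁` is paired with `L (G(z₂))`. Since `L` is adjoint to itself and
fixes the identity, it preserves traces, whence the term with the normalized trace at `z₂`. -/
lemma PairingMap.meanTr_pairMat_equation (hL : PairingMap n r L) (hz₁ : Far T z₁)
    (hz₂ : Far T z₂) (hτ : ∀ α, |τ α| ≤ T) :
    z₁ * meanTr (n := n) (pairMat L τ Finset.univ z₁ z₂) = -meanRes n τ Finset.univ z₂ +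
      ((n : ℂ) ^ 2)⁻¹ * ∑ α, τ α * ∫ ω, (denom τ Finset.univ α z₁ ω)⁻¹ *
        (resVec τ Finset.univ α z₁ ω ⬝ᵥ
          (L (resolventOn τ Finset.univ z₂ ω) *ᵥ tensorVec ω α)) ∂(law n m) := by
  have hc : ∀ α, Continuous fun ω : Sample n m => (τ α : ℂ) * ((denom τ Finset.univ α z₁ ω)⁻¹ *
      (resVec τ Finset.univ α z₁ ω ⬝ᵥ
        (L (resolventOn τ Finset.univ z₂ ω) *ᵥ tensorVec ω α))) := fun α =>
    continuous_const.mul ((continuous_denom_inv (n := n) hz₁ hτ _ α).mul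
      (continuous_first_term hz₁ hz₂ _ _ α))
  have ht : Continuous fun ω : Sample n m => -(resolventOn τ Finset.univ z₂ ω).trace :=
    (continuous_trace (continuous_resolventOn (n := n) τ Finset.univ hz₂.im_ne_zero)).neg
  have hpt : ∀ ω : Sample n m, z₁ * (pairMat L τ Finset.univ z₁ z₂ ω).trace =
      -(resolventOn τ Finset.univ z₂ ω).trace + ∑ α, τ α * ((denom τ Finset.univ α z₁ ω)⁻¹ *
      (resVec τ Finset.univ α z₁ ω ⬝ᵥ
        (L (resolventOn τ Finset.univ z₂ ω) *ᵥ tensorVec ω α))) := by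
    intro ω
    have h1 : (L (resolventOn τ Finset.univ z₂ ω)).trace =
        (resolventOn τ Finset.univ z₂ ω).trace := by
      have := hL.trace_adj (resolventOn τ Finset.univ z₂ ω) 1
      rwa [hL.map_one, Matrix.mul_one, Matrix.mul_one] at this
    rw [pairMat, Matrix.trace_mul_comm, trace_mul_resolventOn hz₁ hτ, h1]
    simp only [mul_assoc]
  rw [meanRes, meanTr, meanTr, mul_left_comm, ← integral_const_mul]
  simp_rw [hpt]
  rw [integral_add (integrable_of_continuous ht)
    (integrable_finsetSum _ fun α _ => integrable_of_continuous (hc α)),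
    integral_finsetSum _ fun α _ => integrable_of_continuous (hc α), integral_neg]
  simp_rw [integral_const_mul]
  ring

/-- The constant in the rate of convergence of the pairings. -/
def pairLimitConst (T q c C K : ℝ) : ℝ :=
  traceConst T q c C K + q * (T * termConst T q (traceConst T q c C K)) +
    (K + 2 * c * C) * (2 * T) + (K + 2 * c * C) * (4 * T ^ 2)

set_option maxHeartbeats 800000 in
/-- The limit of the pairings, with the rate. -/
theorem PairingMap.norm_meanTr_sub_le_limit (hL : PairingMap n r L) (hr : 0 < r) (hr1 : r ≤ 1)
    (hrn : (n : ℝ)⁻¹ ≤ r ^ 2) (h₁ : LimitPoint σ T c z₁ w₁) (h₂ : LimitPoint σ T c z₂ w₂)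
    (hd : WeightData n m τ σ T c C K) (hm : (m : ℝ) ≤ q * (n : ℝ) ^ 2) :
    ‖meanTr (n := n) (pairMat L τ Finset.univ z₁ z₂) - (w₁ * w₂ + r ^ 2 *
      ∫ t : ℝ, (c : ℂ) * (t : ℂ) ^ 2 * w₁ ^ 2 * w₂ ^ 2 / ((1 + t * w₁) * (1 + t * w₂)) ∂σ)‖ ≤
      pairLimitConst T q c C K * (r ^ 2 / √n) := by
  have hn : (0 : ℝ) < (n : ℝ) ^ 2 := pow_pos natCast_pos_of_neZero 2
  have hτ := hd.abs_le
  have hT := hd.hT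
  have hq := nonneg_of_card_le hm
  have hne : ∀ {z w : ℂ}, LimitPoint σ T c z w → ∀ t ∈ Set.Icc 0 T, (1 + t * w : ℂ) ≠ 0 :=
    fun h t ht => ne_zero_of_half_le (h.half_le ht)
  set P := meanTr (n := n) (pairMat L τ Finset.univ z₁ z₂) with hP
  have hP1 : ‖P‖ ≤ 1 := hL.norm_meanTr_pairMat_le h₁.far h₂.far _
  set F := meanRes n τ Finset.univ z₂
  set E : Fin m → ℂ := fun α => ∫ ω, (denom τ Finset.univ α z₁ ω)⁻¹ *
    (resVec τ Finset.univ α z₁ ω ⬝ᵥ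
      (L (resolventOn τ Finset.univ z₂ ω) *ᵥ tensorVec ω α)) ∂(law n m) with hE
  have heq : z₁ * P = -F + ((n : ℂ) ^ 2)⁻¹ * ∑ α, τ α * E α :=
    hL.meanTr_pairMat_equation h₁.far h₂.far hτ
  have hterm : ∀ α, ‖E α - ((1 + τ α * w₁)⁻¹ * P -
      τ α * ((1 + τ α * w₁)⁻¹ * (1 + τ α * w₂)⁻¹ * (r ^ 2 * (w₁ * w₂ ^ 2))))‖ ≤
      termConst T q (traceConst T q c C K) * (r ^ 2 / √n) :=
    fun α => hL.norm_integral_term_sub_le hr hr1 hrn h₁ h₂ hd hm α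
  clear_value P E
  set e := r ^ 2 / √n with he
  set κ := termConst T q (traceConst T q c C K) with hκ
  set f₁ : ℝ → ℂ := fun t => t * (1 + t * w₁ : ℂ)⁻¹ with hf₁
  set f₂ : ℝ → ℂ := fun t => t ^ 2 * (w₁ * w₂ ^ 2) * ((1 + t * w₁ : ℂ)⁻¹ * (1 + t * w₂ : ℂ)⁻¹)
    with hf₂
  have hb : ∀ {z w : ℂ}, LimitPoint σ T c z w → ∀ t ∈ Set.Icc 0 T, ‖(1 + t * w : ℂ)⁻¹‖ ≤ 2 :=
    fun h t ht => norm_inv_le_two (h.half_le ht)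
  have hci : ∀ {z w : ℂ}, LimitPoint σ T c z w →
      ContinuousOn (fun t : ℝ => (1 + t * w : ℂ)⁻¹) (Set.Icc 0 T) :=
    fun h => ContinuousOn.inv₀ (by fun_prop) (hne h)
  have c₁ : ContinuousOn f₁ (Set.Icc 0 T) := ContinuousOn.mul (by fun_prop) (hci h₁)
  have c₂ : ContinuousOn f₂ (Set.Icc 0 T) :=
    ContinuousOn.mul (by fun_prop) ((hci h₁).mul (hci h₂))
  have s1 : ‖((n : ℂ) ^ 2)⁻¹ * ∑ α, f₁ (τ α) - c * ∫ t, f₁ t ∂σ‖ ≤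
      (K + 2 * c * C) * (2 * T) / (n : ℝ) ^ 2 := by
    refine hd.norm_sum_sub_le c₁ fun t ht => ?_
    rw [hf₁]
    simp only
    rw [norm_mul, Complex.norm_real, Real.norm_of_nonneg ht.1, mul_comm]
    exact mul_le_mul (hb h₁ t ht) ht.2 ht.1 (by norm_num)
  have s2 : ‖((n : ℂ) ^ 2)⁻¹ * ∑ α, f₂ (τ α) - c * ∫ t, f₂ t ∂σ‖ ≤
      (K + 2 * c * C) * (4 * T ^ 2) / (n : ℝ) ^ 2 := by
    refine hd.norm_sum_sub_le c₂ fun t ht => ?_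
    simp only [hf₂, norm_mul, norm_pow, Complex.norm_real, Real.norm_of_nonneg ht.1]
    have b1 := hb h₁ t ht
    have b2 := hb h₂ t ht
    have n1 := h₁.norm_le_one
    have n2 := h₂.norm_le_one
    have ht0 := ht.1
    have htT := ht.2
    calc _ ≤ T ^ 2 * (1 * 1 ^ 2) * (2 * 2) := by gcongr
      _ = _ := by ring
  have t1 := h₂.norm_meanRes_sub_le hd hm
  have hκ0 : 0 ≤ κ :=
    termConst_nonneg hT hm (nonneg_of_le_div_sq (n := n) ((norm_nonneg _).trans t1))
  set I₁ := ∫ t, f₁ t ∂σ with hI₁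
  set I₂ := ∫ t, f₂ t ∂σ with hI₂
  have hw : z₁ * w₁ = -1 + w₁ * (c * I₁) := by
    have e1 : ∫ t : ℝ, t * w₁ / (1 + t * w₁) ∂σ = w₁ * I₁ := by
      rw [hI₁, ← integral_const_mul]
      refine integral_congr_ae (Eventually.of_forall fun t => ?_)
      simp only [hf₁]
      rw [div_eq_mul_inv]; ring
    rw [h₁.equation, e1]
    ring
  have hS : ∫ t : ℝ, (c : ℂ) * (t : ℂ) ^ 2 * w₁ ^ 2 * w₂ ^ 2 /
      ((1 + t * w₁) * (1 + t * w₂)) ∂σ = w₁ * (c * I₂) := by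
    rw [hI₂, ← mul_assoc, ← integral_const_mul]
    refine integral_congr_ae (Eventually.of_forall fun t => ?_)
    simp only
    rw [hf₂, div_eq_mul_inv, mul_inv]; ring
  have hsum : ((n : ℂ) ^ 2)⁻¹ * ∑ α, τ α * ((1 + τ α * w₁)⁻¹ * P -
      τ α * ((1 + τ α * w₁)⁻¹ * (1 + τ α * w₂)⁻¹ * (r ^ 2 * (w₁ * w₂ ^ 2)))) =
      P * (((n : ℂ) ^ 2)⁻¹ * ∑ α, f₁ (τ α)) -
        r ^ 2 * (((n : ℂ) ^ 2)⁻¹ * ∑ α, f₂ (τ α)) := by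
    rw [mul_left_comm P, mul_left_comm ((r : ℂ) ^ 2) (((n : ℂ) ^ 2)⁻¹), ← mul_sub]
    congr 1
    rw [Finset.mul_sum, Finset.mul_sum, ← Finset.sum_sub_distrib]
    refine Finset.sum_congr rfl fun α _ => ?_
    simp only [hf₁, hf₂]
    ring
  have s3 : ‖((n : ℂ) ^ 2)⁻¹ * ∑ α, τ α * (E α - ((1 + τ α * w₁)⁻¹ * P -
      τ α * ((1 + τ α * w₁)⁻¹ * (1 + τ α * w₂)⁻¹ * (r ^ 2 * (w₁ * w₂ ^ 2)))))‖ ≤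
      q * (T * κ) * e := by
    rw [norm_mul, norm_natCast_sq_inv, inv_mul_le_iff₀ hn]
    have hb0 : ∀ α, ‖(τ α : ℂ) * (E α - ((1 + τ α * w₁)⁻¹ * P -
      τ α * ((1 + τ α * w₁)⁻¹ * (1 + τ α * w₂)⁻¹ * (r ^ 2 * (w₁ * w₂ ^ 2)))))‖ ≤
        T * (κ * e) := fun α => by
      rw [norm_mul, Complex.norm_real]
      exact mul_le_mul (hτ α) (hterm α) (norm_nonneg _) hT
    have h4 := (norm_sum_le Finset.univ _).trans (Finset.sum_le_sum fun α _ => hb0 α)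
    rw [Finset.sum_const, Finset.card_univ, Fintype.card_fin, nsmul_eq_mul] at h4
    refine h4.trans ?_
    calc (m : ℝ) * (T * (κ * e)) ≤ q * (n : ℝ) ^ 2 * (T * (κ * e)) := by gcongr
      _ = _ := by ring
  simp_rw [mul_sub (τ _ : ℂ) (E _)] at s3
  rw [Finset.sum_sub_distrib, mul_sub, hsum] at s3
  -- Multiplying the approximate equation `z₁ P = -w₂ + P c I₁ - r² c I₂` by `w₁` and inserting the
  -- equation of `w₁` eliminates `z₁` and `I₁`. No division occurs, and the error is only multiplied
  -- by `w₁`, of modulus at most `1`.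
  have herr : P - (w₁ * w₂ + r ^ 2 * (w₁ * (c * I₂))) = -(w₁ *
      (z₁ * P + w₂ - P * (c * I₁) + r ^ 2 * (c * I₂))) := by
    have : w₁ * (z₁ * P) = P * (z₁ * w₁) := by ring
    rw [mul_add, mul_sub, mul_add, this, hw]
    ring
  have hsplit : z₁ * P + w₂ - P * (c * I₁) + r ^ 2 * (c * I₂) = -(F - w₂) +
      (((n : ℂ) ^ 2)⁻¹ * ∑ α, τ α * E α - (P * (((n : ℂ) ^ 2)⁻¹ * ∑ α, f₁ (τ α)) -
        r ^ 2 * (((n : ℂ) ^ 2)⁻¹ * ∑ α, f₂ (τ α)))) +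
      P * (((n : ℂ) ^ 2)⁻¹ * ∑ α, f₁ (τ α) - c * I₁) -
      r ^ 2 * (((n : ℂ) ^ 2)⁻¹ * ∑ α, f₂ (τ α) - c * I₂) := by
    rw [heq]; ring
  have hne2 := inv_sq_le_error hr hr1 hrn
  have conv : ∀ {x a : ℝ}, 0 ≤ x → x ≤ a / (n : ℝ) ^ 2 → x ≤ a * e := by
    intro x a hx h
    have ha := nonneg_of_le_div_sq (n := n) (hx.trans h)
    refine h.trans ?_
    rw [div_eq_mul_one_div]
    gcongr
  have hr2 : ‖(r : ℂ) ^ 2‖ ≤ 1 := by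
    rw [norm_pow, Complex.norm_real, Real.norm_of_nonneg hr.le]
    exact pow_le_one₀ hr.le hr1
  rw [hS, herr, norm_neg, norm_mul]
  refine (mul_le_of_le_one_left (norm_nonneg _) h₁.norm_le_one).trans ?_
  rw [hsplit]
  have u1 := conv (norm_nonneg _) t1
  have u2 : ‖P * (((n : ℂ) ^ 2)⁻¹ * ∑ α, f₁ (τ α) - c * I₁)‖ ≤
      (K + 2 * c * C) * (2 * T) * e := by
    rw [norm_mul]
    exact (mul_le_of_le_one_left (norm_nonneg _) hP1).trans (conv (norm_nonneg _) s1)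
  have u3 : ‖(r : ℂ) ^ 2 * (((n : ℂ) ^ 2)⁻¹ * ∑ α, f₂ (τ α) - c * I₂)‖ ≤
      (K + 2 * c * C) * (4 * T ^ 2) * e := by
    rw [norm_mul]
    exact (mul_le_of_le_one_left (norm_nonneg _) hr2).trans (conv (norm_nonneg _) s2)
  rw [← norm_neg (F - w₂)] at u1
  refine (norm_sub_le _ _).trans ((add_le_add ((norm_add_le _ _).trans (add_le_add
    ((norm_add_le _ _).trans (add_le_add u1 s3)) u2)) u3).trans (le_of_eq ?_))
  unfold pairLimitConst
  ring

end PairingLimit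

/-! ### Identification of the quantities of the theorem, and its assembly. -/

section Main

variable {n m : ℕ} [NeZero n] {T : ℝ} {τ : Fin m → ℝ} {z₁ z₂ : ℂ}

lemma resolventOn_symm (τ : Fin m → ℝ) (S : Finset (Fin m)) (z : ℂ) (ω : Sample n m)
    (x y : Fin n × Fin n) : resolventOn τ S z ω x y = resolventOn τ S z ω y x := by
  conv_lhs => rw [← transpose_resolventOn, Matrix.transpose_apply]

/-- The prefactor `n⁻³` splits into `n⁻²` of the normalized trace and `n⁻¹` of the reduced partial
trace; symmetry of the resolvent matches the indices. -/
lemma expect_g1 : expect (n := n) (g1 τ z₁ z₂) =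
    meanTr (n := n) (pairMat (reduceMap n) τ Finset.univ z₁ z₂) := by
  rw [expect, meanTr, ← integral_const_mul]
  refine integral_congr_ae (Eventually.of_forall fun ω => ?_)
  simp only
  rw [g1, pairMat, Matrix.trace_mul_comm, trace_reduceMap_mul, ← mul_assoc, ← mul_inv, ← pow_succ]
  congr 1
  simp only [Matrix.trace, Matrix.diag, Matrix.mul_apply, ptrR, G, Finset.sum_mul_sum]
  refine Finset.sum_congr rfl fun j _ => ?_
  rw [Finset.sum_comm]
  refine Finset.sum_congr rfl fun p _ => ?_
  rw [Finset.sum_comm]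
  refine Finset.sum_congr rfl fun q _ => Finset.sum_congr rfl fun s _ => ?_
  rw [resolventOn_symm τ _ z₁ ω (j, s), mul_comm]

lemma expect_g2 : expect (n := n) (g2 τ z₁ z₂) =
    meanTr (n := n) (pairMat (transposeMap n) τ Finset.univ z₁ z₂) := by
  rw [expect, meanTr, ← integral_const_mul]
  refine integral_congr_ae (Eventually.of_forall fun ω => ?_)
  simp only
  rw [g2, pairMat]
  congr 1
  simp only [Matrix.trace, Matrix.diag, Matrix.mul_apply, transposeMap_apply, G,
    Fintype.sum_prod_type]
  refine Finset.sum_congr rfl fun j _ => Finset.sum_congr rfl fun s _ =>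
    Finset.sum_congr rfl fun p _ => Finset.sum_congr rfl fun q _ => ?_
  rw [resolventOn_symm τ _ z₂ ω (p, s)]

lemma IsLimitStieltjes.limitPoint {c : ℝ} {σ : Measure ℝ} [IsProbabilityMeasure σ] {f : ℂ → ℂ}
    (hf : IsLimitStieltjes c σ f) (hc : 0 ≤ c) (hT : 0 ≤ T) (hσ : ∀ᵐ t ∂σ, t ∈ Set.Icc 0 T)
    {z : ℂ} (hz : 1 + 2 * T + 8 * c * T < |z.im|) : LimitPoint σ T c z (f z) := by
  have hcT : 0 ≤ c * T := mul_nonneg hc hT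
  have hfar : Far T z := ⟨by linarith, by linarith⟩
  have h := limit_equation hc hT hσ hfar.im_ne_zero (hf.im_nonneg z hfar.im_ne_zero)
    (hf.equation z hfar.im_ne_zero)
  exact ⟨hfar, by linarith, h.1, h.2⟩

lemma inv_sqrt_rpow : (n : ℝ) ^ (-(1 / 2) : ℝ) = 1 / √(n : ℝ) := by
  rw [Real.rpow_neg n.cast_nonneg, ← Real.sqrt_eq_rpow, one_div]

lemma inv_mul_inv_sqrt_rpow : (n : ℝ) ^ (-(3 / 2) : ℝ) = (n : ℝ)⁻¹ / √(n : ℝ) := by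
  have hn : (0 : ℝ) < n := natCast_pos_of_neZero
  have e : (-(3 / 2) : ℝ) = -1 + -(1 / 2) := by norm_num
  rw [e, Real.rpow_add hn, inv_sqrt_rpow, Real.rpow_neg_one]
  ring

end Main

end TensorSampleCov

end

open TensorSampleCov in
theorem lemma1 (c T : ℝ) (hc : 0 < c) (hT : 0 < T) :
    ∃ η₀ : ℝ, 0 < η₀ ∧ ∀ C K : ℝ, ∃ D : ℝ,
      ∀ (m : ℕ → ℕ) (τ : (n : ℕ) → Fin (m n) → ℝ) (σ : Measure ℝ) (f : ℂ → ℂ),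
        IsProbabilityMeasure σ →
        Tendsto (fun n : ℕ => (m n : ℝ) / (n : ℝ) ^ 2) atTop (𝓝 c) →
        ConditionA m τ σ T C →
        IsLimitStieltjes c σ f →
        -- (i)
        (∀ᶠ n : ℕ in atTop, ∀ z : ℂ, η₀ < |z.im| →
          (∀ α : Fin (m n),
            var (n := n) (A (τ n) α z) ≤ D / (n : ℝ) ^ 2 ∧
            var (n := n) (B (τ n) α z) ≤ D / (n : ℝ) ^ 2) ∧
          var (n := n) (gam (τ n) z) ≤ D) ∧
        ((∀ n : ℕ, 1 ≤ n → |(m n : ℝ) - c * (n : ℝ) ^ 2| ≤ K) →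
          -- (ii)
          (∀ᶠ n : ℕ in atTop, ∀ z : ℂ, η₀ < |z.im| →
            ‖expect (n := n) (g (τ n) z) - f z‖ ≤ D / (n : ℝ) ^ 2) ∧
          -- (iii)
          (∀ᶠ n : ℕ in atTop, ∀ z₁ z₂ : ℂ, η₀ < |z₁.im| → η₀ < |z₂.im| →
            ‖expect (n := n) (g1 (τ n) z₁ z₂) -
                (f z₁ * f z₂ + (1 / (n : ℂ)) * sigmaIntegral c σ f z₁ z₂)‖
              ≤ D * (n : ℝ) ^ (-(3 / 2) : ℝ)) ∧
          -- (iv)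
          (∀ᶠ n : ℕ in atTop, ∀ z₁ z₂ : ℂ, η₀ < |z₁.im| → η₀ < |z₂.im| →
            ‖expect (n := n) (g2 (τ n) z₁ z₂) -
                (f z₁ * f z₂ + sigmaIntegral c σ f z₁ z₂)‖
              ≤ D * (n : ℝ) ^ (-(1 / 2) : ℝ))) := by
  -- The three summands serve the contraction property of resolvents, the bound of the denominators
  -- from below, and the stability of the limiting equation.
  refine ⟨1 + 2 * T + 8 * c * T, by positivity, fun C K => ?_⟩
  -- Any number larger than `c` bounds `m / n²` eventually. Part (i) uses nothing more about `m`, so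
  -- its constants do not involve `K`.
  set q := 2 * c with hq
  set D₁ := T ^ 2 * flucConst T q with hD₁
  set D₂ := q * (8 + 32 * T ^ 2) * D₁ with hD₂
  set D₃ := traceConst T q c C K with hD₃
  set D₄ := pairLimitConst T q c C K with hD₄
  refine ⟨max (max D₁ D₂) (max D₃ D₄), fun m τ σ f hσp hlim hA hf => ?_⟩
  set D := max (max D₁ D₂) (max D₃ D₄)
  have h1 : D₁ ≤ D := (le_max_left _ _).trans (le_max_left _ _)
  have h2 : D₂ ≤ D := (le_max_right _ _).trans (le_max_left _ _)
  have h3 : D₃ ≤ D := (le_max_left _ _).trans (le_max_right _ _)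
  have h4 : D₄ ≤ D := (le_max_right _ _).trans (le_max_right _ _)
  have hcT : 0 < c * T := mul_pos hc hT
  have hev : ∀ᶠ n : ℕ in atTop, 1 ≤ n ∧ (m n : ℝ) ≤ q * (n : ℝ) ^ 2 := by
    filter_upwards [eventually_ge_atTop 1, hlim.eventually_le_const (by linarith : c < q)]
      with n hn h
    have : (0 : ℝ) < n := by exact_mod_cast hn
    exact ⟨hn, (div_le_iff₀ (by positivity)).1 h⟩
  have hsupp := hA.ae_mem_Icc hT.le
  have hτ : ∀ n α, |τ n α| ≤ T := fun n α => by
    rw [abs_of_nonneg (hA.nonneg n α)]; exact hA.le_bound n α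
  have hpt : ∀ z : ℂ, 1 + 2 * T + 8 * c * T < |z.im| → LimitPoint σ T c z (f z) :=
    fun z hz => hf.limitPoint hc.le hT.le hsupp hz
  refine ⟨?_, fun hK => ?_⟩
  · filter_upwards [hev] with n ⟨hn, hm⟩ z hz
    have : NeZero n := ⟨by omega⟩
    have hfar := (hpt z hz).far
    refine ⟨fun α => ⟨(var_A_le hfar (hτ n) hm α).trans ?_,
      (var_B_le hfar (hτ n) hm α).trans ?_⟩, (var_gam_le hfar (hτ n) hm).trans h2⟩ <;> gcongr
  have hdata : ∀ n : ℕ, 1 ≤ n → WeightData n (m n) (τ n) σ T c C K := fun n hn =>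
    ⟨hT.le, hc.le, hsupp, fun α => ⟨hA.nonneg n α, hA.le_bound n α⟩, hA.rate n hn, hK n hn⟩
  refine ⟨?_, ?_, ?_⟩
  · filter_upwards [hev] with n ⟨hn, hm⟩ z hz
    have : NeZero n := ⟨by omega⟩
    rw [expect_g]
    refine ((hpt z hz).norm_meanRes_sub_le (hdata n hn) hm).trans ?_
    gcongr
  · filter_upwards [hev] with n ⟨hn, hm⟩ z₁ z₂ hz₁ hz₂
    have : NeZero n := ⟨by omega⟩
    have hn0 : (0 : ℝ) < n := natCast_pos_of_neZero
    have hr : ((√(n : ℝ))⁻¹) ^ 2 = (n : ℝ)⁻¹ := by rw [inv_pow, Real.sq_sqrt hn0.le]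
    have hrC : (((√(n : ℝ))⁻¹ : ℝ) : ℂ) ^ 2 = 1 / (n : ℂ) := by
      rw [← Complex.ofReal_pow, hr]; simp
    have hr1 : (√(n : ℝ))⁻¹ ≤ 1 :=
      inv_le_one_of_one_le₀ (Real.one_le_sqrt.2 (by exact_mod_cast hn))
    -- For `r² = 1/n` the requirement `n⁻¹ ≤ r²` is an equality, and the error `r² / √n` is
    -- `n^{-3/2}`.
    have h := pairingMap_reduceMap.norm_meanTr_sub_le_limit (by positivity) hr1 hr.ge
      (hpt z₁ hz₁) (hpt z₂ hz₂) (hdata n hn) hm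
    rw [hrC, hr] at h
    rw [expect_g1, sigmaIntegral, inv_mul_inv_sqrt_rpow]
    refine h.trans ?_
    gcongr
  · filter_upwards [hev] with n ⟨hn, hm⟩ z₁ z₂ hz₁ hz₂
    have : NeZero n := ⟨by omega⟩
    have h := pairingMap_transposeMap.norm_meanTr_sub_le_limit one_pos le_rfl
      (by rw [one_pow]; exact inv_le_one_of_one_le₀ (by exact_mod_cast hn))
      (hpt z₁ hz₁) (hpt z₂ hz₂) (hdata n hn) hm
    rw [Complex.ofReal_one, one_pow, one_pow, one_mul] at h
    rw [expect_g2, sigmaIntegral, inv_sqrt_rpow]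
    refine h.trans ?_
    gcongr
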